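/- All graphs are finite, undirected and simple. For a subgraph $H$ of a graph $G$, the support $\sup_H(e)$ of an edge $e$ of $H$ is the number of triangles of $H$ that contain $e$; $H$ is a $k$-truss if $\sup_H(e)\ge k-2$ for every edge $e$ of $H$; and, if $H$ has an edge, its trussness is $\tau(H)=2+\min_{e\in E(H)}\sup_H(e)$. The trussness of an edge $e$ of $G$ is the largest $\tau(H)$ over the subgraphs $H\subseteq G$ that contain $e$. For a set $Q$ of vertices put $\mathrm{dist}_H(v,Q)=\max_{q\in Q}\mathrm{dist}_H(v,q)$ and $\mathrm{dist}_H(H,Q)=\max_{v\in V(H)}\mathrm{dist}_H(v,Q)$. Let $G$ be a connected graph with at least two vertices and $\emptyset\ne Q\subseteq V(G)$. Algorithm Basic works as follows. Let $k$ be the largest trussness of a connected subgraph of $G$ (with at least one edge) that contains $Q$, and let $G_0$ be the maximal connected $k$-truss of $G$ that contains $Q$. For $l=0,1,\dots$, as long as all vertices of $Q$ lie in $G_l$ and are connected to each other in $G_l$: choose a vertex $u^*_l$ of $G_l$ with maximum $\mathrm{dist}_{G_l}(u^*_l,Q)$, delete $u^*_l$ and its incident edges from $G_l$, then delete edges that lie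 in fewer than $k-2$ triangles as long as there are any, then the isolated vertices and everything that is not connected to a vertex of $Q$; call the result $G_{l+1}$. Let $t$ be the number of iterations carried out. Return $R=G_r$ for some $r<t$ that minimizes $\mathrm{dist}_{G_r}(G_r,Q)$. (Ties may be broken arbitrarily.) Let $n'=|V(G_0)|$, $m'=|E(G_0)|$, let $d'_{\max}$ be the maximum degree of $G_0$, and let $\rho$ be the arboricity of $G_0$, i.e. the least number of spanning forests that cover all edges of $G_0$. Theorem. Suppose that the truss index of $G$ is given: for every vertex, its degree, its trussness (the maximum trussness of an incident edge), its list of neighbours in descending order of the trussness of the connecting edge and, for every trussness value in the list, the position of its first occurrence; and a hash table from which the trussness of the edge $uv$ (or the absence of such an edge) is obtained from $u,v$ in one step. Then Algorithm Basic can be carried out in $O((|Q|\,t+\rho)\,m')$ time and $O(m')$ space. That is, there are a fixed program for a random access machine with words of $O(\log n)$ bits, $n=|V(G)|$, and unit cost per instruction, and an absolute constant $C$, such that for all $G$, $Q$ and every truss index of $G$ as read-only input, the program executes Algorithm Basic (for some way of breaking ties) and outputs $k$, $t$, $r$, the vertices $u^*_l$, the values $\mathrm{dist}_{G_l}(G_l,Q)$,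 and the edges of $G_0$, each labelled so that the label tells which of the graphs $G_0,\dots,G_{t-1}$ contain it; it halts after at most $C(|Q|\,t+\rho)m'$ steps, and it reads or writes at most $Cm'$ memory cells. Moreover, for every execution of Algorithm Basic on $G$ and $Q$, the number of iterations satisfies $t\le C\min\{n',m'/k\}$, and $\rho\le\min\{d'_{\max},\sqrt{m'}\}$, except that if $G_0$ is a triangle only $\rho\le d'_{\max}$ is claimed. -/

import Mathlib

/-! # Trusses, the greedy truss-community algorithm, and a word RAM -/

namespace CTC

section Graph

variable {V : Type*} {G : SimpleGraph V}

/-! ## Trusses -/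

/-- Number of triangles of `H` through the pair `u`, `v`: the common neighbours of `u` and `v`. -/
noncomputable def sup (H : G.Subgraph) (u v : V) : ℕ :=
  (H.neighborSet u ∩ H.neighborSet v).ncard

/-- `H` is a `k`-truss: every edge of `H` has support at least `k - 2` in `H`. -/
def IsTruss (k : ℕ) (H : G.Subgraph) : Prop :=
  ∀ u v, H.Adj u v → k ≤ sup H u v + 2

/-- `H` is a connected `k`-truss. -/
def IsConnectedTruss (k : ℕ) (H : G.Subgraph) : Prop :=
  H.Connected ∧ IsTruss k H

/-- Trussness of a subgraph (meaningful when `H` has an edge): two plus the minimum support. -/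
noncomputable def trussness (H : G.Subgraph) : ℕ :=
  2 + sInf {s | ∃ u v, H.Adj u v ∧ s = sup H u v}

/-- Trussness of the edge `uv` of `G`: the largest trussness of a subgraph that contains it. -/
noncomputable def edgeTrussness (G : SimpleGraph V) (u v : V) : ℕ :=
  sSup {k | ∃ H : G.Subgraph, H.Adj u v ∧ k = trussness H}

/-- The largest trussness of a connected subgraph (with an edge) that contains `Q`. -/
noncomputable def maxTrussness (G : SimpleGraph V) (Q : Finset V) : ℕ :=
  sSup {k | ∃ H : G.Subgraph,
    H.Connected ∧ H.edgeSet.Nonempty ∧ (Q : Set V) ⊆ H.verts ∧ k = trussness H}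

/-- `H` is a maximal connected `k`-truss containing `Q`. -/
def IsMaxConnectedTruss (k : ℕ) (Q : Finset V) (H : G.Subgraph) : Prop :=
  Maximal (fun K : G.Subgraph => IsConnectedTruss k K ∧ (Q : Set V) ⊆ K.verts) H

/-! ## Distances -/

/-- Vertex query distance in `H`: the largest distance in `H` from `v` to a query vertex
(`⊤` if some query vertex cannot be reached). -/
noncomputable def queryDist (H : G.Subgraph) (Q : Finset V) (v : V) : ℕ∞ :=
  ⨆ q ∈ Q, H.spanningCoe.edist v q

/-- Graph query distance of `H`. -/
noncomputable def graphQueryDist (H : G.Subgraph) (Q : Finset V) : ℕ∞ :=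
  ⨆ v ∈ H.verts, queryDist H Q v

/-! ## Size parameters -/

/-- Number of vertices of `H`. -/
noncomputable def numVerts (H : G.Subgraph) : ℕ := H.verts.ncard

/-- Number of edges of `H`. -/
noncomputable def numEdges (H : G.Subgraph) : ℕ := H.edgeSet.ncard

/-- Maximum degree of a vertex in `H`. -/
noncomputable def maxDeg [Fintype V] (H : G.Subgraph) : ℕ :=
  Finset.univ.sup fun v => (H.neighborSet v).ncard

/-- Arboricity: the least number of spanning forests that cover all edges of `H`. -/
noncomputable def arboricity (H : G.Subgraph) : ℕ :=
  sInf {r | ∃ F : Fin r → SimpleGraph V,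
    (∀ i, F i ≤ H.spanningCoe ∧ (F i).IsAcyclic) ∧
    ∀ u v, H.Adj u v → ∃ i, (F i).Adj u v}

/-! ## The greedy algorithm -/

/-- All vertices of `Q` lie in `H` and are connected to each other in `H`. -/
def Connects (H : G.Subgraph) (Q : Finset V) : Prop :=
  (Q : Set V) ⊆ H.verts ∧ ∀ p ∈ Q, ∀ q ∈ Q, H.spanningCoe.Reachable p q

/-- What remains of `H` when edges of support less than `k - 2` are deleted as long as there are
any, and isolated vertices are then removed: the largest `k`-truss in `H` without isolated
vertices. -/
def trussPart (k : ℕ) (H : G.Subgraph) : G.Subgraph :=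
  sSup {K | K ≤ H ∧ IsTruss k K ∧ ∀ v ∈ K.verts, ∃ w, K.Adj v w}

/-- Remove from `H` the vertices that are not connected in `H` to a vertex of `Q`. -/
def queryPart (Q : Finset V) (H : G.Subgraph) : G.Subgraph :=
  H.induce {v | v ∈ H.verts ∧ ∃ q ∈ Q, q ∈ H.verts ∧ H.spanningCoe.Reachable q v}

/-- One deletion step: delete the vertex `u` with its incident edges, restore the `k`-truss
property, and drop what is no longer connected to the query vertices. -/
def deleteStep (k : ℕ) (Q : Finset V) (H : G.Subgraph) (u : V) : G.Subgraph :=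
  queryPart Q (trussPart k (H.deleteVerts {u}))

/-- A complete execution of the greedy algorithm on `G` and `Q`. Ties in the choice of the farthest
vertex and of the best graph are broken arbitrarily. -/
structure BasicRun (G : SimpleGraph V) (Q : Finset V) where
  /-- the trussness level -/
  k : ℕ
  /-- the number of iterations of the while loop -/
  t : ℕ
  /-- the graph held by the algorithm after `i` iterations -/
  graph : ℕ → G.Subgraph
  /-- the vertex deleted in iteration `i` -/
  far : ℕ → V
  /-- the index of the graph that is returned -/
  best : ℕ
  k_eq : k = maxTrussness G Q
  graph_zero : IsMaxConnectedTruss k Q (graph 0)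
  connects : ∀ i < t, Connects (graph i) Q
  far_mem : ∀ i < t, far i ∈ (graph i).verts
  far_max : ∀ i < t, ∀ v ∈ (graph i).verts,
    queryDist (graph i) Q v ≤ queryDist (graph i) Q (far i)
  graph_succ : ∀ i < t, graph (i + 1) = deleteStep k Q (graph i) (far i)
  stops : ¬ Connects (graph t) Q
  best_lt : best < t
  best_min : ∀ i < t, graphQueryDist (graph best) Q ≤ graphQueryDist (graph i) Q

end Graph

/-! ## A word RAM

Finitely many registers, finitely many zero-initialised arrays of words (array number and index
name a cell), and read-only input tables. All values are natural numbers at most `W`. -/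

/-- The read-only tables: vertex count, the list of query vertices, and the truss index (adjacency
lists, position marks, vertex trussness, and the hash table of edge trussness). -/
inductive Table
  | size
  | numQuery
  | query
  | degree
  | neighbor
  | mark
  | vertexTruss
  | edgeTruss

/-- An input: the entry of each table at a pair of indices (an unused index is `0`). -/
abbrev Input := Table → ℕ → ℕ → ℕ

/-- Arithmetic expressions over registers. -/
inductive Expr
  | lit (c : ℕ)
  | reg (x : ℕ)
  | add (e f : Expr)
  | sub (e f : Expr)
  | mul (e f : Expr)

namespace Expr

/-- Value under a register assignment (subtraction is truncated). -/
def val (s : ℕ → ℕ) : Expr → ℕ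
  | lit c => c
  | reg x => s x
  | add e f => e.val s + f.val s
  | sub e f => e.val s - f.val s
  | mul e f => e.val s * f.val s

/-- Cost of evaluation: the number of symbols. -/
def cost : Expr → ℕ
  | lit _ => 1
  | reg _ => 1
  | add e f => e.cost + f.cost + 1
  | sub e f => e.cost + f.cost + 1
  | mul e f => e.cost + f.cost + 1

/-- All values that occur in the evaluation fit into a word. -/
def Fits (W : ℕ) (s : ℕ → ℕ) : Expr → Prop
  | lit c => c ≤ W
  | reg x => s x ≤ W
  | add e f => e.Fits W s ∧ f.Fits W s ∧ e.val s + f.val s ≤ W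
  | sub e f => e.Fits W s ∧ f.Fits W s
  | mul e f => e.Fits W s ∧ f.Fits W s ∧ e.val s * f.val s ≤ W

end Expr

/-- Programs. `ite e f c d` runs `c` if `e < f` and `d` otherwise; `loop e f c` runs `c` as long as
`e < f`. -/
inductive Com
  | skip
  | assign (x : ℕ) (e : Expr)
  | load (x a : ℕ) (e : Expr)
  | store (a : ℕ) (e f : Expr)
  | input (x : ℕ) (T : Table) (e f : Expr)
  | seq (c d : Com)
  | ite (e f : Expr) (c d : Com)
  | loop (e f : Expr) (c : Com)

/-- Contents of the registers and of the arrays. -/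
structure State where
  reg : ℕ → ℕ
  mem : ℕ → ℕ → ℕ

/-- Everything is zero. -/
def State.zero : State := ⟨fun _ => 0, fun _ _ => 0⟩

/-- Write a register. -/
def State.setReg (s : State) (x v : ℕ) : State :=
  ⟨Function.update s.reg x v, s.mem⟩

/-- Write the cell with index `i` of array `a`. -/
def State.setMem (s : State) (a i v : ℕ) : State :=
  ⟨s.reg, Function.update s.mem a (Function.update (s.mem a) i v)⟩

/-- `Exec inp W c s s' T S`: with word bound `W` and input `inp`, the program `c` started in `s`
halts in `s'` after exactly `T` steps, and `S` is the set of array cells that it has read or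
written. A program that exceeds the word bound has no execution. -/
inductive Exec (inp : Input) (W : ℕ) :
    Com → State → State → ℕ → Finset (ℕ × ℕ) → Prop
  | skip (s : State) : Exec inp W .skip s s 1 ∅
  | assign (s : State) (x : ℕ) (e : Expr) (he : e.Fits W s.reg) :
      Exec inp W (.assign x e) s (s.setReg x (e.val s.reg)) (e.cost + 1) ∅
  | load (s : State) (x a : ℕ) (e : Expr) (he : e.Fits W s.reg)
      (hv : s.mem a (e.val s.reg) ≤ W) :
      Exec inp W (.load x a e) s (s.setReg x (s.mem a (e.val s.reg))) (e.cost + 1)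
        {(a, e.val s.reg)}
  | store (s : State) (a : ℕ) (e f : Expr) (he : e.Fits W s.reg) (hf : f.Fits W s.reg) :
      Exec inp W (.store a e f) s (s.setMem a (e.val s.reg) (f.val s.reg))
        (e.cost + f.cost + 1) {(a, e.val s.reg)}
  | input (s : State) (x : ℕ) (T : Table) (e f : Expr) (he : e.Fits W s.reg)
      (hf : f.Fits W s.reg) (hv : inp T (e.val s.reg) (f.val s.reg) ≤ W) :
      Exec inp W (.input x T e f) s (s.setReg x (inp T (e.val s.reg) (f.val s.reg)))
        (e.cost + f.cost + 1) ∅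
  | seq {c d : Com} {s s' s'' : State} {T T' : ℕ} {S S' : Finset (ℕ × ℕ)}
      (hc : Exec inp W c s s' T S) (hd : Exec inp W d s' s'' T' S') :
      Exec inp W (.seq c d) s s'' (T + T') (S ∪ S')
  | ite_true {e f : Expr} {c d : Com} {s s' : State} {T : ℕ} {S : Finset (ℕ × ℕ)}
      (he : e.Fits W s.reg) (hf : f.Fits W s.reg) (h : e.val s.reg < f.val s.reg)
      (hc : Exec inp W c s s' T S) :
      Exec inp W (.ite e f c d) s s' (e.cost + f.cost + 1 + T) S
  | ite_false {e f : Expr} {c d : Com} {s s' : State} {T : ℕ} {S : Finset (ℕ × ℕ)}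
      (he : e.Fits W s.reg) (hf : f.Fits W s.reg) (h : ¬ e.val s.reg < f.val s.reg)
      (hd : Exec inp W d s s' T S) :
      Exec inp W (.ite e f c d) s s' (e.cost + f.cost + 1 + T) S
  | loop_done {e f : Expr} {c : Com} {s : State}
      (he : e.Fits W s.reg) (hf : f.Fits W s.reg) (h : ¬ e.val s.reg < f.val s.reg) :
      Exec inp W (.loop e f c) s s (e.cost + f.cost + 1) ∅
  | loop_step {e f : Expr} {c : Com} {s s' s'' : State} {T T' : ℕ} {S S' : Finset (ℕ × ℕ)}
      (he : e.Fits W s.reg) (hf : f.Fits W s.reg) (h : e.val s.reg < f.val s.reg)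
      (hc : Exec inp W c s s' T S) (hl : Exec inp W (.loop e f c) s' s'' T' S') :
      Exec inp W (.loop e f c) s s'' (e.cost + f.cost + 1 + T + T') (S ∪ S')

/-! ## Input and output of the algorithm -/

/-- The tables of `inp` hold the truss index of `G`. -/
structure IsTrussIndex {n : ℕ} (G : SimpleGraph (Fin n)) (inp : Input) : Prop where
  size : inp .size 0 0 = n
  degree : ∀ v : Fin n, inp .degree v 0 = (G.neighborSet v).ncard
  /-- `neighbor v 0, …, neighbor v (degree v - 1)` lists the neighbours of `v`, each once -/
  neighbor : ∀ v : Fin n, Set.BijOn (fun j => inp .neighbor v j)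
    (Set.Iio (inp .degree v 0)) ((fun u : Fin n => (u : ℕ)) '' G.neighborSet v)
  edgeTruss : ∀ u v : Fin n, G.Adj u v → inp .edgeTruss u v = edgeTrussness G u v
  edgeTruss_zero : ∀ u v : Fin n, ¬ G.Adj u v → inp .edgeTruss u v = 0
  /-- adjacency lists are in descending order of edge trussness -/
  sorted : ∀ v : Fin n, ∀ i j, i ≤ j → j < inp .degree v 0 →
    inp .edgeTruss v (inp .neighbor v j) ≤ inp .edgeTruss v (inp .neighbor v i)
  /-- `mark v k` is the first position in the list of `v` of an edge of trussness `k`, if any -/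
  mark : ∀ v : Fin n, ∀ k, (∃ u, G.Adj v u ∧ edgeTrussness G v u = k) →
    IsLeast {j | j < inp .degree v 0 ∧ inp .edgeTruss v (inp .neighbor v j) = k} (inp .mark v k)
  vertexTruss : ∀ v : Fin n,
    inp .vertexTruss v 0 = sSup {k | ∃ u, G.Adj v u ∧ k = edgeTrussness G v u}

/-- The query tables of `inp` list the vertices of `Q`, each once. -/
structure IsQueryList {n : ℕ} (Q : Finset (Fin n)) (inp : Input) : Prop where
  numQuery : inp .numQuery 0 0 = Q.card
  query : Set.BijOn (fun j => inp .query j 0) (Set.Iio Q.card)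
    ((fun u : Fin n => (u : ℕ)) '' (Q : Set (Fin n)))

/-- The final state `s` holds the record of the execution `r`. Registers `0, …, 3` contain the
trussness level, the number of iterations, the index of the returned graph and the number of edges
of the first graph. Arrays `0`, `1` list the ends of the edges of the first graph, and array `2` has
a label for each of them, such that the edges of `r.graph i` are those with label greater than `i`
(so the returned graph consists of the edges whose label is greater than register `2`). Arrays `3`,
`4` contain the deleted vertex and the graph query distance for each iteration. -/
structure Records {n : ℕ} {G : SimpleGraph (Fin n)} {Q : Finset (Fin n)}
    (r : BasicRun G Q) (s : State) : Prop where
  level : s.reg 0 = r.k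
  iterations : s.reg 1 = r.t
  best : s.reg 2 = r.best
  edges : s.reg 3 = numEdges (r.graph 0)
  graphs : ∀ i < r.t, ∀ u v : Fin n, (r.graph i).Adj u v ↔
    ∃ j < s.reg 3, i < s.mem 2 j ∧
      ((s.mem 0 j = u ∧ s.mem 1 j = v) ∨ (s.mem 0 j = v ∧ s.mem 1 j = u))
  far : ∀ i < r.t, s.mem 3 i = r.far i
  dist : ∀ i < r.t, (s.mem 4 i : ℕ∞) = graphQueryDist (r.graph i) Q

end CTC

set_option linter.unusedSectionVars false
set_option linter.unusedSimpArgs false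

/-! Why the algorithm is correct. A union of `l`-trusses is an `l`-truss, so the edges of trussness
at least `l` form one (`level_isTruss`), and so does each component of that graph. Hence the
component of a query vertex `q0` at level `k` is the unique maximal connected `k`-truss that
contains `Q` (`IsMaxConnectedTruss.eq_core`), and `k` is the largest level at which `Q` is connected
(`le_maxTrussness_of_reachable`). The peeled graph is characterised without reference to the order
of deletions: it is a `k`-truss inside `H` that contains every `k`-truss inside `H`
(`trussPart_eq`). The cascade maintains exact supports for the first half and the property `Keeps`
for the second. Cutting out the component of `Q` changes no support, because a triangle never leaves
its component (`common_comp`).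

Why it is fast. Three costs add up. (1) The level is found by counting down from the vertex
trussness of `q0`. At levels `l ≥ k` the component of `q0` lies inside `G_0`, so a search costs
`O(m')`. Its minimum degree is at least `l - 1`, while `ρ` forests have at most `ρ` edges per
vertex; so `l ≤ 2ρ + 1` and `O(ρ)` levels are tried (`le_two_mul_arboricity`). (2) The triangles of
an edge are found by scanning the neighbours of its end of smaller degree and looking up the third
side in the hash table. Charging every edge to its child end in a rooted forest shows that the
smaller degrees sum to at most `2ρm'` (`ForestCover.sum_min_le`, `sum_weight_le`). This pays once
for the initial supports (`initSup_spec`) and once for all deletions of the whole execution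
together, since an edge is deleted at most once: `cascade_spec` spends a potential in which each
present edge holds its weight. (3) Every iteration makes one search from `q0`, one from each query
vertex and a bounded number of passes over the edges and vertices, which is `O(|Q|m')`
(`choose_spec`, `mainLoop_spec`). Adjacency lists are sorted by trussness, so a scan stops after one
probe outside `G_0` (`WP.scan`), and vertices are stamped with the number of the search, so nothing
is ever cleared. The cells touched are therefore indexed by edge numbers, vertices and ordered
adjacent pairs of `G_0` (`card_cells_le`).

The bounds on `t` hold because an iteration destroys a vertex of degree at least `k - 1`
(`BasicRun.invariant`). The bound `ρ ≤ √m'` follows from `forestCover_of_card_lt`: fewer than `(b +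
1)²` edges can be covered by `b` forests if `b ≥ 2`. Vertices of degree at most `b` are split off,
at most `2b` remaining vertices are handled by the decomposition of a complete graph into double
stars, and counting leaves one case with `2b + 1` vertices (`forestCover_of_nonadjacent`). For `b =
1` the triangle is the counterexample.

Programs are verified in a logic of total correctness whose loop rule carries a potential
(`WT.while`), so termination, running time and functional behaviour are proved together. -/

namespace CTC

/-! ## Total correctness with time and space bounds -/

section Logic

/-- Sequential composition of a list of programs. -/
def block : List Com → Com
  | [] => .skip
  | c :: cs => .seq c (block cs)

/-- Does the program write register `x`? -/
def Com.wr : Com → ℕ → Bool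
  | .skip, _ => false
  | .assign y _, x => x == y
  | .load y _ _, x => x == y
  | .store _ _ _, _ => false
  | .input y _ _ _, x => x == y
  | .seq c d, x => c.wr x || d.wr x
  | .ite _ _ c d, x => c.wr x || d.wr x
  | .loop _ _ c, x => c.wr x

/-- Does the program write array `a`? -/
def Com.wa : Com → ℕ → Bool
  | .skip, _ => false
  | .assign _ _, _ => false
  | .load _ _ _, _ => false
  | .store b _ _, a => a == b
  | .input _ _ _ _, _ => false
  | .seq c d, a => c.wa a || d.wa a
  | .ite _ _ c d, a => c.wa a || d.wa a
  | .loop _ _ c, a => c.wa a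

/-- The states agree on everything that the program does not write. -/
def Same (c : Com) (s s' : State) : Prop :=
  (∀ x, c.wr x = false → s'.reg x = s.reg x) ∧ (∀ a, c.wa a = false → s'.mem a = s.mem a)

theorem Same.refl (c : Com) (s : State) : Same c s s := ⟨fun _ _ => rfl, fun _ _ => rfl⟩

theorem Same.trans {c : Com} {s s' s'' : State} (h : Same c s s') (h' : Same c s' s'') :
    Same c s s'' :=
  ⟨fun x hx => (h'.1 x hx).trans (h.1 x hx), fun a ha => (h'.2 a ha).trans (h.2 a ha)⟩

theorem Same.mono {c d : Com} {s s' : State} (h : Same c s s')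
    (hr : ∀ x, d.wr x = false → c.wr x = false) (ha : ∀ a, d.wa a = false → c.wa a = false) :
    Same d s s' :=
  ⟨fun x hx => h.1 x (hr x hx), fun a h' => h.2 a (ha a h')⟩

/-- What a program may change is decided by its syntax. Later frame conditions are thus Boolean
computations, mostly closed by `rfl`, and specifications mention only what does change. -/
theorem Exec.same {inp : Input} {W : ℕ} {c : Com} {s s' : State} {T : ℕ} {S : Finset (ℕ × ℕ)}
    (h : Exec inp W c s s' T S) : Same c s s' := by
  induction h with
  | skip s => exact Same.refl _ _
  | assign s x e he =>
    refine ⟨fun y hy => ?_, fun _ _ => rfl⟩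
    simp only [Com.wr, beq_eq_false_iff_ne] at hy
    simp [State.setReg, hy]
  | load s x a e he hv =>
    refine ⟨fun y hy => ?_, fun _ _ => rfl⟩
    simp only [Com.wr, beq_eq_false_iff_ne] at hy
    simp [State.setReg, hy]
  | store s a e f he hf =>
    refine ⟨fun _ _ => rfl, fun y hy => ?_⟩
    simp only [Com.wa, beq_eq_false_iff_ne] at hy
    simp [State.setMem, hy]
  | input s x T e f he hf hv =>
    refine ⟨fun y hy => ?_, fun _ _ => rfl⟩
    simp only [Com.wr, beq_eq_false_iff_ne] at hy
    simp [State.setReg, hy]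
  | seq _ _ h1 h2 =>
    refine (h1.mono ?_ ?_).trans (h2.mono ?_ ?_) <;> intro x hx <;>
      simp only [Com.wr, Com.wa, Bool.or_eq_false_iff] at hx <;> simp [hx]
  | ite_true _ _ _ _ h =>
    refine h.mono ?_ ?_ <;> intro x hx <;>
      simp only [Com.wr, Com.wa, Bool.or_eq_false_iff] at hx <;> simp [hx]
  | ite_false _ _ _ _ h =>
    refine h.mono ?_ ?_ <;> intro x hx <;>
      simp only [Com.wr, Com.wa, Bool.or_eq_false_iff] at hx <;> simp [hx]
  | loop_done => exact Same.refl _ _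
  | loop_step _ _ _ _ _ h1 h2 =>
    exact (h1.mono (fun x hx => hx) (fun x hx => hx)).trans h2

variable {inp : Input} {W : ℕ} {Z : Set (ℕ × ℕ)}

variable (inp W Z) in
/-- The program halts, touches only cells in `Z`, and the final state and the time satisfy `Q`. -/
def WT (c : Com) (s : State) (Q : State → ℕ → Prop) : Prop :=
  ∃ s' T S, Exec inp W c s s' T S ∧ (S : Set (ℕ × ℕ)) ⊆ Z ∧ Q s' T

variable (inp W Z) in
/-- The program halts within `N` steps, touches only cells in `Z`, and ends in `Q`. -/
def WP (c : Com) (s : State) (N : ℕ) (Q : State → Prop) : Prop :=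
  WT inp W Z c s fun s' T => T ≤ N ∧ Q s'

theorem WT.mono {c : Com} {s : State} {Q Q' : State → ℕ → Prop} (h : WT inp W Z c s Q)
    (hQ : ∀ s' T, Same c s s' → Q s' T → Q' s' T) : WT inp W Z c s Q' := by
  obtain ⟨s', T, S, h1, h2, h3⟩ := h
  exact ⟨s', T, S, h1, h2, hQ _ _ h1.same h3⟩

theorem WP.mono {c : Com} {s : State} {N N' : ℕ} {Q Q' : State → Prop} (h : WP inp W Z c s N Q)
    (hN : N ≤ N') (hQ : ∀ s', Same c s s' → Q s' → Q' s') : WP inp W Z c s N' Q' :=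
  WT.mono h fun s' _ hs h' => ⟨h'.1.trans hN, hQ s' hs h'.2⟩

theorem WP.frame {c : Com} {s : State} {N : ℕ} {Q : State → Prop} (h : WP inp W Z c s N Q) :
    WP inp W Z c s N fun s' => Same c s s' ∧ Q s' :=
  h.mono le_rfl fun _ hs h' => ⟨hs, h'⟩

theorem WT.seq {c d : Com} {s : State} {Q : State → ℕ → Prop}
    (h : WT inp W Z c s fun s1 T1 => WT inp W Z d s1 fun s2 T2 => Q s2 (T1 + T2)) :
    WT inp W Z (.seq c d) s Q := by
  obtain ⟨s1, T1, S1, h1, h2, s2, T2, S2, h3, h4, h5⟩ := h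
  refine ⟨s2, _, _, .seq h1 h3, ?_, h5⟩
  push_cast
  exact Set.union_subset h2 h4

theorem WP.comp {c d : Com} {s : State} {N N1 N2 : ℕ} {Q : State → Prop}
    (h : WP inp W Z c s N1 fun s1 => WP inp W Z d s1 N2 Q) (hN : N1 + N2 ≤ N) :
    WP inp W Z (.seq c d) s N Q := by
  refine WT.seq (WT.mono h fun s1 T1 _ h1 => WT.mono h1.2 fun s2 T2 _ h2 => ⟨?_, h2.2⟩)
  have := h1.1
  have := h2.1
  omega

theorem WP.seq' {c d : Com} {s : State} {N N1 N2 : ℕ} {Q R : State → Prop}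
    (h : WP inp W Z c s N1 R) (h' : ∀ s1, Same c s s1 → R s1 → WP inp W Z d s1 N2 Q)
    (hN : N1 + N2 ≤ N) : WP inp W Z (.seq c d) s N Q :=
  WP.comp (h.mono le_rfl h') hN

theorem WP.done {s : State} {N : ℕ} {Q : State → Prop} (h : Q s) (hN : 1 ≤ N) :
    WP inp W Z .skip s N Q :=
  ⟨s, 1, ∅, .skip s, by simp, hN, h⟩

variable (inp W Z) in
/-- Verification condition of a program without loops. -/
def vc : Com → (State → Prop) → State → Prop
  | .skip, Q, s => Q s
  | .assign x e, Q, s => e.Fits W s.reg ∧ Q (s.setReg x (e.val s.reg))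
  | .load x a e, Q, s => e.Fits W s.reg ∧ s.mem a (e.val s.reg) ≤ W ∧ (a, e.val s.reg) ∈ Z ∧
      Q (s.setReg x (s.mem a (e.val s.reg)))
  | .store a e f, Q, s => e.Fits W s.reg ∧ f.Fits W s.reg ∧ (a, e.val s.reg) ∈ Z ∧
      Q (s.setMem a (e.val s.reg) (f.val s.reg))
  | .input x T e f, Q, s => e.Fits W s.reg ∧ f.Fits W s.reg ∧
      inp T (e.val s.reg) (f.val s.reg) ≤ W ∧ Q (s.setReg x (inp T (e.val s.reg) (f.val s.reg)))
  | .seq c d, Q, s => vc c (vc d Q) s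
  | .ite e f c d, Q, s => e.Fits W s.reg ∧ f.Fits W s.reg ∧
      (e.val s.reg < f.val s.reg → vc c Q s) ∧ (¬ e.val s.reg < f.val s.reg → vc d Q s)
  | .loop _ _ _, _, _ => False

/-- Bound on the running time of a program without loops. -/
def Com.cst : Com → ℕ
  | .skip => 1
  | .assign _ e => e.cost + 1
  | .load _ _ e => e.cost + 1
  | .store _ e f => e.cost + f.cost + 1
  | .input _ _ e f => e.cost + f.cost + 1
  | .seq c d => c.cst + d.cst
  | .ite e f c d => e.cost + f.cost + 1 + (c.cst + d.cst)
  | .loop _ _ _ => 0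

theorem WP.of_vc {c : Com} : ∀ {s : State} {Q : State → Prop}, vc inp W Z c Q s →
    WP inp W Z c s c.cst Q := by
  induction c with
  | skip => exact fun h => WP.done h le_rfl
  | assign x e => exact fun h => ⟨_, _, _, .assign _ _ _ h.1, by simp, le_rfl, h.2⟩
  | load x a e =>
    exact fun h => ⟨_, _, _, .load _ _ _ _ h.1 h.2.1, by simpa using h.2.2.1, le_rfl, h.2.2.2⟩
  | store a e f =>
    exact fun h => ⟨_, _, _, .store _ _ _ _ h.1 h.2.1, by simpa using h.2.2.1, le_rfl, h.2.2.2⟩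
  | input x T e f =>
    exact fun h => ⟨_, _, _, .input _ _ _ _ _ h.1 h.2.1 h.2.2.1, by simp, le_rfl, h.2.2.2⟩
  | seq c d hc hd => exact fun h => WP.seq' (hc h) (fun s1 _ h1 => hd h1) le_rfl
  | ite e f c d hc hd =>
    intro s Q h
    by_cases hg : e.val s.reg < f.val s.reg
    · obtain ⟨s', T, S, h1, h2, h3, h4⟩ := hc (h.2.2.1 hg)
      exact ⟨s', _, S, .ite_true h.1 h.2.1 hg h1, h2, by simp only [Com.cst]; omega, h4⟩
    · obtain ⟨s', T, S, h1, h2, h3, h4⟩ := hd (h.2.2.2 hg)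
      exact ⟨s', _, S, .ite_false h.1 h.2.1 hg h1, h2, by simp only [Com.cst]; omega, h4⟩
  | loop e f c _ => exact fun h => h.elim

theorem WP.straight {c : Com} {s : State} {N : ℕ} {Q : State → Prop} (h : vc inp W Z c Q s)
    (hN : c.cst ≤ N) : WP inp W Z c s N Q :=
  (WP.of_vc h).mono hN fun _ _ h => h

/-- Like `WP.straight`, with a postcondition that simplification leaves alone. -/
theorem WP.code {c : Com} {s : State} {N : ℕ} {Q : State → Prop} (hN : c.cst ≤ N)
    (h : ∀ Q' : State → Prop, (∀ s', Q s' → Q' s') → vc inp W Z c Q' s) : WP inp W Z c s N Q :=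
  WP.straight (h Q fun _ h => h) hN

theorem WP.branch {e f : Expr} {c d : Com} {s : State} {N M : ℕ} {Q : State → Prop}
    (he : e.Fits W s.reg) (hf : f.Fits W s.reg)
    (hc : e.val s.reg < f.val s.reg → WP inp W Z c s M Q)
    (hd : ¬ e.val s.reg < f.val s.reg → WP inp W Z d s M Q)
    (hN : e.cost + f.cost + 1 + M ≤ N) : WP inp W Z (.ite e f c d) s N Q := by
  by_cases hg : e.val s.reg < f.val s.reg
  · obtain ⟨s', T, S, h1, h2, h3, h4⟩ := hc hg
    exact ⟨s', _, S, .ite_true he hf hg h1, h2, by omega, h4⟩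
  · obtain ⟨s', T, S, h1, h2, h3, h4⟩ := hd hg
    exact ⟨s', _, S, .ite_false he hf hg h1, h2, by omega, h4⟩

/-- Loop rule with an invariant that carries a potential, which pays for the running time. -/
theorem WT.while {e f : Expr} {c : Com} {s : State} (I : State → ℕ → Prop) {p : ℕ} (h0 : I s p)
    (hfit : ∀ s1 p1, Same c s s1 → I s1 p1 → e.Fits W s1.reg ∧ f.Fits W s1.reg)
    (hstep : ∀ s1 p1, Same c s s1 → I s1 p1 → e.val s1.reg < f.val s1.reg →
      WT inp W Z c s1 fun s2 T => ∃ p2, I s2 p2 ∧ T + (e.cost + f.cost + 1) + p2 ≤ p1) :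
    WT inp W Z (.loop e f c) s fun s' T => ∃ p',
      I s' p' ∧ ¬ e.val s'.reg < f.val s'.reg ∧ T + p' ≤ p + (e.cost + f.cost + 1) := by
  -- Induction on a bound for the potential: every round costs at least one step, so the potential
  -- strictly decreases, and termination comes with the time bound.
  suffices H : ∀ N s1 p1, p1 ≤ N → Same c s s1 → I s1 p1 →
      WT inp W Z (.loop e f c) s1 fun s' T => ∃ p',
        I s' p' ∧ ¬ e.val s'.reg < f.val s'.reg ∧ T + p' ≤ p1 + (e.cost + f.cost + 1) from
    H _ s p le_rfl (Same.refl _ _) h0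
  intro N
  induction N with
  | zero =>
    intro s1 p1 hN hs hI
    obtain ⟨he, hf⟩ := hfit s1 p1 hs hI
    by_cases hg : e.val s1.reg < f.val s1.reg
    · obtain ⟨s2, T, S, h1, h2, p2, h3, h4⟩ := hstep s1 p1 hs hI hg
      omega
    · exact ⟨s1, _, _, .loop_done he hf hg, by simp, p1, hI, hg, by omega⟩
  | succ N ih =>
    intro s1 p1 hN hs hI
    obtain ⟨he, hf⟩ := hfit s1 p1 hs hI
    by_cases hg : e.val s1.reg < f.val s1.reg
    · obtain ⟨s2, T, S, h1, h2, p2, h3, h4⟩ := hstep s1 p1 hs hI hg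
      obtain ⟨s', T', S', h5, h6, p', h7, h8, h9⟩ := ih s2 p2 (by omega) (hs.trans h1.same) h3
      refine ⟨s', _, _, .loop_step he hf hg h1 h5, ?_, p', h7, h8, by omega⟩
      push_cast
      exact Set.union_subset h2 h6
    · exact ⟨s1, _, _, .loop_done he hf hg, by simp, p1, hI, hg, by omega⟩

/-- Counting loop: register `i` runs from `0` to the value of register `b`. -/
def forUp (i b : ℕ) (c : Com) : Com :=
  block [.assign i (.lit 0), .loop (.reg i) (.reg b) (block [c, .assign i (.add (.reg i) (.lit 1))])]

/-- The potential is the cost of the rounds still to come. The `8` per round are test (3), increment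
(4) and the `skip` that ends a block (1); the final `6` are initialisation (2), the failing test (3)
and `skip` (1). -/
theorem WP.counting {i b : ℕ} {c : Com} {s : State} {m : ℕ} (I : ℕ → State → Prop) (κ : ℕ → ℕ)
    (hib : i ≠ b) (hi : c.wr i = false) (hb : c.wr b = false) (hm : s.reg b = m) (hmW : m ≤ W)
    (hW : 1 ≤ W) (h0 : I 0 (s.setReg i 0))
    (hstep : ∀ j < m, ∀ s1, Same (forUp i b c) s s1 → s1.reg i = j → I j s1 →
      WP inp W Z c s1 (κ j) fun s2 => I (j + 1) (s2.setReg i (j + 1))) :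
    WP inp W Z (forUp i b c) s (∑ j ∈ Finset.range m, (κ j + 8) + 6) (I m) := by
  have hwb : ∀ x, (forUp i b c).wr x = false → (block [c, .assign i (.add (.reg i) (.lit 1))]).wr x
      = false := by
    intro x hx
    simp only [forUp, block, Com.wr, Bool.or_eq_false_iff] at hx ⊢
    tauto
  have hwa : ∀ x, (forUp i b c).wa x = false → (block [c, .assign i (.add (.reg i) (.lit 1))]).wa x
      = false := by
    intro x hx
    simp only [forUp, block, Com.wa, Bool.or_eq_false_iff] at hx ⊢
    tauto
  have hS0 : Same (forUp i b c) s (s.setReg i 0) := by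
    refine ⟨fun x hx => ?_, fun _ _ => rfl⟩
    have : x ≠ i := by rintro rfl; simp [forUp, block, Com.wr] at hx
    simp [State.setReg, this]
  refine WP.comp (N1 := 2) (N2 := ∑ j ∈ Finset.range m, (κ j + 8) + 4) (WP.straight ?_ (by simp [Com.cst, Expr.cost]))
    (by omega)
  refine ⟨Nat.zero_le _, ?_⟩
  refine WP.comp (N1 := ∑ j ∈ Finset.range m, (κ j + 8) + 3) (N2 := 1) ?_ (by omega)
  have key := WT.while (inp := inp) (W := W) (Z := Z) (e := .reg i) (f := .reg b)
    (c := block [c, .assign i (.add (.reg i) (.lit 1))]) (s := s.setReg i 0)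
    (fun s1 p => s1.reg i ≤ m ∧ s1.reg b = m ∧ I (s1.reg i) s1 ∧
      p = ∑ j ∈ Finset.Ico (s1.reg i) m, (κ j + 8))
    (p := ∑ j ∈ Finset.range m, (κ j + 8)) ?_ ?_ ?_
  · refine WT.mono key fun s' T _ h => ?_
    obtain ⟨p', ⟨h1, h2, h3, hp⟩, h4, h5⟩ := h
    simp only [Expr.cost] at h5
    refine ⟨by omega, WP.done ?_ le_rfl⟩
    simp only [Expr.val, h2] at h4
    obtain h6 : s'.reg i = m := by omega
    rwa [h6] at h3
  · simp only [State.setReg, Function.update_self, Nat.zero_le, true_and, Finset.range_eq_Ico,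
      and_true]
    rw [Function.update_of_ne hib.symm]
    exact ⟨hm, h0⟩
  · intro s1 p _ h
    simp only [Expr.Fits]
    omega
  · intro s1 p hs h hg
    obtain ⟨-, hb1, hI, hp⟩ := h
    simp only [Expr.val, hb1] at hg
    have hs' : Same (forUp i b c) s s1 := hS0.trans (hs.mono (by exact hwb) (by exact hwa))
    have hbody := hstep _ hg s1 hs' rfl hI
    refine WT.seq (WT.mono hbody fun s2 T hs2 h2 => ?_)
    have e2 : s2.reg i = s1.reg i := hs2.1 i hi
    have e3 : s2.reg b = m := (hs2.1 b hb).trans hb1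
    refine WT.seq ⟨_, _, _, .assign _ _ _ ?_, by simp, _, _, _, .skip _, by simp, ?_⟩
    · simp only [Expr.Fits, Expr.val, e2]
      omega
    · simp only [Expr.val, Expr.cost, State.setReg, Function.update_self, e2]
      rw [Function.update_of_ne hib.symm]
      refine ⟨_, ⟨by omega, e3, h2.2, rfl⟩, ?_⟩
      rw [hp, Finset.sum_eq_sum_Ico_succ_bot hg (fun j => κ j + 8)]
      have := h2.1
      omega

@[simp] theorem State.reg_setReg (s : State) (x v y : ℕ) :
    (s.setReg x v).reg y = if y = x then v else s.reg y := by
  simp [State.setReg, Function.update_apply]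

@[simp] theorem State.mem_setReg (s : State) (x v : ℕ) : (s.setReg x v).mem = s.mem := rfl

@[simp] theorem State.reg_setMem (s : State) (a i v : ℕ) : (s.setMem a i v).reg = s.reg := rfl

@[simp] theorem State.mem_setMem (s : State) (a i v b : ℕ) :
    (s.setMem a i v).mem b = if b = a then Function.update (s.mem a) i v else s.mem b := by
  by_cases h : b = a
  · subst h; simp [State.setMem]
  · simp [State.setMem, h]

attribute [simp] vc Expr.val Expr.Fits Expr.cost Com.cst block

end Logic


/-! ## Forest covers -/

section Forests

open SimpleGraph

variable {V : Type*}

/-- The edges of `H` are covered by `b` forests. -/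
def ForestCover (b : ℕ) (H : SimpleGraph V) : Prop :=
  ∃ F : Fin b → SimpleGraph V, (∀ i, (F i).IsAcyclic) ∧ ∀ u v, H.Adj u v → ∃ i, (F i).Adj u v

theorem forestCover_iff {b : ℕ} {H : SimpleGraph V} :
    ForestCover b H ↔ ∃ F : Fin b → SimpleGraph V,
      (∀ i, F i ≤ H ∧ (F i).IsAcyclic) ∧ ∀ u v, H.Adj u v → ∃ i, (F i).Adj u v := by
  constructor
  · rintro ⟨F, h1, h2⟩
    refine ⟨fun i => F i ⊓ H, fun i => ⟨inf_le_right, (h1 i).anti inf_le_left⟩, fun u v h => ?_⟩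
    obtain ⟨i, hi⟩ := h2 u v h
    exact ⟨i, hi, h⟩
  · rintro ⟨F, h1, h2⟩
    exact ⟨F, fun i => (h1 i).2, h2⟩

/-- Root every component at an arbitrary vertex; the parent is the next vertex on the unique path to
the root. If `v` is not on the path of its neighbour `u`, then prefixing `v` to that path gives the
path of `v`. -/
theorem exists_parent {F : SimpleGraph V} (hF : F.IsAcyclic) :
    ∃ p : V → V, ∀ u v, F.Adj u v → p u = v ∨ p v = u := by
  classical
  let r : V → V := fun v => (F.connectedComponentMk v).out
  have hr : ∀ v, F.Reachable v (r v) := fun v =>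
    (ConnectedComponent.exact (Quot.out_eq (F.connectedComponentMk v))).symm
  have hp : ∀ v, ∃ p : F.Walk v (r v), p.IsPath := fun v => (hr v).exists_isPath
  choose p hp using hp
  refine ⟨fun v => (p v).snd, fun u v huv => ?_⟩
  have e : r u = r v := by
    simp only [r, ConnectedComponent.sound huv.reachable]
  by_cases h : v ∈ (p u).support
  · exact Or.inl (hF.eq_snd_of_adj_start (hp u) huv h).symm
  · right
    refine (hF.eq_snd_of_adj_start (hp v) huv.symm ?_).symm
    have h1 : (Walk.cons huv.symm (p u)).IsPath := (hp u).cons h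
    have h2 : ((Walk.cons huv.symm (p u)).copy rfl e).IsPath := by simpa using h1
    have := (hF.subsingleton_path _ _).elim ⟨p v, hp v⟩ ⟨_, h2⟩
    have h3 : p v = (Walk.cons huv.symm (p u)).copy rfl e := congrArg Subtype.val this
    rw [h3]
    simp

/-- Charge each edge to its child end in some forest that contains it. A vertex has one parent per
forest and is charged at most `b` times, and the minimum is at most the value at the child. With
degrees for `d` this bounds the cost of listing triangles. -/
theorem ForestCover.sum_min_le [Fintype V] [LinearOrder V] {b : ℕ} {H : SimpleGraph V}
    (hH : ForestCover b H) (E : Finset (V × V)) (hE : ∀ e ∈ E, H.Adj e.1 e.2 ∧ e.1 < e.2)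
    (d : V → ℕ) : ∑ e ∈ E, min (d e.1) (d e.2) ≤ b * ∑ v, d v := by
  classical
  obtain ⟨F, hF, hc⟩ := hH
  choose p hp using fun i => exists_parent (hF i)
  have h1 : ∀ e : E, ∃ x : Fin b × V,
      (x.2 = e.1.1 ∧ p x.1 x.2 = e.1.2) ∨ (x.2 = e.1.2 ∧ p x.1 x.2 = e.1.1) := by
    intro e
    obtain ⟨i, hi⟩ := hc _ _ (hE e e.2).1
    rcases hp i _ _ hi with h | h
    · exact ⟨(i, e.1.1), Or.inl ⟨rfl, h⟩⟩
    · exact ⟨(i, e.1.2), Or.inr ⟨rfl, h⟩⟩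
  choose φ hφ using h1
  -- Forest and child determine the parent, hence the edge up to orientation; the condition `e.1 <
  -- e.2` fixes the orientation.
  have hinj : Function.Injective φ := by
    intro e e' h
    have l1 := (hE e e.2).2
    have l2 := (hE e' e'.2).2
    have a1 := hφ e
    have a2 := hφ e'
    rw [← h] at a2
    apply Subtype.ext
    rcases a1 with ⟨b1, b2⟩ | ⟨b1, b2⟩ <;> rcases a2 with ⟨c1, c2⟩ | ⟨c1, c2⟩
    · exact Prod.ext (b1.symm.trans c1) (b2.symm.trans c2)
    · rw [← b1, ← b2] at l1; rw [← c1, ← c2] at l2; exact absurd l1 l2.asymm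
    · rw [← b1, ← b2] at l1; rw [← c1, ← c2] at l2; exact absurd l1 l2.asymm
    · exact Prod.ext (b2.symm.trans c2) (b1.symm.trans c1)
  calc ∑ e ∈ E, min (d e.1) (d e.2) = ∑ e : E, min (d e.1.1) (d e.1.2) :=
        (Finset.sum_coe_sort E _).symm
    _ ≤ ∑ e : E, d (φ e).2 := by
        refine Finset.sum_le_sum fun e _ => ?_
        rcases hφ e with ⟨h, -⟩ | ⟨h, -⟩ <;> rw [h]
        · exact min_le_left _ _
        · exact min_le_right _ _
    _ = ∑ x ∈ Finset.univ.map ⟨φ, hinj⟩, d x.2 := by simp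
    _ ≤ ∑ x : Fin b × V, d x.2 := Finset.sum_le_sum_of_subset (Finset.subset_univ _)
    _ = b * ∑ v, d v := by simp [Fintype.sum_prod_type]

/-- A vertex of maximum rank on a cycle would have two different neighbours of rank at most its own.
-/
theorem isAcyclic_of_rank {F : SimpleGraph V} (r : V → ℕ)
    (h : ∀ v u w, F.Adj v u → F.Adj v w → r u ≤ r v → r w ≤ r v → u = w) : F.IsAcyclic := by
  classical
  intro x c hc
  obtain ⟨v, hv, hmax⟩ := Finset.exists_max_image c.support.toFinset r ⟨x, by simp⟩
  rw [List.mem_toFinset] at hv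
  have hc' := hc.rotate hv
  have hm : ∀ y ∈ (c.rotate v hv).support, r y ≤ r v := by
    intro y hy
    apply hmax
    rw [List.mem_toFinset]
    exact (Walk.mem_support_rotate_iff _ _ hv).1 hy
  have hn : ¬ (c.rotate v hv).Nil := hc'.not_nil
  exact hc'.snd_ne_penultimate (h v _ _ (Walk.adj_snd hn) (Walk.adj_penultimate hn).symm
    (hm _ (Walk.getVert_mem_support _ _)) (hm _ (Walk.getVert_mem_support _ _)))

/-- Every vertex distributes its edges to lower vertices over different forests. Within one forest
it then has at most one lower neighbour, which is what `isAcyclic_of_rank` asks for. -/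
theorem forestCover_of_lower [Fintype V] [LinearOrder V] {d : ℕ} {H : SimpleGraph V} (r : V → ℕ)
    (hr : Function.Injective r)
    (h : ∀ v, ({u | H.Adj v u ∧ r u < r v} : Set V).ncard ≤ d) : ForestCover d H := by
  classical
  have h1 : ∀ v, ∃ f : V → Fin d ⊕ Unit,
      Set.InjOn f {u | H.Adj v u ∧ r u < r v} ∧ ∀ u, H.Adj v u ∧ r u < r v → ∃ i, f u = .inl i := by
    intro v
    have h2 : Fintype.card {u // H.Adj v u ∧ r u < r v} ≤ Fintype.card (Fin d) := by
      have := h v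
      rw [← Nat.card_coe_set_eq, Nat.card_eq_fintype_card] at this
      simpa [Fintype.card_subtype] using this
    obtain ⟨g⟩ := Function.Embedding.nonempty_of_card_le h2
    refine ⟨fun u => if hu : H.Adj v u ∧ r u < r v then .inl (g ⟨u, hu⟩) else .inr (), ?_, ?_⟩
    · intro u hu w hw huw
      simp only [Set.mem_ofPred_eq] at hu hw
      simpa [hu, hw] using huw
    · intro u hu
      exact ⟨g ⟨u, hu⟩, by simp [hu]⟩
  choose f hf1 hf2 using h1
  refine ⟨fun i => SimpleGraph.fromRel fun u v => H.Adj v u ∧ r u < r v ∧ f v u = .inl i, ?_, ?_⟩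
  · intro i
    refine isAcyclic_of_rank r fun v u w hu hw hru hrw => ?_
    simp only [fromRel_adj] at hu hw
    obtain ⟨-, hu⟩ := hu
    obtain ⟨-, hw⟩ := hw
    have hu' := hu.resolve_left fun h => by omega
    have hw' := hw.resolve_left fun h => by omega
    exact hf1 v ⟨hu'.1, hu'.2.1⟩ ⟨hw'.1, hw'.2.1⟩ (hu'.2.2.trans hw'.2.2.symm)
  · intro u v huv
    have : r u ≠ r v := fun h => huv.ne (hr h)
    rcases lt_or_gt_of_ne this with h | h
    · obtain ⟨i, hi⟩ := hf2 v u ⟨huv.symm, h⟩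
      exact ⟨i, huv.ne, Or.inl ⟨huv.symm, h, hi⟩⟩
    · obtain ⟨i, hi⟩ := hf2 u v ⟨huv, h⟩
      exact ⟨i, huv.ne, Or.inr ⟨huv, h, hi⟩⟩

theorem isAcyclic_sup_edge {F : SimpleGraph V} (hF : F.IsAcyclic) {v w : V}
    (hv : ∀ x, ¬ F.Adj v x) : (F ⊔ edge w v).IsAcyclic := by
  by_cases h : w = v
  · subst h
    simpa using hF
  · refine hF.sup_edge_of_not_reachable (not_reachable_of_neighborSet_right_eq_empty h ?_)
    ext x
    simpa using hv x

/-- Attach a vertex that is isolated in all forests to at most one vertex in each of them. -/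
theorem exists_attach {b : ℕ} {F : Fin b → SimpleGraph V} (hF : ∀ i, (F i).IsAcyclic) {v : V}
    (hv : ∀ i x, ¬ (F i).Adj v x) {N : Finset V} (hN : N.card ≤ b) (hvN : v ∉ N) :
    ∃ F' : Fin b → SimpleGraph V, (∀ i, (F' i).IsAcyclic) ∧ (∀ i, F i ≤ F' i) ∧
      (∀ w ∈ N, ∃ i, (F' i).Adj v w) ∧
      ∀ i p, p ≠ v → p ∉ N → (∀ x, ¬ (F i).Adj p x) → ∀ x, ¬ (F' i).Adj p x := by
  classical
  have h2 : Fintype.card N ≤ Fintype.card (Fin b) := by simpa using hN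
  obtain ⟨g⟩ := Function.Embedding.nonempty_of_card_le h2
  refine ⟨fun i => if h : ∃ w : N, g w = i then F i ⊔ edge h.choose.1 v else F i, ?_, ?_, ?_, ?_⟩
  · intro i
    by_cases h : ∃ w : N, g w = i
    · simp only [h, dite_true]
      exact isAcyclic_sup_edge (hF i) (hv i)
    · simp only [h, dite_false]
      exact hF i
  · intro i
    by_cases h : ∃ w : N, g w = i
    · simp only [h, dite_true]
      exact le_sup_left
    · simp only [h, dite_false]
      exact le_rfl
  · intro w hw
    have h : ∃ w' : N, g w' = g ⟨w, hw⟩ := ⟨_, rfl⟩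
    refine ⟨g ⟨w, hw⟩, ?_⟩
    have hc : h.choose = ⟨w, hw⟩ := g.injective h.choose_spec
    simp only [h, dite_true, hc]
    right
    rw [edge_adj]
    have : v ≠ w := by rintro rfl; exact hvN hw
    exact ⟨Or.inr ⟨rfl, rfl⟩, this⟩
  · intro i p hpv hpN hp x
    by_cases h : ∃ w : N, g w = i
    · simp only [h, dite_true, sup_adj, edge_adj]
      have : p ≠ h.choose.1 := fun e => hpN (e ▸ h.choose.2)
      simp [hp x, hpv, this]
    · simp only [h, dite_false]
      exact hp x

/-- Half of the adjacency of the double stars that decompose the complete graph on `Fin b × Bool`. -/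
def starArc {b : ℕ} (i : Fin b) (x y : Fin b × Bool) : Prop :=
  x.1 = i ∧ ((y.1 = i ∧ x.2 ≠ y.2) ∨ (i < y.1 ∧ x.2 = y.2) ∨ (y.1 < i ∧ x.2 ≠ y.2))

/-- A forest in `H`: the preimage of the double star with centre `i`. -/
def doubleStar {b : ℕ} (H : SimpleGraph V) (g : V → Fin b × Bool) (i : Fin b) : SimpleGraph V where
  Adj u v := H.Adj u v ∧ (starArc i (g u) (g v) ∨ starArc i (g v) (g u))
  symm := ⟨fun _ _ h => ⟨h.1.symm, h.2.symm⟩⟩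
  loopless := ⟨fun _ h => h.1.ne rfl⟩

/-- For indices `i < j`, a pair on the same side belongs to star `i` and a pair on opposite sides to
star `j`; two vertices of equal index are the joined centres of their star. -/
theorem exists_starArc {b : ℕ} (x y : Fin b × Bool) (h : x ≠ y) :
    ∃ i, starArc i x y ∨ starArc i y x := by
  obtain ⟨i, β⟩ := x
  obtain ⟨j, γ⟩ := y
  simp only [ne_eq, Prod.mk.injEq, not_and] at h
  simp only [starArc]
  rcases lt_trichotomy i j with hij | rfl | hij
  · by_cases hβ : β = γ
    · exact ⟨i, Or.inl ⟨rfl, Or.inr (Or.inl ⟨hij, hβ⟩)⟩⟩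
    · exact ⟨j, Or.inr ⟨rfl, Or.inr (Or.inr ⟨hij, Ne.symm hβ⟩)⟩⟩
  · exact ⟨i, Or.inl ⟨rfl, Or.inl ⟨rfl, h rfl⟩⟩⟩
  · by_cases hβ : β = γ
    · exact ⟨j, Or.inr ⟨rfl, Or.inr (Or.inl ⟨hij, hβ.symm⟩)⟩⟩
    · exact ⟨i, Or.inl ⟨rfl, Or.inr (Or.inr ⟨hij, hβ⟩)⟩⟩

/-- Rank the two centres `0` and `1` and all leaves `2`. A leaf is joined to one centre only, and
the second centre has only the first at or below its rank. -/
theorem doubleStar_isAcyclic {b : ℕ} {H : SimpleGraph V} {g : V → Fin b × Bool}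
    (hg : Set.InjOn g H.support) (i : Fin b) : (doubleStar H g i).IsAcyclic := by
  let r : Fin b × Bool → ℕ := fun x => if x.1 = i then (if x.2 then 1 else 0) else 2
  refine isAcyclic_of_rank (fun v => r (g v)) fun v u w hu hw hru hrw => ?_
  refine hg ⟨v, hu.1.symm⟩ ⟨v, hw.1.symm⟩ ?_
  have h1 := hu.2
  have h2 := hw.2
  clear hu hw
  revert h1 h2 hru hrw
  generalize g v = x
  generalize g u = y
  generalize g w = z
  obtain ⟨a, α⟩ := x
  obtain ⟨b, β⟩ := y
  obtain ⟨c, γ⟩ := z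
  simp only [r, starArc, Prod.mk.injEq]
  intro hru hrw h1 h2
  by_cases ha : a = i <;> by_cases hb : b = i <;> by_cases hc : c = i <;>
    cases α <;> cases β <;> cases γ <;> simp_all <;> omega

theorem doubleStar_cover {b : ℕ} {H : SimpleGraph V} {g : V → Fin b × Bool}
    (hg : Set.InjOn g H.support) {u v : V} (h : H.Adj u v) : ∃ i, (doubleStar H g i).Adj u v := by
  obtain ⟨i, hi⟩ := exists_starArc (g u) (g v) fun e => h.ne (hg ⟨v, h⟩ ⟨u, h.symm⟩ e)
  exact ⟨i, h, hi⟩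

/-- The vertex `v` is isolated in the given forests, so its edges, at most `b` in number, can go to
pairwise different forests, where `v` becomes a leaf. -/
theorem forestCover_deleteIncidence [Fintype V] {b : ℕ} {H : SimpleGraph V} {v : V}
    (hd : (H.neighborSet v).ncard ≤ b) (hc : ForestCover b (H.deleteIncidenceSet v)) :
    ForestCover b H := by
  classical
  obtain ⟨F, hF, hcov⟩ := forestCover_iff.1 hc
  have hiso : ∀ i x, ¬ (F i).Adj v x := fun i x h =>
    (deleteIncidenceSet_adj.1 ((hF i).1 h)).2.1 rfl
  obtain ⟨F', h1, h2, h3, -⟩ := exists_attach (fun i => (hF i).2) hiso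
    (N := (H.neighborSet v).toFinset) (by rwa [← Set.ncard_eq_toFinset_card']) (by simp)
  refine ⟨F', h1, fun x y hxy => ?_⟩
  by_cases hx : x = v
  · subst hx
    exact h3 y (by simpa using hxy)
  by_cases hy : y = v
  · subst hy
    obtain ⟨i, hi⟩ := h3 x (by simpa using hxy.symm)
    exact ⟨i, hi.symm⟩
  obtain ⟨i, hi⟩ := hcov x y (deleteIncidenceSet_adj.2 ⟨hxy, hx, hy⟩)
  exact ⟨i, h2 i hi⟩

theorem forestCover_of_support_card_le [Fintype V] {b : ℕ} {H : SimpleGraph V}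
    (h : H.support.ncard ≤ 2 * b) : ForestCover b H := by
  classical
  have h2 : Fintype.card H.support ≤ Fintype.card (Fin b × Bool) := by
    rw [Set.ncard_eq_toFinset_card', Set.toFinset_card] at h
    simpa [mul_comm] using h
  obtain ⟨e⟩ := Function.Embedding.nonempty_of_card_le h2
  by_cases hne : Nonempty (Fin b × Bool)
  · obtain ⟨y⟩ := hne
    let g : V → Fin b × Bool := fun v => if hv : v ∈ H.support then e ⟨v, hv⟩ else y
    have hg : Set.InjOn g H.support := by
      intro u hu w hw huw
      simpa [g, hu, hw] using huw
    exact ⟨doubleStar H g, doubleStar_isAcyclic hg, fun u v huv => doubleStar_cover hg huv⟩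
  · refine ⟨fun _ => ⊥, fun _ => isAcyclic_bot, fun u v huv => ?_⟩
    exact absurd ⟨e ⟨u, v, huv⟩⟩ hne

/-- The exceptional step of the bound on the number of forests: the forests of `H` without `v` can
be chosen such that `p` is isolated in one of them, which leaves room for two edges at `v`. -/
theorem forestCover_of_nonadjacent [Fintype V] {b : ℕ} (hb : 2 ≤ b) {H : SimpleGraph V} {v p q : V}
    (hcard : H.support.ncard ≤ 2 * b + 1) (hd : (H.neighborSet v).ncard = b + 1)
    (hvp : H.Adj v p) (hq : q ∈ H.support) (hqv : q ≠ v) (hqp : q ≠ p) (hpq : ¬ H.Adj p q) :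
    ForestCover b H := by
  classical
  set H' := H.deleteIncidenceSet v with hH'
  have hpv : p ≠ v := hvp.ne'
  let S : Finset V := H.support.toFinset.erase v
  have hvS : v ∈ H.support.toFinset := by simpa using ⟨p, hvp⟩
  have hS : S.card ≤ 2 * b := by
    rw [Finset.card_erase_of_mem hvS, ← Set.ncard_eq_toFinset_card']
    omega
  have hpS : p ∈ S := by simpa [S] using ⟨hpv, v, hvp.symm⟩
  have hqS : q ∈ S := by simpa [S] using ⟨hqv, hq⟩
  have h2 : Fintype.card S ≤ Fintype.card (Fin b × Bool) := by simpa [mul_comm] using hS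
  obtain ⟨e⟩ := Function.Embedding.nonempty_of_card_le h2
  let i0 : Fin b := ⟨0, by omega⟩
  let i1 : Fin b := ⟨1, by omega⟩
  have hi : i0 ≠ i1 := by simp [i0, i1]
  -- move `q` to the centre of the first star and `p` to its leaf next to `q`
  let π1 : Equiv.Perm (Fin b × Bool) := Equiv.swap (e ⟨q, hqS⟩) (i0, false)
  let π : Equiv.Perm (Fin b × Bool) := Equiv.swap (π1 (e ⟨p, hpS⟩)) (i1, false) * π1
  have hepq : e ⟨p, hpS⟩ ≠ e ⟨q, hqS⟩ := fun h => hqp (by simpa using (e.injective h).symm)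
  have hπp : π (e ⟨p, hpS⟩) = (i1, false) := by simp [π]
  have hπq : π (e ⟨q, hqS⟩) = (i0, false) := by
    have h1 : π1 (e ⟨q, hqS⟩) = (i0, false) := by simp [π1]
    rw [Equiv.Perm.mul_apply, h1]
    refine Equiv.swap_apply_of_ne_of_ne ?_ (by simp [hi])
    rw [← h1]
    exact fun h => hepq (π1.injective h).symm
  let g : V → Fin b × Bool := fun u => if hu : u ∈ S then π (e ⟨u, hu⟩) else (i0, false)
  have hgS : Set.InjOn g S := by
    intro u hu w hw huw
    simp only [Finset.mem_coe] at hu hw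
    simpa [g, hu, hw] using huw
  have hsub : H'.support ⊆ S := by
    rintro x ⟨y, hxy⟩
    have := deleteIncidenceSet_adj.1 hxy
    simpa [S] using (⟨⟨y, this.1⟩, this.2.1⟩ : x ∈ H.support ∧ x ≠ v)
  have hg : Set.InjOn g H'.support := hgS.mono hsub
  have hgp : g p = (i1, false) := by simp only [g, hpS, dite_true, hπp]
  have hgq : g q = (i0, false) := by simp only [g, hqS, dite_true, hπq]
  have hiso : ∀ i x, ¬ (doubleStar H' g i).Adj v x := fun i x h =>
    (deleteIncidenceSet_adj.1 h.1).2.1 rfl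
  obtain ⟨F, h1, h2, h3, h4⟩ := exists_attach (doubleStar_isAcyclic hg) hiso
    (N := (H.neighborSet v).toFinset.erase p) (by
      rw [Finset.card_erase_of_mem (by simpa using hvp), ← Set.ncard_eq_toFinset_card', hd]
      omega) (by simp)
  -- In star `i0` the vertex `p` could only be joined to the centre on its own side. That centre is
  -- `q`, and `pq` is not an edge; so `p` stays isolated and can take the one edge at `v` that the
  -- attachment left over.
  have hp0 : ∀ x, ¬ (F i0).Adj p x := by
    refine h4 i0 p hpv (by simp) fun x hx => ?_
    have hxS : x ∈ S := hsub ⟨p, hx.1.symm⟩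
    have h5 : starArc i0 (g x) (g p) := by
      rcases hx.2 with h | h
      · exact absurd (hgp ▸ h.1) (by simpa using hi.symm)
      · exact h
    rw [hgp] at h5
    have h6 : g x = (i0, false) := by
      refine Prod.ext h5.1 ?_
      rcases h5.2 with h | h | h
      · exact absurd h.1 hi.symm
      · exact h.2
      · exact absurd h.1 (by simp [i0, i1])
    have h7 : x = q := hgS hxS hqS (h6.trans hgq.symm)
    subst h7
    exact hpq (deleteIncidenceSet_adj.1 hx.1).1
  refine ⟨fun i => if i = i0 then F i ⊔ edge v p else F i, fun i => ?_, fun x y hxy => ?_⟩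
  · by_cases h : i = i0
    · subst h
      simpa using isAcyclic_sup_edge (h1 i0) hp0
    · simpa [h] using h1 i
  · have hle : ∀ i, F i ≤ if i = i0 then F i ⊔ edge v p else F i := by
      intro i
      by_cases h : i = i0 <;> simp [h]
    have hv : ∀ w, H.Adj v w → ∃ i, (if i = i0 then F i ⊔ edge v p else F i).Adj v w := by
      intro w hw
      by_cases hwp : w = p
      · refine ⟨i0, ?_⟩
        simp only [if_true, sup_adj, edge_adj]
        exact Or.inr ⟨Or.inl ⟨trivial, hwp⟩, hw.ne⟩
      · obtain ⟨i, hi⟩ := h3 w (by simpa using ⟨hwp, hw⟩)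
        exact ⟨i, hle i hi⟩
    by_cases hx : x = v
    · subst hx
      exact hv y hxy
    by_cases hy : y = v
    · subst hy
      obtain ⟨i, hi⟩ := hv x hxy.symm
      exact ⟨i, hi.symm⟩
    obtain ⟨i, hi⟩ := doubleStar_cover hg (deleteIncidenceSet_adj.2 ⟨hxy, hx, hy⟩)
    exact ⟨i, hle i (h2 i hi)⟩

/-- Induction on the edges by splitting off vertices of degree between `1` and `b`. If there are
none, all degrees on the support are at least `b + 1`, and the edge bound leaves at most `2b + 1`
vertices there. Up to `2b` vertices are covered by double stars; in the last case degree sums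
produce the configuration of `forestCover_of_nonadjacent`. -/
theorem forestCover_of_card_lt [Fintype V] {b : ℕ} (hb : 2 ≤ b) (H : SimpleGraph V)
    (h : H.edgeSet.ncard < (b + 1) ^ 2) : ForestCover b H := by
  classical
  induction hN : H.edgeSet.ncard using Nat.strong_induction_on generalizing H with
  | _ N ih =>
  subst hN
  by_cases hlow : ∃ v w, H.Adj v w ∧ (H.neighborSet v).ncard ≤ b
  · obtain ⟨v, w, hvw, hd⟩ := hlow
    refine forestCover_deleteIncidence hd (ih _ ?_ _ ?_ rfl)
    all_goals
      have hlt : (H.deleteIncidenceSet v).edgeSet.ncard < H.edgeSet.ncard := by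
        refine Set.ncard_lt_ncard ⟨edgeSet_mono (H.deleteIncidenceSet_le v), fun hle => ?_⟩
          (Set.toFinite _)
        exact (deleteIncidenceSet_adj.1 (hle (show s(v, w) ∈ H.edgeSet from hvw))).2.1 rfl
      omega
  push Not at hlow
  by_cases hs : H.support.ncard ≤ 2 * b
  · exact forestCover_of_support_card_le hs
  have hdeg : ∀ v, (H.neighborSet v).ncard = H.degree v := fun v => by
    rw [Set.ncard_eq_toFinset_card', ← card_neighborSet_eq_degree, Set.toFinset_card]
  have hm : H.edgeSet.ncard = H.edgeFinset.card := by
    rw [Set.ncard_eq_toFinset_card']; rfl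
  set S := H.support.toFinset with hSdef
  have hScard : S.card = H.support.ncard := (Set.ncard_eq_toFinset_card' _).symm
  have hmem : ∀ v, v ∈ S ↔ ∃ w, H.Adj v w := by intro v; simp [S, mem_support]
  have hsum : ∑ v ∈ S, H.degree v = 2 * H.edgeSet.ncard := by
    rw [hm, ← sum_degrees_eq_twice_card_edges]
    refine Finset.sum_subset (Finset.subset_univ _) fun v _ hv => ?_
    by_contra h0
    exact hv ((hmem v).2 ((degree_pos_iff_exists_adj _ _).1 (Nat.pos_of_ne_zero h0)))
  have hlow' : ∀ v ∈ S, b + 1 ≤ H.degree v := by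
    intro v hv
    obtain ⟨w, hw⟩ := (hmem v).1 hv
    rw [← hdeg]
    exact hlow v w hw
  have hge : S.card * (b + 1) ≤ ∑ v ∈ S, H.degree v := by
    simpa using Finset.card_nsmul_le_sum S _ _ hlow'
  have hSeq : S.card = 2 * b + 1 := by
    have : S.card < 2 * (b + 1) := by
      by_contra hcon
      push Not at hcon
      nlinarith
    omega
  -- Otherwise the degree sum would be at least `(2b + 1)(b + 2)`, which exceeds `2(b + 1)²`.
  obtain ⟨v, hv, hvd⟩ : ∃ v ∈ S, H.degree v = b + 1 := by
    by_contra hcon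
    push Not at hcon
    have : S.card * (b + 2) ≤ ∑ v ∈ S, H.degree v := by
      have := Finset.card_nsmul_le_sum S (fun v => H.degree v) (b + 2) fun v hv => by
        have := hlow' v hv
        have := hcon v hv
        omega
      simpa using this
    rw [hSeq] at this
    nlinarith
  -- Otherwise the `b + 1` neighbours of `v` have degree at least `2b` and the other `b` vertices
  -- degree at least `b + 1`. The sum `3b(b + 1)` is too large for `b ≥ 2`.
  obtain ⟨p, q, hvp, hq, hqv, hqp, hpq⟩ : ∃ p q, H.Adj v p ∧ q ∈ S ∧ q ≠ v ∧ q ≠ p ∧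
      ¬ H.Adj p q := by
    by_contra hcon
    push Not at hcon
    have hfull : ∀ p ∈ H.neighborFinset v, 2 * b ≤ H.degree p := by
      intro p hp
      rw [mem_neighborFinset] at hp
      have hpS : p ∈ S := (hmem p).2 ⟨v, hp.symm⟩
      have hsub : S.erase p ⊆ H.neighborFinset p := by
        intro q hq
        rw [Finset.mem_erase] at hq
        rw [mem_neighborFinset]
        by_cases hqv : q = v
        · exact hqv ▸ hp.symm
        · exact hcon p q hp hq.2 hqv hq.1
      have := Finset.card_le_card hsub
      rw [Finset.card_erase_of_mem hpS, card_neighborFinset_eq_degree] at this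
      omega
    have hN : H.neighborFinset v ⊆ S := fun p hp => (hmem p).2 ⟨v, by simpa [adj_comm] using hp⟩
    have e1 := Finset.sum_sdiff (f := fun v => H.degree v) hN
    have e2 : (H.neighborFinset v).card * (2 * b) ≤ ∑ p ∈ H.neighborFinset v, H.degree p := by
      simpa using Finset.card_nsmul_le_sum _ _ _ hfull
    have e3 : (S \ H.neighborFinset v).card * (b + 1) ≤
        ∑ p ∈ S \ H.neighborFinset v, H.degree p := by
      simpa using Finset.card_nsmul_le_sum (S \ H.neighborFinset v) _ _
        fun u hu => hlow' u (Finset.mem_sdiff.1 hu).1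
    rw [Finset.card_sdiff_of_subset hN, card_neighborFinset_eq_degree, hvd, hSeq] at e3
    rw [card_neighborFinset_eq_degree, hvd] at e2
    have e4 : 2 * b + 1 - (b + 1) = b := by omega
    rw [e4] at e3
    nlinarith
  exact forestCover_of_nonadjacent hb (by omega) (by rw [hdeg, hvd]) hvp (by simpa [S] using hq)
    hqv hqp hpq

end Forests


/-! ## Trusses and components -/

section Truss

open SimpleGraph

variable {V : Type*} {G : SimpleGraph V}

/-- The subgraph with the edges of `P` and without isolated vertices. -/
def ofGraph (P : SimpleGraph V) (h : P ≤ G) : G.Subgraph where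
  verts := P.support
  Adj := P.Adj
  adj_sub := fun h' => h h'
  edge_vert := fun h' => ⟨_, h'⟩
  symm := P.symm

@[simp] theorem ofGraph_spanningCoe {P : SimpleGraph V} {h : P ≤ G} :
    (ofGraph P h).spanningCoe = P := by
  ext u v; rfl

theorem ofGraph_eq {P : SimpleGraph V} {h : P ≤ G} {H : G.Subgraph}
    (h1 : ∀ u v, H.Adj u v ↔ P.Adj u v) (h2 : ∀ v ∈ H.verts, ∃ w, H.Adj v w) :
    H = ofGraph P h := by
  refine Subgraph.ext (Set.ext fun v => ⟨fun hv => ?_, fun hv => ?_⟩) ?_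
  · obtain ⟨w, hw⟩ := h2 v hv
    exact ⟨w, (h1 v w).1 hw⟩
  · obtain ⟨w, hw⟩ := hv
    exact H.edge_vert ((h1 v w).2 hw)
  · ext u v
    exact h1 u v

/-- Number of common neighbours. -/
noncomputable def common (P : SimpleGraph V) (u v : V) : ℕ :=
  (P.neighborSet u ∩ P.neighborSet v).ncard

theorem sup_eq_common (H : G.Subgraph) (u v : V) : sup H u v = common H.spanningCoe u v := rfl

theorem common_comm (P : SimpleGraph V) (u v : V) : common P u v = common P v u := by
  simp [common, Set.inter_comm]

section Finite

variable [Fintype V]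

theorem common_mono {P P' : SimpleGraph V} (h : P ≤ P') (u v : V) :
    common P u v ≤ common P' u v :=
  Set.ncard_le_ncard (Set.inter_subset_inter (fun _ hx => h hx) (fun _ hx => h hx))
    (Set.toFinite _)

theorem common_lt_degree {P : SimpleGraph V} {u v : V} (h : P.Adj u v) :
    common P u v + 1 ≤ (P.neighborSet u).ncard := by
  refine Nat.succ_le_of_lt (Set.ncard_lt_ncard ⟨Set.inter_subset_left, fun hle => ?_⟩
    (Set.toFinite _))
  exact (hle (show v ∈ P.neighborSet u from h)).2.ne rfl

theorem common_le_card (P : SimpleGraph V) (u v : V) : common P u v ≤ Fintype.card V := by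
  rw [← Nat.card_eq_fintype_card, ← Set.ncard_univ]
  exact Set.ncard_le_ncard (Set.subset_univ _) (Set.toFinite _)

theorem sup_le_card (H : G.Subgraph) (u v : V) : sup H u v ≤ Fintype.card V :=
  common_le_card H.spanningCoe u v

theorem trussness_le (H : G.Subgraph) {u v : V} (h : H.Adj u v) :
    trussness H ≤ sup H u v + 2 := by
  have : sInf {s | ∃ u v, H.Adj u v ∧ s = sup H u v} ≤ sup H u v := Nat.sInf_le ⟨u, v, h, rfl⟩
  unfold trussness
  omega

theorem isTruss_trussness (H : G.Subgraph) : IsTruss (trussness H) H :=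
  fun _ _ h => trussness_le H h

theorem le_trussness {H : G.Subgraph} {l : ℕ} (hH : IsTruss l H) {u v : V} (h : H.Adj u v) :
    l ≤ trussness H := by
  obtain ⟨x, y, hxy, he⟩ := Nat.sInf_mem (s := {s | ∃ u v, H.Adj u v ∧ s = sup H u v})
    ⟨_, u, v, h, rfl⟩
  have := hH x y hxy
  unfold trussness
  omega

theorem IsTruss.mono {H : G.Subgraph} {l k : ℕ} (hH : IsTruss k H) (h : l ≤ k) : IsTruss l H :=
  fun u v huv => h.trans (hH u v huv)

theorem bddAbove_edgeTrussness (u v : V) :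
    BddAbove {k | ∃ H : G.Subgraph, H.Adj u v ∧ k = trussness H} := by
  refine ⟨Fintype.card V + 2, ?_⟩
  rintro k ⟨H, h, rfl⟩
  exact (trussness_le H h).trans (Nat.add_le_add_right (sup_le_card _ _ _) 2)

theorem le_edgeTrussness {H : G.Subgraph} {l : ℕ} (hH : IsTruss l H) {u v : V} (h : H.Adj u v) :
    l ≤ edgeTrussness G u v :=
  (le_trussness hH h).trans (le_csSup (bddAbove_edgeTrussness u v) ⟨H, h, rfl⟩)

theorem exists_edgeTrussness {u v : V} (h : G.Adj u v) :
    ∃ H : G.Subgraph, H.Adj u v ∧ IsTruss (edgeTrussness G u v) H := by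
  obtain ⟨H, h1, h2⟩ := Nat.sSup_mem (s := {k | ∃ H : G.Subgraph, H.Adj u v ∧ k = trussness H})
    ⟨_, ⊤, h, rfl⟩ (bddAbove_edgeTrussness u v)
  refine ⟨H, h1, ?_⟩
  rw [edgeTrussness, h2]
  exact isTruss_trussness H

theorem edgeTrussness_le {u v : V} (h : G.Adj u v) :
    edgeTrussness G u v ≤ Fintype.card V + 2 := by
  obtain ⟨H, h1, h2⟩ := exists_edgeTrussness h
  exact (h2 u v h1).trans (Nat.add_le_add_right (sup_le_card _ _ _) 2)

end Finite

theorem edgeTrussness_comm (u v : V) : edgeTrussness G u v = edgeTrussness G v u := by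
  simp only [edgeTrussness, Subgraph.adj_comm]

variable (G) in
/-- The edges of trussness at least `l`. -/
def level (l : ℕ) : SimpleGraph V where
  Adj u v := G.Adj u v ∧ l ≤ edgeTrussness G u v
  symm := ⟨fun u v h => ⟨h.1.symm, edgeTrussness_comm u v ▸ h.2⟩⟩
  loopless := ⟨fun _ h => h.1.ne rfl⟩

theorem level_le (l : ℕ) : level G l ≤ G := fun _ _ h => h.1

theorem level_anti {k l : ℕ} (h : k ≤ l) : level G l ≤ level G k := fun _ _ h' => ⟨h'.1, h.trans h'.2⟩

/-- The component of `q` in `P`. -/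
def comp (P : SimpleGraph V) (q : V) : SimpleGraph V where
  Adj u v := P.Adj u v ∧ P.Reachable q u
  symm := ⟨fun _ _ h => ⟨h.1.symm, h.2.trans h.1.reachable⟩⟩
  loopless := ⟨fun _ h => h.1.ne rfl⟩

theorem comp_le (P : SimpleGraph V) (q : V) : comp P q ≤ P := fun _ _ h => h.1

theorem comp_reachable_iff {P : SimpleGraph V} {q v : V} :
    (comp P q).Reachable q v ↔ P.Reachable q v := by
  refine ⟨fun h => h.mono (comp_le P q), fun h => ?_⟩
  suffices H : ∀ u, P.Walk u v → P.Reachable q u → (comp P q).Reachable u v from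
    h.elim fun p => H q p (Reachable.refl q)
  clear h
  intro u p
  induction p with
  | nil => exact fun _ => Reachable.refl _
  | @cons a b _ h p ih =>
    intro hq
    have h' : (comp P q).Adj a b := ⟨h, hq⟩
    exact h'.reachable.trans (ih (hq.trans h.reachable))

theorem comp_mono {P P' : SimpleGraph V} (h : P ≤ P') (q : V) : comp P q ≤ comp P' q :=
  fun _ _ h' => ⟨h h'.1, h'.2.mono h⟩

theorem reachable_of_mem_support_comp {P : SimpleGraph V} {q v : V} (h : v ∈ (comp P q).support) :
    P.Reachable q v := h.choose_spec.2

/-- A common neighbour of two vertices of the component is reached by the very edges that make it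
one. Restricting to a component therefore preserves supports and the truss property. -/
theorem common_comp {P : SimpleGraph V} {q u v : V} (h : (comp P q).Adj u v) :
    common (comp P q) u v = common P u v := by
  unfold common
  congr 1
  ext w
  exact ⟨fun hw => ⟨hw.1.1, hw.2.1⟩, fun hw => ⟨⟨hw.1, h.2⟩, ⟨hw.2, h.2.trans h.1.reachable⟩⟩⟩

theorem mem_support_comp {P : SimpleGraph V} {q v : V} (hq : q ∈ P.support)
    (hv : P.Reachable q v) : v ∈ (comp P q).support := by
  by_cases h : q = v
  · subst h
    obtain ⟨w, hw⟩ := hq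
    exact ⟨w, hw, hv⟩
  · obtain ⟨p⟩ := hv.symm
    cases p with
    | nil => exact absurd rfl h
    | cons h' p => exact ⟨_, h', hv⟩

theorem reachable_coe_of_spanningCoe {H : G.Subgraph} {u v : V} (hu : u ∈ H.verts)
    (h : H.spanningCoe.Reachable u v) : ∃ hv : v ∈ H.verts, H.coe.Reachable ⟨u, hu⟩ ⟨v, hv⟩ := by
  obtain ⟨p⟩ := h
  induction p with
  | nil => exact ⟨hu, Reachable.refl _⟩
  | cons h p ih =>
    obtain ⟨hv, hr⟩ := ih (H.edge_vert (Subgraph.Adj.symm h))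
    refine ⟨hv, Reachable.trans (Adj.reachable ?_) hr⟩
    exact h

theorem reachable_spanningCoe_of_connected {H : G.Subgraph} (hH : H.Connected) {u v : V}
    (hu : u ∈ H.verts) (hv : v ∈ H.verts) : H.spanningCoe.Reachable u v := by
  have h := hH.coe.preconnected ⟨u, hu⟩ ⟨v, hv⟩
  let f : H.coe →g H.spanningCoe := ⟨fun x => x.1, fun h => h⟩
  exact h.map f

theorem connected_ofGraph_comp {P : SimpleGraph V} (hP : P ≤ G) {q : V} (hq : q ∈ P.support) :
    (ofGraph (comp P q) ((comp_le P q).trans hP)).Connected := by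
  have hq' : q ∈ (comp P q).support := mem_support_comp hq (Reachable.refl q)
  rw [Subgraph.connected_iff']
  have : Nonempty (ofGraph (comp P q) ((comp_le P q).trans hP)).verts := ⟨⟨q, hq'⟩⟩
  refine ⟨fun u v => ?_⟩
  have h1 : ∀ w : (ofGraph (comp P q) ((comp_le P q).trans hP)).verts,
      (ofGraph (comp P q) ((comp_le P q).trans hP)).coe.Reachable ⟨q, hq'⟩ w := by
    intro w
    obtain ⟨_, h⟩ := reachable_coe_of_spanningCoe (H := ofGraph (comp P q) ((comp_le P q).trans hP))
      hq' (v := w.1) (by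
        rw [ofGraph_spanningCoe, comp_reachable_iff]
        exact reachable_of_mem_support_comp w.2)
    exact h
  exact (h1 u).symm.trans (h1 v)

variable [Fintype V]

/-- A truss that witnesses the trussness of `uv` consists of edges of at least that trussness, so it
lies inside the level graph and its triangles are counted there. -/
theorem level_isTruss (l : ℕ) {u v : V} (h : (level G l).Adj u v) :
    l ≤ common (level G l) u v + 2 := by
  obtain ⟨H, h1, h2⟩ := exists_edgeTrussness h.1
  have h3 : H.spanningCoe ≤ level G l := fun x y hxy =>
    ⟨H.adj_sub hxy, le_edgeTrussness (h2.mono h.2) hxy⟩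
  exact h.2.trans ((h2 u v h1).trans (Nat.add_le_add_right (common_mono h3 u v) 2))

theorem IsTruss.le_level {H : G.Subgraph} {l : ℕ} (hH : IsTruss l H) : H.spanningCoe ≤ level G l :=
  fun _ _ h => ⟨H.adj_sub h, le_edgeTrussness hH h⟩

theorem isTruss_ofGraph_comp_level (l : ℕ) (q : V) :
    IsTruss l (ofGraph (comp (level G l) q) ((comp_le _ q).trans (level_le l))) := by
  intro u v h
  rw [sup_eq_common, ofGraph_spanningCoe, common_comp h]
  exact level_isTruss l h.1

variable {Q : Finset V}

theorem bddAbove_maxTrussness :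
    BddAbove {k | ∃ H : G.Subgraph, H.Connected ∧ H.edgeSet.Nonempty ∧ (Q : Set V) ⊆ H.verts ∧
      k = trussness H} := by
  refine ⟨Fintype.card V + 2, ?_⟩
  rintro k ⟨H, -, ⟨e, he⟩, -, rfl⟩
  induction e using Sym2.ind with
  | _ u v => exact (trussness_le H he).trans (Nat.add_le_add_right (sup_le_card _ _ _) 2)

theorem le_maxTrussness {H : G.Subgraph} {l : ℕ} (hc : H.Connected) (hH : IsTruss l H)
    (hQ : (Q : Set V) ⊆ H.verts) {u v : V} (h : H.Adj u v) : l ≤ maxTrussness G Q :=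
  (le_trussness hH h).trans (le_csSup bddAbove_maxTrussness ⟨H, hc, ⟨s(u, v), h⟩, hQ, rfl⟩)

theorem connected_top_subgraph (hG : G.Connected) : (⊤ : G.Subgraph).Connected := by
  rw [Subgraph.connected_iff']
  exact (Subgraph.topIso (G := G)).connected_iff.2 hG

theorem exists_maxTrussness (hG : G.Connected) (hn : 2 ≤ Fintype.card V) :
    ∃ H : G.Subgraph, H.Connected ∧ H.edgeSet.Nonempty ∧ (Q : Set V) ⊆ H.verts ∧
      IsTruss (maxTrussness G Q) H := by
  have : Nontrivial V := Fintype.one_lt_card_iff_nontrivial.1 hn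
  obtain ⟨v⟩ := hG.nonempty
  obtain ⟨w, hw⟩ := hG.preconnected.exists_adj_of_nontrivial v
  obtain ⟨H, h1, h2, h3, h4⟩ := Nat.sSup_mem
    (s := {k | ∃ H : G.Subgraph, H.Connected ∧ H.edgeSet.Nonempty ∧ (Q : Set V) ⊆ H.verts ∧
      k = trussness H})
    ⟨_, ⊤, connected_top_subgraph hG, ⟨s(v, w), hw⟩, by simp, rfl⟩ bddAbove_maxTrussness
  refine ⟨H, h1, h2, h3, ?_⟩
  rw [maxTrussness, h4]
  exact isTruss_trussness H

theorem two_le_maxTrussness (hG : G.Connected) (hn : 2 ≤ Fintype.card V) :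
    2 ≤ maxTrussness G Q := by
  have : Nontrivial V := Fintype.one_lt_card_iff_nontrivial.1 hn
  obtain ⟨v⟩ := hG.nonempty
  obtain ⟨w, hw⟩ := hG.preconnected.exists_adj_of_nontrivial v
  exact le_maxTrussness (H := ⊤) (connected_top_subgraph hG) (fun _ _ _ => Nat.le_add_left _ _)
    (by simp) hw

variable (G Q) in
/-- The edges of the maximal connected truss that contains `q ∈ Q`. -/
noncomputable def core (q : V) : SimpleGraph V := comp (level G (maxTrussness G Q)) q

theorem core_le (q : V) : core G Q q ≤ G := (comp_le _ _).trans (level_le _)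

theorem exists_adj_of_connected {H : G.Subgraph} (hc : H.Connected) (he : H.edgeSet.Nonempty)
    {v : V} (hv : v ∈ H.verts) : ∃ w, H.Adj v w := by
  obtain ⟨e, he⟩ := he
  induction e using Sym2.ind with
  | _ x y =>
  by_cases hx : v = x
  · exact ⟨y, hx ▸ he⟩
  · obtain ⟨p⟩ := reachable_spanningCoe_of_connected hc hv (H.edge_vert he)
    cases p with
    | nil => exact absurd rfl hx
    | cons h' p => exact ⟨_, h'⟩

theorem mem_support_level (hG : G.Connected) (hn : 2 ≤ Fintype.card V) {q : V} (hq : q ∈ Q) :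
    q ∈ (level G (maxTrussness G Q)).support := by
  obtain ⟨H, h1, h2, h3, h4⟩ := exists_maxTrussness (Q := Q) hG hn
  obtain ⟨w, hw⟩ := exists_adj_of_connected h1 h2 (h3 hq)
  exact ⟨w, h4.le_level hw⟩

theorem reachable_level (hG : G.Connected) (hn : 2 ≤ Fintype.card V) {q q' : V} (hq : q ∈ Q)
    (hq' : q' ∈ Q) : (level G (maxTrussness G Q)).Reachable q q' := by
  obtain ⟨H, h1, h2, h3, h4⟩ := exists_maxTrussness (Q := Q) hG hn
  exact (reachable_spanningCoe_of_connected h1 (h3 hq) (h3 hq')).mono h4.le_level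

/-- The component at level `l` is itself a connected `l`-truss with an edge that contains `Q`. This
turns the computation of `k` into connectivity tests on level graphs. -/
theorem le_maxTrussness_of_reachable {l : ℕ} {q : V} (hq : q ∈ (level G l).support)
    (h : ∀ q' ∈ Q, (level G l).Reachable q q') : l ≤ maxTrussness G Q := by
  obtain ⟨w, hw⟩ := id hq
  refine le_maxTrussness (connected_ofGraph_comp (level_le l) hq) (isTruss_ofGraph_comp_level l q)
    (fun q' hq' => mem_support_comp hq (h q' hq')) (u := q) (v := w) ⟨hw, Reachable.refl q⟩

theorem subset_support_core (hG : G.Connected) (hn : 2 ≤ Fintype.card V) {q : V} (hq : q ∈ Q) :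
    (Q : Set V) ⊆ (core G Q q).support := fun _ hq' =>
  mem_support_comp (mem_support_level hG hn hq) (reachable_level hG hn hq hq')

theorem isTruss_core (q : V) : IsTruss (maxTrussness G Q) (ofGraph (core G Q q) (core_le q)) :=
  isTruss_ofGraph_comp_level _ q

/-- All edges of a `k`-truss have trussness at least `k`, and connectedness confines them to one
component. So the core is a greatest element, and the maximal connected truss is unique. -/
theorem le_core {K : G.Subgraph} (hK : IsConnectedTruss (maxTrussness G Q) K) {q : V}
    (hqK : q ∈ K.verts) (hq : q ∈ (level G (maxTrussness G Q)).support) :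
    K ≤ ofGraph (core G Q q) (core_le q) := by
  have hr : ∀ v ∈ K.verts, (level G (maxTrussness G Q)).Reachable q v := fun v hv =>
    (reachable_spanningCoe_of_connected hK.1 hqK hv).mono hK.2.le_level
  exact ⟨fun v hv => mem_support_comp hq (hr v hv),
    fun u v huv => ⟨hK.2.le_level huv, hr u (K.edge_vert huv)⟩⟩

theorem isMaxConnectedTruss_core (hG : G.Connected) (hn : 2 ≤ Fintype.card V) {q : V}
    (hq : q ∈ Q) : IsMaxConnectedTruss (maxTrussness G Q) Q (ofGraph (core G Q q) (core_le q)) := by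
  have hqs := mem_support_level hG hn hq
  refine ⟨⟨⟨connected_ofGraph_comp (level_le _) hqs, isTruss_core q⟩,
    subset_support_core hG hn hq⟩, ?_⟩
  rintro K ⟨h1, h2⟩ -
  exact le_core h1 (h2 hq) hqs

theorem IsMaxConnectedTruss.eq_core (hG : G.Connected) (hn : 2 ≤ Fintype.card V) {q : V}
    (hq : q ∈ Q) {H : G.Subgraph} (hH : IsMaxConnectedTruss (maxTrussness G Q) Q H) :
    H = ofGraph (core G Q q) (core_le q) := by
  have h1 := le_core hH.1.1 (hH.1.2 hq) (mem_support_level hG hn hq)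
  exact le_antisymm h1 (hH.2 (isMaxConnectedTruss_core hG hn hq).1 h1)

end Truss


/-! ## Arboricity -/

section Arboricity

open SimpleGraph

variable {V : Type*} [Fintype V] {G : SimpleGraph V}

theorem arboricity_le {H : G.Subgraph} {b : ℕ} (h : ForestCover b H.spanningCoe) :
    arboricity H ≤ b :=
  Nat.sInf_le (forestCover_iff.1 h)

theorem forestCover_maxDeg (H : G.Subgraph) : ForestCover (maxDeg H) H.spanningCoe := by
  classical
  let e := Fintype.equivFin V
  let _ : LinearOrder V := LinearOrder.lift' e e.injective
  refine forestCover_of_lower (fun v => (e v : ℕ))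
    (fun u v h => e.injective (Fin.ext h)) fun v => ?_
  refine (Set.ncard_le_ncard (t := H.neighborSet v) (fun u hu => hu.1) (Set.toFinite _)).trans ?_
  exact Finset.le_sup (f := fun v => (H.neighborSet v).ncard) (Finset.mem_univ v)

theorem forestCover_arboricity (H : G.Subgraph) : ForestCover (arboricity H) H.spanningCoe :=
  forestCover_iff.2 (Nat.sInf_mem (s := {r | ∃ F : Fin r → SimpleGraph V,
    (∀ i, F i ≤ H.spanningCoe ∧ (F i).IsAcyclic) ∧ ∀ u v, H.Adj u v → ∃ i, (F i).Adj u v})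
    ⟨_, forestCover_iff.1 (forestCover_maxDeg H)⟩)

theorem arboricity_le_maxDeg (H : G.Subgraph) : arboricity H ≤ maxDeg H :=
  arboricity_le (forestCover_maxDeg H)

theorem forestCover_zero {H : SimpleGraph V} (h : ∀ u v, ¬ H.Adj u v) : ForestCover 0 H :=
  ⟨fun i => i.elim0, fun i => i.elim0, fun u v huv => (h u v huv).elim⟩

theorem forestCover_one {H : SimpleGraph V} (h : H.IsAcyclic) : ForestCover 1 H :=
  ⟨fun _ => H, fun _ => h, fun _ _ huv => ⟨0, huv⟩⟩

/-- A cycle has at least three edges, so here it uses all edges of `H`; in the absence of isolated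
vertices it also passes through all vertices. -/
theorem triangle_of_card_le {H : G.Subgraph} (hv : ∀ v ∈ H.verts, ∃ w, H.Adj v w)
    (hm : numEdges H ≤ 3) (hac : ¬ H.spanningCoe.IsAcyclic) : numVerts H = 3 ∧ numEdges H = 3 := by
  classical
  simp only [IsAcyclic, not_forall, not_not] at hac
  obtain ⟨x, c, hc⟩ := hac
  have hE : H.spanningCoe.edgeSet = H.edgeSet := rfl
  have hsub : c.edges.toFinset.card ≤ numEdges H := by
    rw [numEdges, ← Set.ncard_coe_finset]
    refine Set.ncard_le_ncard (fun e he => ?_) (Set.toFinite _)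
    rw [← hE]
    exact c.edges_subset_edgeSet (by simpa using he)
  have hcard : c.edges.toFinset.card = c.length := by
    rw [List.toFinset_card_of_nodup hc.edges_nodup, Walk.length_edges]
  have h3 := hc.three_le_length
  have hm3 : numEdges H = 3 := by omega
  have heq : (c.edges.toFinset : Set (Sym2 V)) = H.edgeSet := by
    refine Set.eq_of_subset_of_ncard_le (fun e he => ?_) ?_ (Set.toFinite _)
    · rw [← hE]
      exact c.edges_subset_edgeSet (by simpa using he)
    · rw [Set.ncard_coe_finset]
      change numEdges H ≤ _
      omega
  have hverts : H.verts = (c.support.tail.toFinset : Set V) := by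
    ext v
    constructor
    · intro h
      obtain ⟨w, hw⟩ := hv v h
      have h1 : s(v, w) ∈ c.edges := by
        have : s(v, w) ∈ (c.edges.toFinset : Set (Sym2 V)) := by rw [heq]; exact hw
        simpa using this
      have h2 := c.fst_mem_support_of_mem_edges h1
      simp only [List.coe_toFinset]
      rcases (Walk.mem_support_iff _).1 h2 with rfl | h3
      · exact Walk.end_mem_tail_support hc.not_nil
      · exact h3
    · intro h
      simp only [List.coe_toFinset] at h
      have h2 : v ∈ c.support := List.mem_of_mem_tail h
      rw [Walk.mem_support_iff_exists_mem_edges_of_not_nil hc.not_nil] at h2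
      obtain ⟨e, he, hve⟩ := h2
      have h4 : e ∈ H.edgeSet := by rw [← heq]; simpa using he
      exact H.mem_verts_of_mem_edge h4 hve
  refine ⟨?_, hm3⟩
  rw [numVerts, hverts, Set.ncard_coe_finset, List.toFinset_card_of_nodup hc.support_nodup,
    List.length_tail, Walk.length_support]
  omega

/-- If fewer than `ρ²` edges existed, `forestCover_of_card_lt` with `b = ρ - 1` would give a cover
by fewer forests. It needs `ρ ≥ 3`; for `ρ = 2` there are at most three edges but a cycle, hence a
triangle. -/
theorem arboricity_sq_le {H : G.Subgraph} (hv : ∀ v ∈ H.verts, ∃ w, H.Adj v w)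
    (hH : ¬ (numVerts H = 3 ∧ numEdges H = 3)) : arboricity H ^ 2 ≤ numEdges H := by
  by_contra hcon
  push Not at hcon
  have hE : H.spanningCoe.edgeSet.ncard = numEdges H := rfl
  rcases Nat.lt_or_ge (arboricity H) 3 with h | h
  · have h0 : numEdges H ≠ 0 := by
      intro h0
      have h1 : H.edgeSet = ∅ := (Set.ncard_eq_zero (Set.toFinite _)).1 h0
      have : arboricity H = 0 := Nat.le_zero.1 (arboricity_le (forestCover_zero fun u v huv => by
        have : s(u, v) ∈ H.edgeSet := huv
        simp [h1] at this))
      simp [this] at hcon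
    have h2 : ¬ arboricity H ≤ 1 := by
      intro h2
      have := Nat.pow_le_pow_left h2 2
      omega
    have h3 : arboricity H = 2 := by omega
    rw [h3] at hcon
    exact hH (triangle_of_card_le hv (by omega) fun hac =>
      h2 (arboricity_le (forestCover_one hac)))
  · have h1 := forestCover_of_card_lt (b := arboricity H - 1) (by omega) H.spanningCoe (by
      rw [hE, Nat.sub_add_cancel (by omega)]
      exact hcon)
    have := arboricity_le h1
    omega

/-- For `l ≥ k` the component of `q` at level `l` lies inside the core. Its degrees are at least `l
- 1`, whereas `ρ` forests provide at most `ρ` edges per vertex. This bounds the number of levels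
tried before `k` is found. -/
theorem le_two_mul_arboricity {Q : Finset V} {l : ℕ} {q : V}
    (hq : q ∈ (level G l).support) (hl : maxTrussness G Q ≤ l) :
    l ≤ 2 * arboricity (ofGraph (core G Q q) (core_le q)) + 1 := by
  classical
  set ρ := arboricity (ofGraph (core G Q q) (core_le q)) with hρ
  set P := comp (level G l) q with hP
  have hle : P ≤ core G Q q := comp_mono (level_anti hl) q
  have hc : ForestCover ρ (core G Q q) := by
    have := forestCover_arboricity (ofGraph (core G Q q) (core_le q))
    rwa [ofGraph_spanningCoe] at this
  have hqs : q ∈ P.support := mem_support_comp hq (Reachable.refl q)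
  let e := Fintype.equivFin V
  let _ : LinearOrder V := LinearOrder.lift' e e.injective
  set S := P.support.toFinset with hS
  have hmem : ∀ v, v ∈ S ↔ ∃ w, P.Adj v w := by intro v; simp [S, mem_support]
  have hSpos : 0 < S.card := Finset.card_pos.2 ⟨q, by simpa [S] using hqs⟩
  have hdeg : ∀ v ∈ S, l - 1 ≤ P.degree v := by
    intro v hv
    obtain ⟨w, hw⟩ := (hmem v).1 hv
    have h1 := common_lt_degree hw
    rw [common_comp hw, Set.ncard_eq_toFinset_card', Set.toFinset_card, card_neighborSet_eq_degree] at h1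
    have h2 := level_isTruss l hw.1
    omega
  have hsum : S.card * (l - 1) ≤ 2 * P.edgeFinset.card := by
    rw [← sum_degrees_eq_twice_card_edges]
    calc S.card * (l - 1) ≤ ∑ v ∈ S, P.degree v := by
          simpa using Finset.card_nsmul_le_sum S _ _ hdeg
      _ ≤ ∑ v, P.degree v := Finset.sum_le_sum_of_subset (Finset.subset_univ _)
  have hcard : P.edgeFinset.card ≤ ρ * S.card := by
    let E : Finset (V × V) := Finset.univ.filter fun x => P.Adj x.1 x.2 ∧ x.1 < x.2
    -- With the indicator function of the component in place of degrees, every edge of `P`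
    -- contributes `1` and the right side is `ρ` times the number of its vertices.
    have h1 := hc.sum_min_le E (fun x hx => by
      have := (Finset.mem_filter.1 hx).2
      exact ⟨hle this.1, this.2⟩) (fun v => if v ∈ S then 1 else 0)
    have h2 : ∑ x ∈ E, min (if x.1 ∈ S then 1 else 0) (if x.2 ∈ S then 1 else 0) = E.card := by
      rw [Finset.card_eq_sum_ones]
      refine Finset.sum_congr rfl fun x hx => ?_
      have := (Finset.mem_filter.1 hx).2.1
      rw [if_pos ((hmem _).2 ⟨_, this⟩), if_pos ((hmem _).2 ⟨_, this.symm⟩)]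
      rfl
    have h3 : P.edgeFinset ⊆ E.image fun x => s(x.1, x.2) := by
      intro x hx
      induction x using Sym2.ind with
      | _ u v =>
      rw [mem_edgeFinset] at hx
      have huv : P.Adj u v := hx
      rcases lt_or_gt_of_ne huv.ne with h | h
      · exact Finset.mem_image.2 ⟨(u, v), by simp [E, huv, h], rfl⟩
      · exact Finset.mem_image.2 ⟨(v, u), by simp [E, huv.symm, h], Sym2.eq_swap⟩
    have h4 := (Finset.card_le_card h3).trans Finset.card_image_le
    rw [h2] at h1
    simp only [Finset.sum_ite_mem, Finset.univ_inter, Finset.sum_const, smul_eq_mul, mul_one] at h1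
    exact h4.trans h1
  have h5 : l - 1 ≤ 2 * ρ := by
    by_contra hcon
    push Not at hcon
    nlinarith
  omega

end Arboricity

/-! ## Executions of the greedy algorithm -/

section Steps

open SimpleGraph

variable {V : Type*} [Fintype V] {G : SimpleGraph V} {k : ℕ} {Q : Finset V}

theorem trussPart_le (H : G.Subgraph) : trussPart k H ≤ H := sSup_le fun _ hK => hK.1

theorem queryPart_le (H : G.Subgraph) : queryPart Q H ≤ H := by
  refine ⟨fun v hv => hv.1, fun u v huv => huv.2.2⟩

theorem isTruss_trussPart (H : G.Subgraph) : IsTruss k (trussPart k H) := by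
  intro u v huv
  obtain ⟨K, hK, hKuv⟩ := Subgraph.sSup_adj.1 huv
  have h1 : K ≤ trussPart k H := le_sSup hK
  have h2 : K.spanningCoe ≤ (trussPart k H).spanningCoe := fun x y hxy => h1.2 hxy
  exact (hK.2.1 u v hKuv).trans (Nat.add_le_add_right (common_mono h2 u v) 2)

theorem exists_adj_trussPart (H : G.Subgraph) {v : V} (hv : v ∈ (trussPart k H).verts) :
    ∃ w, (trussPart k H).Adj v w := by
  unfold trussPart at hv
  rw [Subgraph.verts_sSup] at hv
  simp only [Set.mem_iUnion] at hv
  obtain ⟨K, hK, hvK⟩ := hv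
  obtain ⟨w, hw⟩ := hK.2.2 v hvK
  exact ⟨w, Subgraph.sSup_adj.2 ⟨K, hK, hw⟩⟩

theorem queryPart_adj_of_mem {H : G.Subgraph} {u v : V} (hu : u ∈ (queryPart Q H).verts)
    (h : H.Adj u v) : (queryPart Q H).Adj u v := by
  obtain ⟨h1, q, h2, h3, h4⟩ := id hu
  have h5 : H.spanningCoe.Adj u v := h
  exact ⟨hu, ⟨H.edge_vert h.symm, q, h2, h3, h4.trans h5.reachable⟩, h⟩

theorem exists_adj_queryPart {H : G.Subgraph} (hH : ∀ v ∈ H.verts, ∃ w, H.Adj v w) {v : V}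
    (hv : v ∈ (queryPart Q H).verts) : ∃ w, (queryPart Q H).Adj v w := by
  obtain ⟨w, hw⟩ := hH v hv.1
  exact ⟨w, queryPart_adj_of_mem hv hw⟩

theorem isTruss_queryPart {H : G.Subgraph} (hH : IsTruss k H) : IsTruss k (queryPart Q H) := by
  intro u v huv
  refine (hH u v huv.2.2).trans (Nat.add_le_add_right ?_ 2)
  refine Set.ncard_le_ncard (fun w hw => ?_) (Set.toFinite _)
  exact ⟨queryPart_adj_of_mem huv.1 hw.1, queryPart_adj_of_mem huv.2.1 hw.2⟩

theorem deleteStep_le (H : G.Subgraph) (u : V) : deleteStep k Q H u ≤ H.deleteVerts {u} :=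
  (queryPart_le _).trans (trussPart_le _)

theorem not_mem_deleteStep (H : G.Subgraph) (u : V) : u ∉ (deleteStep k Q H u).verts := by
  intro h
  have := (deleteStep_le H u).1 h
  simp at this

theorem numVerts_deleteStep_lt {H : G.Subgraph} {u : V} (hu : u ∈ H.verts) :
    numVerts (deleteStep k Q H u) < numVerts H := by
  refine Set.ncard_lt_ncard ⟨fun v hv => ?_, fun hle => not_mem_deleteStep H u (hle hu)⟩
    (Set.toFinite _)
  have := (deleteStep_le H u).1 hv
  rw [Subgraph.deleteVerts_verts] at this
  exact this.1

/-- The edge `uw` lies in at least `k - 2` triangles, each of which gives `u` another neighbour; so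
at least `k - 1` edges vanish with `u`. -/
theorem numEdges_deleteStep_le {H : G.Subgraph} {u w : V} (hH : IsTruss k H) (huw : H.Adj u w) :
    numEdges (deleteStep k Q H u) + (k - 1) ≤ numEdges H := by
  have h1 : k - 1 ≤ (H.neighborSet u).ncard := by
    have h := common_lt_degree (P := H.spanningCoe) huw
    have h' := hH u w huw
    rw [sup_eq_common] at h'
    have h'' : (H.spanningCoe.neighborSet u).ncard = (H.neighborSet u).ncard := rfl
    omega
  have h2 : ((fun x => s(u, x)) '' H.neighborSet u).ncard = (H.neighborSet u).ncard :=
    Set.ncard_image_of_injective _ fun x y hxy => Sym2.congr_right.1 hxy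
  have h3 : Disjoint (deleteStep k Q H u).edgeSet ((fun x => s(u, x)) '' H.neighborSet u) := by
    rw [Set.disjoint_left]
    rintro _ h ⟨x, -, rfl⟩
    exact not_mem_deleteStep H u ((deleteStep k Q H u).edge_vert h)
  have h4 : (deleteStep k Q H u).edgeSet ∪ ((fun x => s(u, x)) '' H.neighborSet u) ⊆ H.edgeSet := by
    refine Set.union_subset (fun e he => ?_) ?_
    · exact Subgraph.edgeSet_mono ((deleteStep_le H u).trans Subgraph.deleteVerts_le) he
    · rintro _ ⟨x, hx, rfl⟩
      exact hx
  have h5 := Set.ncard_le_ncard h4 (Set.toFinite _)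
  rw [Set.ncard_union_eq h3 (Set.toFinite _) (Set.toFinite _), h2] at h5
  unfold numEdges
  omega

theorem BasicRun.graph_zero_eq (r : BasicRun G Q) (hG : G.Connected) (hn : 2 ≤ Fintype.card V)
    {q : V} (hq : q ∈ Q) : r.graph 0 = ofGraph (core G Q q) (core_le q) := by
  have h := r.graph_zero
  rw [r.k_eq] at h
  exact h.eq_core hG hn hq

theorem BasicRun.invariant (r : BasicRun G Q) (hG : G.Connected) (hn : 2 ≤ Fintype.card V)
    (hQ : Q.Nonempty) : ∀ i ≤ r.t, IsTruss r.k (r.graph i) ∧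
      (∀ v ∈ (r.graph i).verts, ∃ w, (r.graph i).Adj v w) ∧
      numVerts (r.graph i) + i ≤ numVerts (r.graph 0) ∧
      numEdges (r.graph i) + i * (r.k - 1) ≤ numEdges (r.graph 0) := by
  obtain ⟨q, hq⟩ := hQ
  intro i
  induction i with
  | zero =>
    refine fun _ => ⟨r.graph_zero.1.1.2, fun v hv => ?_, by omega, by omega⟩
    rw [r.graph_zero_eq hG hn hq] at hv ⊢
    exact hv
  | succ i ih =>
    intro hi
    obtain ⟨h1, h2, h3, h4⟩ := ih (by omega)
    rw [r.graph_succ i (by omega)]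
    have hu := r.far_mem i (by omega)
    obtain ⟨w, hw⟩ := h2 _ hu
    refine ⟨isTruss_queryPart (isTruss_trussPart _),
      fun v hv => exists_adj_queryPart (fun v hv => exists_adj_trussPart _ hv) hv, ?_, ?_⟩
    · have := numVerts_deleteStep_lt (k := r.k) (Q := Q) hu
      omega
    · have := numEdges_deleteStep_le (Q := Q) h1 hw
      rw [add_mul]
      omega

theorem BasicRun.t_le (r : BasicRun G Q) (hG : G.Connected) (hn : 2 ≤ Fintype.card V)
    (hQ : Q.Nonempty) {C : ℕ} (hC : 2 ≤ C) :
    (r.t : ℝ) ≤ C * min (numVerts (r.graph 0) : ℝ) (numEdges (r.graph 0) / r.k) := by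
  obtain ⟨-, -, h3, h4⟩ := r.invariant hG hn hQ r.t le_rfl
  have hk : 2 ≤ r.k := r.k_eq ▸ two_le_maxTrussness hG hn
  have hk' : (0 : ℝ) < r.k := by exact_mod_cast (by omega : 0 < r.k)
  have hC' : (2 : ℝ) ≤ C := by exact_mod_cast hC
  rw [mul_min_of_nonneg _ _ (by positivity)]
  refine le_min ?_ ?_
  · have h5 : (r.t : ℝ) ≤ numVerts (r.graph 0) := by exact_mod_cast (by omega)
    have : (0 : ℝ) ≤ numVerts (r.graph 0) := by positivity
    nlinarith
  · rw [mul_div_assoc', le_div_iff₀ hk']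
    -- From `t(k - 1) ≤ m'` and `k ≤ 2(k - 1)`, which holds as `k ≥ 2`; this is where the constant
    -- must be at least `2`.
    have h5 : r.t * r.k ≤ 2 * numEdges (r.graph 0) := by
      obtain ⟨j, hj⟩ : ∃ j, r.k = j + 2 := ⟨r.k - 2, by omega⟩
      rw [hj] at h4 ⊢
      have : j + 2 - 1 = j + 1 := by omega
      rw [this] at h4
      nlinarith
    have h6 : (r.t : ℝ) * r.k ≤ 2 * numEdges (r.graph 0) := by exact_mod_cast h5
    have : (0 : ℝ) ≤ numEdges (r.graph 0) := by positivity
    nlinarith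

theorem BasicRun.bounds (r : BasicRun G Q) (hG : G.Connected) (hn : 2 ≤ Fintype.card V)
    (hQ : Q.Nonempty) {C : ℕ} (hC : 2 ≤ C) :
    (r.t : ℝ) ≤ C * min (numVerts (r.graph 0) : ℝ) (numEdges (r.graph 0) / r.k) ∧
      arboricity (r.graph 0) ≤ maxDeg (r.graph 0) ∧
      (¬ (numVerts (r.graph 0) = 3 ∧ numEdges (r.graph 0) = 3) →
        (arboricity (r.graph 0) : ℝ) ≤ √(numEdges (r.graph 0) : ℝ)) := by
  refine ⟨r.t_le hG hn hQ hC, arboricity_le_maxDeg _, fun h => ?_⟩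
  refine Real.le_sqrt_of_sq_le ?_
  exact_mod_cast arboricity_sq_le (r.invariant hG hn hQ 0 (Nat.zero_le _)).2.1 h

/-! ## Components, truss parts and distances of graphs without isolated vertices -/

theorem queryPart_ofGraph {P : SimpleGraph V} (hP : P ≤ G) {q : V} (hq : q ∈ Q)
    (hs : q ∈ P.support) (hr : ∀ q' ∈ Q, P.Reachable q q') :
    queryPart Q (ofGraph P hP) = ofGraph (comp P q) ((comp_le P q).trans hP) := by
  have h1 : ∀ v, v ∈ (queryPart Q (ofGraph P hP)).verts ↔ v ∈ P.support ∧ P.Reachable q v := by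
    intro v
    change (v ∈ P.support ∧ ∃ q' ∈ Q, q' ∈ P.support ∧ (ofGraph P hP).spanningCoe.Reachable q' v) ↔ _
    rw [ofGraph_spanningCoe]
    constructor
    · rintro ⟨h1, q', h2, -, h3⟩
      exact ⟨h1, (hr q' h2).trans h3⟩
    · rintro ⟨h1, h2⟩
      exact ⟨h1, q, hq, hs, h2⟩
  refine ofGraph_eq (fun u v => ?_) fun v hv => ?_
  · constructor
    · intro h
      exact ⟨h.2.2, ((h1 u).1 h.1).2⟩
    · intro h
      exact queryPart_adj_of_mem ((h1 u).2 ⟨⟨v, h.1⟩, h.2⟩) h.1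
  · exact exists_adj_queryPart (H := ofGraph P hP) (fun v hv => hv) hv

/-- Allows the loop condition to be tested before the component is cut out, by one search from `q`.
The condition on the support is not redundant: a single query vertex that has lost its edges is
connected to all of `Q` but is no longer in the graph. -/
theorem connects_queryPart_iff {P : SimpleGraph V} (hP : P ≤ G) {q : V} (hq : q ∈ Q) :
    Connects (queryPart Q (ofGraph P hP)) Q ↔ q ∈ P.support ∧ ∀ q' ∈ Q, P.Reachable q q' := by
  constructor
  · rintro ⟨h1, h2⟩
    refine ⟨(h1 hq).1, fun q' hq' => (h2 q hq q' hq').mono fun x y hxy => ?_⟩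
    exact hxy.2.2
  · rintro ⟨h1, h2⟩
    rw [queryPart_ofGraph hP hq h1 h2]
    refine ⟨fun q' hq' => mem_support_comp h1 (h2 q' hq'), fun p hp p' hp' => ?_⟩
    rw [ofGraph_spanningCoe]
    exact (comp_reachable_iff.2 (h2 p hp)).symm.trans (comp_reachable_iff.2 (h2 p' hp'))

/-- The interface to the cascade: containment, large supports and survival of all trusses identify
the result, however the deletions were ordered. -/
theorem trussPart_eq {H : G.Subgraph} {P : SimpleGraph V} (hP : P ≤ G) (h1 : P ≤ H.spanningCoe)
    (h2 : ∀ u v, P.Adj u v → k ≤ common P u v + 2)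
    (h3 : ∀ K ≤ H, IsTruss k K → K.spanningCoe ≤ P) : trussPart k H = ofGraph P hP := by
  refine le_antisymm (sSup_le ?_) (le_sSup ⟨⟨?_, ?_⟩, ?_, ?_⟩)
  · rintro K ⟨hK1, hK2, hK3⟩
    refine ⟨fun v hv => ?_, fun u v huv => h3 K hK1 hK2 huv⟩
    obtain ⟨w, hw⟩ := hK3 v hv
    exact ⟨w, h3 K hK1 hK2 hw⟩
  · rintro v ⟨w, hw⟩
    exact H.edge_vert (h1 hw)
  · exact fun u v huv => h1 huv
  · intro u v huv
    rw [sup_eq_common, ofGraph_spanningCoe]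
    exact h2 u v huv
  · exact fun v hv => hv

theorem queryDist_ofGraph {P : SimpleGraph V} (hP : P ≤ G) {v : V}
    (hr : ∀ q ∈ Q, P.Reachable q v) :
    queryDist (ofGraph P hP) Q v = ((Q.sup fun q => P.dist q v : ℕ) : ℕ∞) := by
  unfold queryDist
  rw [ofGraph_spanningCoe]
  refine le_antisymm (iSup₂_le fun q hq => ?_) ?_
  · rw [edist_comm, ← (hr q hq).coe_dist_eq_edist]
    exact_mod_cast Finset.le_sup (f := fun q => P.dist q v) hq
  · rcases Q.eq_empty_or_nonempty with rfl | hQ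
    · simp
    · obtain ⟨q, hq, he⟩ := Finset.exists_mem_eq_sup Q hQ fun q => P.dist q v
      rw [he, (hr q hq).coe_dist_eq_edist, edist_comm]
      exact le_iSup₂_of_le q hq le_rfl

theorem graphQueryDist_eq {H : G.Subgraph} {u : V} (hu : u ∈ H.verts)
    (h : ∀ v ∈ H.verts, queryDist H Q v ≤ queryDist H Q u) :
    graphQueryDist H Q = queryDist H Q u :=
  le_antisymm (iSup₂_le h) (le_iSup₂_of_le u hu le_rfl)

end Steps


/-! ## Breadth-first search -/

section Search

open SimpleGraph

variable {V : Type*} {R : SimpleGraph V} {q : V}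

/-- State of a breadth-first search: `L` lists the discovered vertices in the order of discovery,
and the first `h` of them have been processed. -/
structure Search (R : SimpleGraph V) (q : V) (L : List V) (h : ℕ) : Prop where
  nodup : L.Nodup
  start : q ∈ L
  reach : ∀ v ∈ L, R.Reachable q v
  mono : L.Pairwise fun a b => R.dist q a ≤ R.dist q b
  near : ∀ x ∈ L, ∀ y ∈ L.drop h, R.dist q x ≤ R.dist q y + 1
  closed : ∀ x ∈ L.take h, ∀ w, R.Adj x w → w ∈ L

theorem Search.init (R : SimpleGraph V) (q : V) : Search R q [q] 0 where
  nodup := by simp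
  start := by simp
  reach := by simp
  mono := by simp
  near := by simp
  closed := by simp

theorem exists_pred {x : V} {c : ℕ} (hr : R.Reachable q x) (hx : R.dist q x = c + 1) :
    ∃ y, R.Adj y x ∧ R.Reachable q y ∧ R.dist q y = c := by
  obtain ⟨p, hp⟩ := hr.symm.exists_walk_length_eq_dist
  cases p with
  | nil => simp at hx
  | @cons _ y _ h p =>
    have hry : R.Reachable q y := ⟨p.reverse⟩
    rw [dist_comm, hx, Walk.length_cons] at hp
    have h1 : R.dist q y ≤ c := by
      rw [dist_comm]
      exact (dist_le p).trans (by omega)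
    have h2 : R.dist q x ≤ R.dist q y + 1 := by
      obtain ⟨p', hp'⟩ := hry.exists_walk_length_eq_dist
      rw [← hp', ← Walk.length_concat p' h.symm]
      exact dist_le _
    exact ⟨y, h.symm, hry, by omega⟩

theorem dist_adj_le {v w : V} (hr : R.Reachable q v) (h : R.Adj v w) :
    R.dist q w ≤ R.dist q v + 1 := by
  obtain ⟨p', hp'⟩ := hr.exists_walk_length_eq_dist
  rw [← hp', ← Walk.length_concat p' h]
  exact dist_le _

/-- Induction on the distance. A predecessor is listed by induction and is strictly nearer than
`L[h]`; as the list is sorted by distance, it stands before position `h`, so it has been processed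
and its neighbours are listed. -/
theorem Search.mem_of_dist_le {L : List V} {h : ℕ} (hS : Search R q L h) (hh : h < L.length) :
    ∀ c ≤ R.dist q L[h], ∀ x, R.Reachable q x → R.dist q x = c → x ∈ L := by
  intro c
  induction c with
  | zero =>
    intro _ x hx h0
    rw [hx.dist_eq_zero_iff] at h0
    exact h0 ▸ hS.start
  | succ c ih =>
    intro hc x hx hd
    obtain ⟨y, hyx, hry, hdy⟩ := exists_pred hx hd
    have hy := ih (by omega) y hry hdy
    obtain ⟨i, hi, rfl⟩ := List.mem_iff_getElem.1 hy
    by_cases hih : i < h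
    · exact hS.closed _ (List.mem_take_iff_getElem.2 ⟨i, by omega, rfl⟩) x hyx
    · exfalso
      rcases Nat.lt_or_eq_of_le (Nat.le_of_not_lt hih) with hlt | rfl
      · have := List.pairwise_iff_getElem.1 hS.mono h i hh hi hlt
        omega
      · omega

/-- Adjacency bounds the distance from above; were it smaller, `w` would already be listed by
`Search.mem_of_dist_le`. -/
theorem Search.dist_new {L : List V} {h : ℕ} (hS : Search R q L h) (hh : h < L.length) {w : V}
    (hw : R.Adj L[h] w) (hwL : w ∉ L) : R.dist q w = R.dist q L[h] + 1 := by
  have hr := hS.reach _ (List.getElem_mem hh)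
  have h1 := dist_adj_le hr hw
  have hrw := hr.trans hw.reachable
  by_contra hne
  exact hwL (hS.mem_of_dist_le hh _ (by omega) w hrw rfl)

/-- The next vertex in the list has been processed, and `M` has been discovered meanwhile. -/
theorem Search.step {L M : List V} {h : ℕ} (hS : Search R q L h) (hh : h < L.length)
    (hnd : (L ++ M).Nodup) (hM : ∀ w ∈ M, R.Adj L[h] w) (hcl : ∀ w, R.Adj L[h] w → w ∈ L ++ M) :
    Search R q (L ++ M) (h + 1) := by
  have hr := hS.reach _ (List.getElem_mem hh)
  have hdM : ∀ w ∈ M, R.dist q w = R.dist q L[h] + 1 := fun w hw =>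
    hS.dist_new hh (hM w hw) fun hwL => (List.disjoint_of_nodup_append hnd) hwL hw
  have hdrop : L.drop h = L[h] :: L.drop (h + 1) := List.drop_eq_getElem_cons hh
  have hmem : L[h] ∈ L.drop h := hdrop ▸ List.mem_cons_self
  refine ⟨hnd, List.mem_append_left _ hS.start, ?_, ?_, ?_, ?_⟩
  · intro v hv
    rcases List.mem_append.1 hv with hv | hv
    · exact hS.reach v hv
    · exact hr.trans (hM v hv).reachable
  · refine List.pairwise_append.2 ⟨hS.mono, ?_, ?_⟩
    · rw [List.pairwise_iff_forall_sublist]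
      intro a b hab
      have ha : a ∈ M := hab.subset (by simp)
      have hb : b ∈ M := hab.subset (by simp)
      rw [hdM a ha, hdM b hb]
    · intro a ha b hb
      rw [hdM b hb]
      exact hS.near a ha _ hmem
  · intro x hx y hy
    have h1 : R.dist q x ≤ R.dist q L[h] + 1 := by
      rcases List.mem_append.1 hx with hx | hx
      · exact hS.near x hx _ hmem
      · exact (hdM x hx).le
    have h2 : R.dist q L[h] ≤ R.dist q y := by
      rw [List.drop_append_of_le_length (by omega)] at hy
      rcases List.mem_append.1 hy with hy | hy
      · have h3 := hS.mono.sublist (List.drop_sublist h L)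
        rw [hdrop, List.pairwise_cons] at h3
        exact h3.1 y hy
      · rw [hdM y hy]; omega
    omega
  · intro x hx w hw
    rw [List.take_append_of_le_length (by omega), ← List.take_concat_get' L h hh] at hx
    rcases List.mem_append.1 hx with hx | hx
    · exact List.mem_append_left _ (hS.closed x hx w hw)
    · rw [List.mem_singleton] at hx
      exact hcl w (hx ▸ hw)

theorem Search.mem_iff {L : List V} (hS : Search R q L L.length) (v : V) :
    v ∈ L ↔ R.Reachable q v := by
  refine ⟨hS.reach v, fun hr => ?_⟩
  have h1 := hS.closed
  rw [List.take_length] at h1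
  suffices H : ∀ u, u ∈ L → R.Walk u v → v ∈ L from hr.elim fun p => H q hS.start p
  clear hr hS
  intro u hu p
  induction p with
  | nil => exact hu
  | cons h p ih => exact ih (h1 _ hu _ h)

end Search

/-! ## Scanning an adjacency list -/

section Scan

variable {n : ℕ} {G : SimpleGraph (Fin n)} {inp : Input} {W : ℕ} {Z : Set (ℕ × ℕ)}

/-- Neighbours of `v` by edges of trussness at least `l`, as given by the input. -/
def nb (n : ℕ) (inp : Input) (l : ℕ) (v : Fin n) : Finset (Fin n) :=
  Finset.univ.filter fun w => l ≤ inp .edgeTruss v w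

@[simp] theorem mem_nb {l : ℕ} {v w : Fin n} : w ∈ nb n inp l v ↔ l ≤ inp .edgeTruss v w := by
  simp [nb]

theorem mem_nb_iff (hI : IsTrussIndex G inp) {l : ℕ} (hl : 1 ≤ l) {v w : Fin n} :
    w ∈ nb n inp l v ↔ (level G l).Adj v w := by
  rw [mem_nb]
  by_cases h : G.Adj v w
  · rw [hI.edgeTruss v w h]
    exact ⟨fun h' => ⟨h, h'⟩, fun h' => h'.2⟩
  · rw [hI.edgeTruss_zero v w h]
    exact ⟨fun h' => by omega, fun h' => (h h'.1).elim⟩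

/-- Run `c` for all neighbours `w` (register 13) of the vertex in register 10 by edges of trussness
at least the value of register 0. -/
def scan (c : Com) : Com :=
  block [.input 12 .degree (.reg 10) (.lit 0), .assign 11 (.lit 0),
    .loop (.reg 11) (.reg 12) (block [.input 13 .neighbor (.reg 10) (.reg 11),
      .input 14 .edgeTruss (.reg 10) (.reg 13),
      .ite (.reg 14) (.reg 0) (.assign 12 (.reg 11))
        (block [c, .assign 11 (.add (.reg 11) (.lit 1))])])]

theorem degree_le (hI : IsTrussIndex G inp) (v : Fin n) : inp .degree v 0 ≤ n := by
  rw [hI.degree v]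
  have h := Set.ncard_le_ncard (Set.subset_univ (G.neighborSet v)) (Set.toFinite _)
  rwa [Set.ncard_univ, Nat.card_eq_fintype_card, Fintype.card_fin] at h

theorem edgeTruss_le (hI : IsTrussIndex G inp) (v w : Fin n) : inp .edgeTruss v w ≤ n + 2 := by
  by_cases h : G.Adj v w
  · rw [hI.edgeTruss v w h]
    simpa using edgeTrussness_le h
  · rw [hI.edgeTruss_zero v w h]
    omega

/-- Lists are in descending order of trussness, so the wanted neighbours form a prefix. At the first
failing probe the end marker in register 12 is moved to the current position, which ends the loop.
The cost is governed by the degree at level `l`, not by the degree in `G`. The invariant is indexed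
by the set of visited neighbours because their order is irrelevant. -/
theorem WP.scan (hI : IsTrussIndex G inp) (hW : n + 2 ≤ W) {c : Com} {s : State} {K l : ℕ}
    {v : Fin n} (Inv : Finset (Fin n) → State → Prop) (hl : 1 ≤ l) (hlW : l ≤ W) (h0 : s.reg 0 = l)
    (h10 : s.reg 10 = v)
    (hc0 : c.wr 0 = false) (hc10 : c.wr 10 = false) (hc11 : c.wr 11 = false)
    (hc12 : c.wr 12 = false)
    (hinv : ∀ X s1 x y, 11 ≤ x → x ≤ 14 → Inv X s1 → Inv X (s1.setReg x y))
    (hInv : Inv ∅ s)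
    (hstep : ∀ X w s1, Same (scan c) s s1 → X ⊆ nb n inp l v → w ∉ X → w ∈ nb n inp l v →
      s1.reg 13 = w → Inv X s1 → WP inp W Z c s1 K (Inv (insert w X))) :
    WP inp W Z (scan c) s ((K + 20) * (nb n inp l v).card + 30) (Inv (nb n inp l v)) := by
  classical
  set D := inp .degree v 0 with hD
  set f : ℕ → ℕ := fun j => inp .neighbor v j with hf
  have hDn : D ≤ n := degree_le hI v
  have hbij := hI.neighbor v
  have hN1 : ∀ j < D, ∃ w : Fin n, f j = w ∧ G.Adj v w := by
    intro j hj
    obtain ⟨w, hw, he⟩ := hbij.mapsTo (show j ∈ Set.Iio D from hj)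
    exact ⟨w, he.symm, hw⟩
  have hN2 : ∀ i < D, ∀ j < D, f i = f j → i = j := fun i hi j hj h =>
    hbij.injOn (show i ∈ Set.Iio D from hi) (show j ∈ Set.Iio D from hj) h
  have hN3 : ∀ w : Fin n, G.Adj v w → ∃ j < D, f j = w := by
    intro w hw
    obtain ⟨j, hj, he⟩ := hbij.surjOn ⟨w, hw, rfl⟩
    exact ⟨j, hj, he⟩
  have hwr : ∀ x, (CTC.scan c).wr x = false ↔ c.wr x = false ∧ x ≠ 11 ∧ x ≠ 12 ∧ x ≠ 13 ∧ x ≠ 14 := by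
    intro x
    simp only [CTC.scan, block, Com.wr, Bool.or_eq_false_iff, beq_eq_false_iff_ne]
    tauto
  have hwa : ∀ a, (CTC.scan c).wa a = false ↔ c.wa a = false := by
    intro x
    simp only [CTC.scan, block, Com.wa, Bool.or_eq_false_iff]
    tauto
  have hsame : ∀ (s1 : State) x y, 11 ≤ x → x ≤ 14 → Same (CTC.scan c) s s1 →
      Same (CTC.scan c) s (s1.setReg x y) := by
    intro s1 x y hx hx' h
    refine ⟨fun z hz => ?_, h.2⟩
    have := (hwr z).1 hz
    rw [State.reg_setReg, if_neg (by omega)]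
    exact h.1 z hz
  have hs10 : ∀ s1, Same (CTC.scan c) s s1 → s1.reg 10 = v := fun s1 h =>
    (h.1 10 ((hwr 10).2 (by simp [hc10]))).trans h10
  have hs0 : ∀ s1, Same (CTC.scan c) s s1 → s1.reg 0 = l := fun s1 h =>
    (h.1 0 ((hwr 0).2 (by simp [hc0]))).trans h0
  have hloopsame : ∀ s1 s2, Same (CTC.scan c) s s1 →
      Same (block [.input 13 .neighbor (.reg 10) (.reg 11),
      .input 14 .edgeTruss (.reg 10) (.reg 13),
      .ite (.reg 14) (.reg 0) (.assign 12 (.reg 11))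
        (block [c, .assign 11 (.add (.reg 11) (.lit 1))])]) s1 s2 → Same (CTC.scan c) s s2 := by
    intro s1 s2 h1 h2
    refine h1.trans (h2.mono (fun x hx => ?_) (fun x hx => ?_))
    · have := (hwr x).1 hx
      simp only [block, Com.wr, Bool.or_eq_false_iff, beq_eq_false_iff_ne]
      tauto
    · have := (hwa x).1 hx
      simp only [block, Com.wa, Bool.or_eq_false_iff]
      tauto
  refine WP.comp (N1 := 3) (N2 := (K + 20) * (nb n inp l v).card + 27)
    (WP.straight ?_ (by simp [Com.cst, Expr.cost])) (by omega)
  refine ⟨by simp only [Expr.Fits, h10]; omega, Nat.zero_le _, ?_, ?_⟩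
  · simp only [Expr.val, h10]; omega
  simp only [Expr.val, h10]
  refine WP.comp (N1 := 2) (N2 := (K + 20) * (nb n inp l v).card + 25)
    (WP.straight ?_ (by simp [Com.cst, Expr.cost])) (by omega)
  refine ⟨Nat.zero_le _, ?_⟩
  simp only [Expr.val]
  refine WP.comp (N1 := (K + 20) * (nb n inp l v).card + 24) (N2 := 1) ?_ (by omega)
  have hs1 : Same (CTC.scan c) s ((s.setReg 12 D).setReg 11 0) :=
    hsame _ _ _ (by omega) (by omega) (hsame _ _ _ (by omega) (by omega) (Same.refl _ _))
  have key := WT.while (inp := inp) (W := W) (Z := Z) (e := .reg 11) (f := .reg 12)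
    (c := block [.input 13 .neighbor (.reg 10) (.reg 11),
      .input 14 .edgeTruss (.reg 10) (.reg 13),
      .ite (.reg 14) (.reg 0) (.assign 12 (.reg 11))
        (block [c, .assign 11 (.add (.reg 11) (.lit 1))])]) (s := (s.setReg 12 D).setReg 11 0)
    (fun s1 p => ∃ X : Finset (Fin n), X.card = s1.reg 11 ∧ X ⊆ nb n inp l v ∧
      (∀ w : Fin n, w ∈ X ↔ ∃ i < s1.reg 11, f i = w) ∧ Inv X s1 ∧ s1.reg 11 ≤ D ∧
      s1.reg 12 ≤ D ∧
      (s1.reg 12 = D ∨ (s1.reg 12 = s1.reg 11 ∧ X = nb n inp l v)) ∧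
      -- The last summand pays for the single probe beyond the prefix.
      p = (K + 20) * ((nb n inp l v).card - X.card) + if s1.reg 11 < s1.reg 12 then 20 else 0)
    (p := (K + 20) * (nb n inp l v).card + if 0 < D then 20 else 0) ?_ ?_ ?_
  · refine WT.mono key fun s' T _ h => ?_
    obtain ⟨p', ⟨X, hX1, hX2, hX3, hX4, hX5, hX6, hX7, -⟩, h4, h5⟩ := h
    simp only [Expr.cost] at h5
    have h6 : (if 0 < D then 20 else 0) ≤ 20 := by split_ifs <;> omega
    refine ⟨by omega, WP.done ?_ le_rfl⟩
    have : X = nb n inp l v := by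
      rcases hX7 with h7 | ⟨-, h7⟩
      · simp only [Expr.val] at h4
        refine Finset.Subset.antisymm hX2 fun w hw => ?_
        obtain ⟨j, hj, he⟩ := hN3 w ((mem_nb_iff hI hl).1 hw).1
        exact (hX3 w).2 ⟨j, by omega, he⟩
      · exact h7
    exact this ▸ hX4
  · refine ⟨∅, by simp, by simp, by simp, hinv _ _ _ _ (by omega) (by omega)
      (hinv _ _ _ _ (by omega) (by omega) hInv), by simp, by simp, by simp, by simp⟩
  · rintro s1 p hs ⟨X, hX1, hX2, hX3, hX4, hX5, hX6, hX7, -⟩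
    simp only [Expr.Fits]
    omega
  · rintro s1 p hs ⟨X, hX1, hX2, hX3, hX4, hX5, hX6, hX7, hp⟩ hg
    have hss : Same (CTC.scan c) s s1 := hloopsame _ _ hs1 hs
    have e10 := hs10 _ hss
    have e0 := hs0 _ hss
    simp only [Expr.val] at hg
    have hjD : s1.reg 11 < D := by omega
    obtain ⟨w, hw, hadj⟩ := hN1 _ hjD
    have hwX : w ∉ X := fun hwX => by
      obtain ⟨i, hi, he⟩ := (hX3 w).1 hwX
      have := hN2 i (by omega) _ hjD (he.trans hw.symm)
      omega
    have hτW : inp .edgeTruss v w ≤ W := (edgeTruss_le hI v w).trans hW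
    have hfw : inp .neighbor v (s1.reg 11) = w := hw
    set s3 := (s1.setReg 13 w).setReg 14 (inp .edgeTruss v w) with hs3
    have hs3' : Same (CTC.scan c) s s3 :=
      hsame _ _ _ (by omega) (by omega) (hsame _ _ _ (by omega) (by omega) hss)
    have hI3 : Inv X s3 :=
      hinv _ _ _ _ (by omega) (by omega) (hinv _ _ _ _ (by omega) (by omega) hX4)
    have e3 : s3.reg 14 = inp .edgeTruss v w ∧ s3.reg 0 = l ∧ s3.reg 11 = s1.reg 11 ∧
        s3.reg 12 = s1.reg 12 ∧ s3.reg 13 = w := by simp [hs3, e0]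
    obtain ⟨e314, e30, e311, e312, e313⟩ := e3
    have pre : ∀ (N : ℕ) (Q : State → Prop),
        WP inp W Z (.ite (.reg 14) (.reg 0) (.assign 12 (.reg 11))
          (block [c, .assign 11 (.add (.reg 11) (.lit 1))])) s3 N Q →
        WP inp W Z (block [.input 13 .neighbor (.reg 10) (.reg 11),
          .input 14 .edgeTruss (.reg 10) (.reg 13),
          .ite (.reg 14) (.reg 0) (.assign 12 (.reg 11))
            (block [c, .assign 11 (.add (.reg 11) (.lit 1))])]) s1 (N + 7) Q := by
      intro N Q h
      refine WP.comp (N1 := 3) (N2 := N + 4) (WP.straight ?_ (by simp [Com.cst, Expr.cost]))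
        (by omega)
      refine ⟨by simp only [Expr.Fits]; omega, by simp only [Expr.Fits]; omega, ?_, ?_⟩
      · simp only [Expr.val, e10, hfw]; omega
      simp only [Expr.val, e10, hfw]
      refine WP.comp (N1 := 3) (N2 := N + 1) (WP.straight ?_ (by simp [Com.cst, Expr.cost]))
        (by omega)
      refine ⟨by simp [Expr.Fits, e10]; omega, by simp [Expr.Fits]; omega, ?_, ?_⟩
      · simp [Expr.val, e10, hτW]
      simp only [Expr.val, State.reg_setReg, e10, if_true]
      rw [if_neg (by omega)]
      refine WP.comp (N1 := N) (N2 := 1) ?_ (by omega)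
      exact h.mono le_rfl fun s' _ h' => WP.done h' le_rfl
    by_cases hlt : inp .edgeTruss v w < l
    -- A neighbour not yet visited would stand at the current or a later position and thus have at
    -- most the trussness of the entry that has just failed.
    · have hXeq : X = nb n inp l v := by
        refine Finset.Subset.antisymm hX2 fun x hx => ?_
        obtain ⟨j, hj, he⟩ := hN3 x ((mem_nb_iff hI hl).1 hx).1
        refine (hX3 x).2 ⟨j, ?_, he⟩
        by_contra hcon
        have h1 := hI.sorted v (s1.reg 11) j (by omega) hj
        have h2 : inp .neighbor v j = x := he
        rw [h2, hfw] at h1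
        rw [mem_nb] at hx
        omega
      have := pre 5 (fun s2 => Inv X s2 ∧ s2.reg 11 = s1.reg 11 ∧ s2.reg 12 = s1.reg 11) (by
        refine WP.branch (M := 2) ?_ ?_ (fun _ => WP.straight ?_ (by simp [Com.cst, Expr.cost]))
          (fun h => ?_) (by simp [Expr.cost])
        · simp only [Expr.Fits]; omega
        · simp only [Expr.Fits]; omega
        · refine ⟨by simp only [Expr.Fits]; omega, ?_⟩
          refine ⟨hinv _ _ _ _ (by omega) (by omega) hI3, ?_, ?_⟩
          · simp [e311]
          · simp [Expr.val, e311]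
        · simp only [Expr.val] at h
          omega)
      refine WT.mono this fun s2 T hs2 h2 => ?_
      obtain ⟨hT, h3, h4, h5⟩ := h2
      refine ⟨_, ⟨X, by omega, hX2, ?_, h3, by omega, by omega, Or.inr ⟨by omega, hXeq⟩, rfl⟩, ?_⟩
      · rw [h4]; exact hX3
      · rw [if_neg (by omega), hp, if_pos hg]
        simp only [Expr.cost]
        omega
    · have hwn : w ∈ nb n inp l v := by rw [mem_nb]; omega
      have := pre (K + 8) (fun s2 => Inv (insert w X) s2 ∧ s2.reg 11 = s1.reg 11 + 1 ∧
          s2.reg 12 = s1.reg 12) (by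
        refine WP.branch (M := K + 5) ?_ ?_ (fun h => ?_) (fun _ => ?_)
          (by simp [Expr.cost]; omega)
        · simp only [Expr.Fits]; omega
        · simp only [Expr.Fits]; omega
        · simp only [Expr.val] at h
          omega
        · refine WP.seq' (N2 := 5) (hstep X w s3 hs3' hX2 hwX hwn e313 hI3) ?_ le_rfl
          intro s4 hs4 h4
          have e411 : s4.reg 11 = s1.reg 11 := (hs4.1 11 hc11).trans e311
          have e412 : s4.reg 12 = s1.reg 12 := (hs4.1 12 hc12).trans e312
          refine WP.straight ?_ (by simp [Com.cst, Expr.cost, block])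
          refine ⟨by simp only [Expr.Fits, Expr.val]; omega, ?_⟩
          exact ⟨hinv _ _ _ _ (by omega) (by omega) h4, by simp [Expr.val, e411], by simp [e412]⟩)
      refine WT.mono this fun s2 T hs2 h2 => ?_
      obtain ⟨hT, h3, h4, h5⟩ := h2
      have hcard : (insert w X).card = s1.reg 11 + 1 := by
        rw [Finset.card_insert_of_notMem hwX, hX1]
      have hsub : insert w X ⊆ nb n inp l v := Finset.insert_subset hwn hX2
      have hle := Finset.card_le_card hsub
      refine ⟨_, ⟨insert w X, by omega, hsub, ?_, h3, by omega, by omega, ?_, rfl⟩, ?_⟩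
      · intro x
        rw [Finset.mem_insert, hX3, h4]
        constructor
        · rintro (rfl | ⟨i, hi, he⟩)
          · exact ⟨_, Nat.lt_succ_self _, hw⟩
          · exact ⟨i, by omega, he⟩
        · rintro ⟨i, hi, he⟩
          rcases Nat.lt_succ_iff_lt_or_eq.1 hi with h | rfl
          · exact Or.inr ⟨i, h, he⟩
          · exact Or.inl (Fin.ext (he.symm.trans hw))
      · left
        rcases hX7 with h7 | ⟨h7, -⟩ <;> omega
      · rw [hp, if_pos hg, hcard, hX1]
        simp only [Expr.cost]
        obtain ⟨m, hm⟩ : ∃ m, (nb n inp l v).card = s1.reg 11 + 1 + m :=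
          ⟨_, (Nat.add_sub_cancel' (hcard ▸ hle)).symm⟩
        have e1 : (nb n inp l v).card - s1.reg 11 = m + 1 := by omega
        have e2 : (nb n inp l v).card - (s1.reg 11 + 1) = m := by omega
        rw [e1, e2]
        have h6 : (if s2.reg 11 < s2.reg 12 then 20 else 0) ≤ 20 := by split_ifs <;> omega
        have h7 : (K + 20) * (m + 1) = (K + 20) * m + (K + 20) := by ring
        omega

end Scan


/-! ## Breadth-first search on the word RAM -/

section BFS

open SimpleGraph

variable {n : ℕ} {G : SimpleGraph (Fin n)} {inp : Input} {W : ℕ} {Z : Set (ℕ × ℕ)}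
  {V0 : Finset (Fin n)} {k m : ℕ}

/-- The cells that the program may touch: indices up to `m`, vertices of `V0`, and pairs of
vertices of `V0` that are adjacent at level `k`. -/
structure Zone (inp : Input) (Z : Set (ℕ × ℕ)) (V0 : Finset (Fin n)) (k m : ℕ) : Prop where
  closed : ∀ v ∈ V0, ∀ w ∈ nb n inp k v, w ∈ V0
  card : V0.card ≤ m + 1
  m_le : m ≤ n * n
  vtx : ∀ a < 14, ∀ v ∈ V0, (a, (v : ℕ)) ∈ Z
  idx : ∀ a < 14, ∀ i ≤ m, (a, i) ∈ Z
  dart : ∀ a < 14, ∀ v ∈ V0, ∀ w ∈ nb n inp k v, (a, (v : ℕ) * n + w) ∈ Z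

theorem nb_anti {k l : ℕ} (h : k ≤ l) (v : Fin n) : nb n inp l v ⊆ nb n inp k v := by
  intro w hw
  rw [mem_nb] at hw ⊢
  omega

theorem pair_lt (v w : Fin n) : (v : ℕ) * n + w < n * n := by
  have h1 : ((v : ℕ) + 1) * n ≤ n * n := Nat.mul_le_mul_right n v.2
  have h2 := w.2
  nlinarith

theorem pair_inj {v w v' w' : Fin n} (h : (v : ℕ) * n + w = (v' : ℕ) * n + w') :
    v = v' ∧ w = w' := by
  have hn : 0 < n := v.pos
  have e1 : (v : ℕ) = v' := by
    have h1 : ((v : ℕ) * n + w) / n = v := by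
      rw [mul_comm, Nat.mul_add_div hn, Nat.div_eq_of_lt w.2, add_zero]
    have h2 : ((v' : ℕ) * n + w') / n = v' := by
      rw [mul_comm, Nat.mul_add_div hn, Nat.div_eq_of_lt w'.2, add_zero]
    rw [← h1, h, h2]
  rw [e1] at h
  exact ⟨Fin.ext e1, Fin.ext (by omega)⟩

/-- The memory holds the list `L` of discovered vertices (length `t`), stamped with `st`, and their
distances. -/
structure Queued (V0 : Finset (Fin n)) (st : ℕ) (D : Fin n → ℕ) (L : List (Fin n)) (t : ℕ)
    (mem : ℕ → ℕ → ℕ) : Prop where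
  len : t = L.length
  get : ∀ (i : ℕ) (v : Fin n), L[i]? = some v → mem 5 i = v
  stamp_le : ∀ v ∈ V0, mem 6 v ≤ st
  stamp : ∀ v ∈ V0, mem 6 v = st ↔ v ∈ L
  dist : ∀ v ∈ L, mem 7 v = D v
  sub : ∀ v ∈ L, v ∈ V0

theorem Queued.append {st : ℕ} {D : Fin n → ℕ} {L : List (Fin n)} {t : ℕ} {mem mem' : ℕ → ℕ → ℕ}
    (h : Queued V0 st D L t mem) {w : Fin n} (hw : w ∈ V0)
    (h5 : mem' 5 = Function.update (mem 5) t w) (h6 : mem' 6 = Function.update (mem 6) w st)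
    (h7 : mem' 7 = Function.update (mem 7) w (D w)) :
    Queued V0 st D (L ++ [w]) (t + 1) mem' where
  len := by simp [h.len]
  get := by
    intro i v hi
    rw [h5, Function.update_apply]
    rw [List.getElem?_append] at hi
    split_ifs at hi with hlt
    · rw [if_neg (by rw [h.len]; omega)]
      exact h.get i v hi
    · rw [List.getElem?_singleton] at hi
      split_ifs at hi with h0
      rw [if_pos (by rw [h.len]; omega)]
      simp only [Option.some.injEq] at hi
      rw [hi]
  stamp_le := by
    intro v hv
    rw [h6, Function.update_apply]
    split_ifs
    · exact le_rfl
    · exact h.stamp_le v hv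
  stamp := by
    intro v hv
    rw [h6, Function.update_apply]
    split_ifs with hvw
    · simp [Fin.ext hvw]
    · rw [h.stamp v hv, List.mem_append, List.mem_singleton]
      have : v ≠ w := fun e => hvw (by rw [e])
      simp [this]
  dist := by
    intro v hv
    rw [h7, Function.update_apply]
    split_ifs with hvw
    · rw [Fin.ext hvw]
    · rw [List.mem_append, List.mem_singleton] at hv
      refine h.dist v (hv.resolve_right fun e => hvw (by rw [e]))
  sub := by
    intro v hv
    rw [List.mem_append, List.mem_singleton] at hv
    rcases hv with hv | rfl
    · exact h.sub v hv
    · exact hw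

/-- Discover the vertex in register 13 if the edge from register 10 is present and the vertex is
new. -/
def discover : Com :=
  block [.load 15 8 (.add (.mul (.reg 10) (.reg 4)) (.reg 13)), .load 17 9 (.reg 15),
    .ite (.reg 17) (.lit 2)
      (block [.load 17 6 (.reg 13), .ite (.reg 17) (.reg 7)
        (block [.store 6 (.reg 13) (.reg 7), .store 7 (.reg 13) (.add (.reg 18) (.lit 1)),
          .store 5 (.reg 9) (.reg 13), .assign 9 (.add (.reg 9) (.lit 1))])
        .skip]) .skip]

/-- Process the vertices in the list. -/
def bfsLoop : Com :=
  .loop (.reg 8) (.reg 9) (block [.load 10 5 (.reg 8), .assign 8 (.add (.reg 8) (.lit 1)),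
    .load 18 7 (.reg 10), scan discover])

/-- Start a breadth-first search from the vertex in register 23. -/
def bfsInit : Com :=
  block [.assign 7 (.add (.reg 7) (.lit 1)), .store 5 (.lit 0) (.reg 23),
    .store 6 (.reg 23) (.reg 7), .store 7 (.reg 23) (.lit 0), .assign 8 (.lit 0),
    .assign 9 (.lit 1)]

/-- Breadth-first search from the vertex in register 23. -/
def bfs : Com := .seq bfsInit bfsLoop

/-- An edge is present if its status is below `2`, and a vertex is new if its stamp is below that of
the current search. A search thus begins by raising the stamp, without clearing any array. -/
theorem discover_spec {R : SimpleGraph (Fin n)} {l st : ℕ}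
    (hZ : Zone inp Z V0 k m) (hW : n * n + 4 * n + 20 ≤ W) {D : Fin n → ℕ} {L : List (Fin n)}
    {v w : Fin n} {s : State} (hst : st + 1 ≤ W) (hkl : k ≤ l)
    (hv : v ∈ V0) (hw : w ∈ nb n inp l v)
    (h4 : s.reg 4 = n) (h7 : s.reg 7 = st) (h10 : s.reg 10 = v) (h13 : s.reg 13 = w)
    (h18 : s.reg 18 = D v) (hDn : D v < n) (hnd : L.Nodup)
    (h8 : s.mem 8 (v * n + w) ≤ m) (h9 : s.mem 9 (s.mem 8 (v * n + w)) ≤ 2)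
    (hR : R.Adj v w ↔ s.mem 9 (s.mem 8 (v * n + w)) < 2)
    (hnew : w ∉ L → R.Adj v w → D w = D v + 1)
    (hq : Queued V0 st D L (s.reg 9) s.mem) :
    WP inp W Z discover s 60 (fun s' => ∃ M, (M = [] ∨ M = [w] ∧ R.Adj v w ∧ w ∉ L) ∧
      (R.Adj v w → w ∈ L ++ M) ∧ Queued V0 st D (L ++ M) (s'.reg 9) s'.mem) := by
  have hp := pair_lt v w
  have hm := hZ.m_le
  have hwn := hZ.closed v hv w (nb_anti hkl v hw)
  have hwlt := w.2
  have hlen : L.length ≤ m + 1 := by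
    have h1 : L.toFinset ⊆ V0 := fun x hx => hq.sub x (by simpa using hx)
    have h2 := Finset.card_le_card h1
    rw [List.toFinset_card_of_nodup hnd] at h2
    exact h2.trans hZ.card
  refine WP.code (by simp [discover]) fun Q hQ => ?_
  have hlen' : w ∉ L → L.length ≤ m := fun hwL => by
    have h1 : (w :: L).toFinset ⊆ V0 := fun x hx => by
      rcases List.mem_cons.1 (List.mem_toFinset.1 hx) with rfl | h
      · exact hwn
      · exact hq.sub x h
    have h2 := Finset.card_le_card h1
    rw [List.toFinset_card_of_nodup (List.nodup_cons.2 ⟨hwL, hnd⟩), List.length_cons] at h2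
    have := hZ.card
    omega
  have hs6 := hq.stamp_le w hwn
  have h9len := hq.len
  have z8 := hZ.dart 8 (by omega) v hv w (nb_anti hkl v hw)
  have z9 := hZ.idx 9 (by omega) _ h8
  have z6 := hZ.vtx 6 (by omega) w hwn
  have z7 := hZ.vtx 7 (by omega) w hwn
  by_cases hRvw : R.Adj v w
  · have hlt := hR.1 hRvw
    by_cases hwL : w ∈ L
    · have hs := (hq.stamp w hwn).2 hwL
      simp [discover, h4, h10, h13, h7, h18, hlt, hs, z8, z9, z6]
      and_intros <;> try omega
      exact hQ _ ⟨[], Or.inl rfl, fun _ => by simpa using hwL, by simpa using hq⟩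
    · have hs : s.mem 6 w < st := lt_of_le_of_ne hs6 fun e => hwL ((hq.stamp w hwn).1 e)
      have z5 := hZ.idx 5 (by omega) _ (hlen' hwL)
      rw [← h9len] at z5
      have hll := hlen' hwL
      simp [discover, h4, h10, h13, h7, h18, hlt, hs, z8, z9, z6, z7, z5]
      and_intros <;> try omega
      refine hQ _ ⟨[w], Or.inr ⟨rfl, hRvw, hwL⟩, fun _ => by simp, ?_⟩
      simp only [State.reg_setReg, State.mem_setReg, State.reg_setMem, if_true]
      refine hq.append hwn ?_ ?_ ?_
      · simp
      · simp
      · simp [hnew hwL hRvw]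
  · have hlt : ¬ s.mem 9 (s.mem 8 (v * n + w)) < 2 := fun h => hRvw (hR.2 h)
    simp [discover, h4, h10, h13, h7, h18, hlt, z8, z9, z6, z7]
    and_intros <;> try omega
    exact hQ _ ⟨[], Or.inl rfl, fun h => (hRvw h).elim, by simpa using hq⟩

/-- What breadth-first search from `q` in the graph `R` needs. -/
structure SearchReady (inp : Input) (V0 : Finset (Fin n)) (R : SimpleGraph (Fin n)) (l m st : ℕ)
    (q : Fin n) (s : State) : Prop where
  level : s.reg 0 = l
  size : s.reg 4 = n
  stamp : s.reg 7 = st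
  source : s.reg 23 = q
  source_mem : q ∈ V0
  adj : ∀ v ∈ V0, ∀ w, R.Adj v w → w ∈ nb n inp l v
  arr : ∀ v ∈ V0, ∀ w ∈ nb n inp l v, s.mem 8 (v * n + w) ≤ m ∧
    s.mem 9 (s.mem 8 (v * n + w)) ≤ 2 ∧ (R.Adj v w ↔ s.mem 9 (s.mem 8 (v * n + w)) < 2)
  stamps : ∀ v ∈ V0, s.mem 6 v ≤ st

/-- What breadth-first search from `q` in the graph `R` achieves. -/
structure Searched (V0 : Finset (Fin n)) (R : SimpleGraph (Fin n)) (st : ℕ) (q : Fin n)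
    (L : List (Fin n)) (s : State) : Prop where
  stamp : s.reg 7 = st
  nodup : L.Nodup
  mem_iff : ∀ v, v ∈ L ↔ R.Reachable q v
  queued : Queued V0 st (R.dist q) L (s.reg 9) s.mem

variable (inp) in
/-- Time for processing one vertex in a breadth-first search. -/
def vertexCost (k : ℕ) (v : Fin n) : ℕ := 80 * (nb n inp k v).card + 60

theorem dist_lt {R : SimpleGraph (Fin n)} {q v : Fin n} (h : R.Reachable q v) : R.dist q v < n := by
  obtain ⟨p, hp, he⟩ := h.exists_path_of_dist
  rw [← he]
  simpa using hp.length_lt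

/-- The potential is the cost of the vertices of `V0` that have not been processed. It is charged at
level `k`, which dominates the scan at any level `l ≥ k`. -/
theorem bfsLoop_spec (hI : IsTrussIndex G inp) {R : SimpleGraph (Fin n)} {l st : ℕ} {q : Fin n}
    {s : State} (hZ : Zone inp Z V0 k m) (hW : n * n + 4 * n + 20 ≤ W) (hst : st + 1 ≤ W)
    (hkl : k ≤ l) (hl : 1 ≤ l) (hlW : l ≤ W) (hr : SearchReady inp V0 R l m st q s)
    (h8 : s.reg 8 = 0) (hq : Queued V0 st (R.dist q) [q] (s.reg 9) s.mem) :
    WP inp W Z bfsLoop s (∑ v ∈ V0, vertexCost inp k v + 3)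
      (fun s' => ∃ L, Searched V0 R st q L s') := by
  have hsz : s.reg 4 = n := hr.size
  have key := WT.while (inp := inp) (W := W) (Z := Z) (e := .reg 8) (f := .reg 9)
    (c := block [.load 10 5 (.reg 8), .assign 8 (.add (.reg 8) (.lit 1)),
      .load 18 7 (.reg 10), scan discover]) (s := s)
    (fun s1 p => ∃ L, Search R q L (s1.reg 8) ∧ s1.reg 8 ≤ L.length ∧
      Queued V0 st (R.dist q) L (s1.reg 9) s1.mem ∧
      p = ∑ v ∈ V0 \ (L.take (s1.reg 8)).toFinset, vertexCost inp k v)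
    (p := ∑ v ∈ V0, vertexCost inp k v) ?_ ?_ ?_
  · refine WT.mono key fun s' T hs h => ?_
    obtain ⟨p', ⟨L, hL1, hL2, hL3, -⟩, h4, h5⟩ := h
    simp only [Expr.cost] at h5
    refine ⟨by omega, L, (hs.1 7 rfl).trans hr.stamp, hL1.nodup, ?_, hL3⟩
    have : s'.reg 8 = L.length := by
      have := hL3.len
      simp only [Expr.val] at h4
      omega
    rw [this] at hL1
    exact hL1.mem_iff
  · refine ⟨[q], ?_, ?_, hq, ?_⟩
    · rw [h8]; exact Search.init R q
    · rw [h8]; simp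
    · rw [h8]; simp
  · rintro s1 p hs ⟨L, hL1, hL2, hL3, -⟩
    have h1 : L.toFinset ⊆ V0 := fun x hx => hL3.sub x (by simpa using hx)
    have h2 := Finset.card_le_card h1
    rw [List.toFinset_card_of_nodup hL1.nodup] at h2
    have := hL3.len
    have := hZ.card
    have := hZ.m_le
    simp only [Expr.Fits]
    omega
  · rintro s1 p hs ⟨L, hL1, hL2, hL3, hp⟩ hg
    simp only [Expr.val] at hg
    have hh : s1.reg 8 < L.length := hL3.len ▸ hg
    set v := L[s1.reg 8] with hv
    have hvL : v ∈ L := List.getElem_mem hh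
    have hvV := hL3.sub v hvL
    have hget : s1.mem 5 (s1.reg 8) = v := hL3.get _ _ (List.getElem?_eq_getElem hh)
    have hlen : L.length ≤ m + 1 := by
      have h1 : L.toFinset ⊆ V0 := fun x hx => hL3.sub x (by simpa using hx)
      have h2 := Finset.card_le_card h1
      rw [List.toFinset_card_of_nodup hL1.nodup] at h2
      exact h2.trans hZ.card
    have hdv : R.dist q v < n := dist_lt (hL1.reach v hvL)
    have hd := hL3.dist v hvL
    have hvlt := v.2
    have hm := hZ.m_le
    have z5 := hZ.idx 5 (by omega) (s1.reg 8) (by omega)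
    have z7 := hZ.vtx 7 (by omega) v hvV
    let s3 : State := ((s1.setReg 10 v).setReg 8 (s1.reg 8 + 1)).setReg 18 (R.dist q v)
    have hs3 : Same bfsLoop s s3 := by
      refine Same.trans (s' := s1) hs ⟨fun x hx => ?_, fun _ _ => rfl⟩
      have : x ≠ 10 ∧ x ≠ 8 ∧ x ≠ 18 := by
        simp [bfsLoop, Com.wr] at hx
        tauto
      simp [s3, this]
    have pre : ∀ (N : ℕ) (Q : State → Prop), WP inp W Z (scan discover) s3 N Q →
        WP inp W Z (block [.load 10 5 (.reg 8), .assign 8 (.add (.reg 8) (.lit 1)),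
          .load 18 7 (.reg 10), scan discover]) s1 (N + 9) Q := by
      intro N Q h
      refine WP.comp (N1 := 2) (N2 := N + 7) (WP.straight ?_ (by simp)) (by omega)
      refine ⟨by simp only [Expr.Fits]; omega, by simp only [Expr.val, hget]; omega, z5, ?_⟩
      refine WP.comp (N1 := 4) (N2 := N + 3) (WP.straight ?_ (by simp)) (by omega)
      refine ⟨by simp; omega, ?_⟩
      refine WP.comp (N1 := 2) (N2 := N + 1) (WP.straight ?_ (by simp)) (by omega)
      simp only [vc, Expr.val, Expr.Fits, State.reg_setReg, State.mem_setReg, hget, hd,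
        Nat.reduceEqDiff, if_true, if_false]
      refine ⟨by omega, by omega, z7, ?_⟩
      refine WP.comp (N1 := N) (N2 := 1) ?_ (by omega)
      exact h.mono le_rfl fun s' _ h' => WP.done h' le_rfl
    have hscan := WP.scan (Z := Z) hI (by omega) (c := discover) (s := s3) (K := 60) (l := l) (v := v)
      (fun X s2 => ∃ M, (L ++ M).Nodup ∧ (∀ w ∈ M, R.Adj v w) ∧ (∀ w ∈ X, R.Adj v w → w ∈ L ++ M) ∧
        Queued V0 st (R.dist q) (L ++ M) (s2.reg 9) s2.mem) hl hlW
      ((hs3.1 0 rfl).trans hr.level) (by simp [s3]) rfl rfl rfl rfl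
      (by
        rintro X s2 x y hx hx' ⟨M, h1, h2, h3, h4⟩
        refine ⟨M, h1, h2, h3, ?_⟩
        rw [State.reg_setReg, if_neg (by omega)]
        exact h4)
      ⟨[], by simpa using hL1.nodup, by simp, by simp, by simpa [s3] using hL3⟩
      (by
        rintro X w s2 hs2 hX hwX hw h13 ⟨M, h1, h2, h3, h4⟩
        have e8 : s2.mem 8 = s.mem 8 := (hs2.2 8 rfl).trans (hs3.2 8 rfl)
        have e9 : s2.mem 9 = s.mem 9 := (hs2.2 9 rfl).trans (hs3.2 9 rfl)
        obtain ⟨a1, a2, a3⟩ := hr.arr v hvV w hw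
        rw [← e8, ← e9] at a2 a3
        rw [← e8] at a1
        refine (discover_spec (R := R) (D := R.dist q) hZ hW hst hkl hvV hw
          ((hs2.1 4 rfl).trans ((hs3.1 4 rfl).trans hsz))
          ((hs2.1 7 rfl).trans ((hs3.1 7 rfl).trans hr.stamp))
          ((hs2.1 10 rfl).trans (by simp [s3])) h13
          ((hs2.1 18 rfl).trans (by simp [s3])) hdv h1 a1 a2 a3 ?_ h4).mono le_rfl ?_
        · intro hwL hadj
          exact hL1.dist_new hh hadj fun h => hwL (List.mem_append_left _ h)
        · rintro s4 - ⟨M', hM', hM2, hM3⟩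
          rw [List.append_assoc] at hM2 hM3
          refine ⟨M ++ M', ?_, ?_, ?_, hM3⟩
          · rcases hM' with rfl | ⟨rfl, -, hwL⟩
            · simpa using h1
            · rw [← List.append_assoc]
              exact List.nodup_append.2 ⟨h1, by simp, fun a ha b hb e => by
                rw [List.mem_singleton] at hb
                exact hwL (hb ▸ e ▸ ha)⟩
          · intro x hx
            rcases List.mem_append.1 hx with hx | hx
            · exact h2 x hx
            · rcases hM' with rfl | ⟨rfl, hadj, -⟩
              · simp at hx
              · rw [List.mem_singleton] at hx
                exact hx ▸ hadj
          · intro x hx hadj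
            rcases Finset.mem_insert.1 hx with rfl | hx
            · exact hM2 hadj
            · rw [← List.append_assoc]
              exact List.mem_append_left _ (h3 x hx hadj))
    refine WT.mono (pre _ _ hscan.frame) fun s2 T hs2 h2 => ?_
    obtain ⟨hT, hs23, M, h1, h2, h3, h4⟩ := h2
    have e8 : s2.reg 8 = s1.reg 8 + 1 := (hs23.1 8 rfl).trans (by simp [s3])
    have hstep := hL1.step hh h1 h2 fun w hw => h3 w (hr.adj v hvV w hw) hw
    refine ⟨_, ⟨L ++ M, by rw [e8]; exact hstep, by rw [e8, List.length_append]; omega, h4, rfl⟩, ?_⟩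
    rw [e8, List.take_append_of_le_length (by omega), ← List.take_concat_get' L _ hh, hp]
    have hvT : v ∉ (L.take (s1.reg 8)).toFinset := by
      rw [List.mem_toFinset]
      intro hmem
      obtain ⟨i, hi, he⟩ := List.mem_take_iff_getElem.1 hmem
      have := (hL1.nodup.getElem_inj_iff).1 he
      omega
    have e1 : (List.take (s1.reg 8) L ++ [L[s1.reg 8]]).toFinset =
        insert v (L.take (s1.reg 8)).toFinset := by
      ext x
      rw [List.mem_toFinset, List.mem_append, List.mem_singleton, Finset.mem_insert,
        List.mem_toFinset, or_comm]
    rw [e1, Finset.sdiff_insert, ← Finset.add_sum_erase _ _ (Finset.mem_sdiff.2 ⟨hvV, hvT⟩)]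
    have e2 := Finset.card_le_card (nb_anti (inp := inp) hkl v)
    simp only [Expr.cost]
    have : vertexCost inp k v = 80 * (nb n inp k v).card + 60 := rfl
    omega

theorem bfs_spec (hI : IsTrussIndex G inp) {R : SimpleGraph (Fin n)} {l st : ℕ} {q : Fin n}
    {s : State} (hZ : Zone inp Z V0 k m) (hW : n * n + 4 * n + 20 ≤ W) (hst : st + 2 ≤ W)
    (hkl : k ≤ l) (hl : 1 ≤ l) (hlW : l ≤ W) (hr : SearchReady inp V0 R l m st q s) :
    WP inp W Z bfs s (∑ v ∈ V0, vertexCost inp k v + 40)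
      (fun s' => ∃ L, Searched V0 R (st + 1) q L s') := by
  have hqlt := q.2
  have h7 := hr.stamp
  have h23 := hr.source
  have z5 := hZ.idx 5 (by omega) 0 (by omega)
  have z6 := hZ.vtx 6 (by omega) q hr.source_mem
  have z7 := hZ.vtx 7 (by omega) q hr.source_mem
  have hpre : WP inp W Z bfsInit s 30 fun s1 => s1.reg 8 = 0 ∧ SearchReady inp V0 R l m (st + 1) q s1 ∧
      Queued V0 (st + 1) (R.dist q) [q] (s1.reg 9) s1.mem := by
    refine WP.code (by simp [bfsInit]) fun Q hQ => ?_
    simp [bfsInit, h7, h23, z5, z6, z7]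
    and_intros <;> try omega
    refine hQ _ ⟨by simp, ⟨by simp [hr.level], by simp [hr.size], by simp, by simp [h23],
      hr.source_mem, hr.adj, by simpa using hr.arr, ?_⟩, ?_⟩
    · intro v hv
      have := hr.stamps v hv
      simp [Function.update_apply]
      split_ifs <;> omega
    · refine ⟨by simp, ?_, ?_, ?_, ?_, ?_⟩
      · intro i v hi
        rw [List.getElem?_singleton] at hi
        split_ifs at hi with h0
        simp only [Option.some.injEq] at hi
        simp [h0, hi]
      · intro v hv
        have := hr.stamps v hv
        simp [Function.update_apply]
        split_ifs <;> omega
      · intro v hv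
        have := hr.stamps v hv
        simp [Function.update_apply, Fin.ext_iff]
        omega
      · intro v hv
        rw [List.mem_singleton] at hv
        simp [hv]
      · intro v hv
        rw [List.mem_singleton] at hv
        exact hv ▸ hr.source_mem
  exact WP.seq' hpre (fun s1 _ h => bfsLoop_spec hI hZ hW (by omega) hkl hl hlW h.2.1 h.1 h.2.2)
    (by omega)

end BFS


/-! ## Finding the trussness level -/

section Level

open SimpleGraph

variable {n : ℕ} {G : SimpleGraph (Fin n)} {Q : Finset (Fin n)} {inp : Input} {W : ℕ}
  {Z : Set (ℕ × ℕ)} {V0 : Finset (Fin n)} {k m : ℕ} {q0 : Fin n} {qu : ℕ → Fin n}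

/-- The fixed data of a run of the program: `V0` is the vertex set of the maximal connected
`k`-truss, `m` the number of its edges, and `qu` lists the query vertices. -/
structure Setting (G : SimpleGraph (Fin n)) (Q : Finset (Fin n)) (inp : Input) (W : ℕ)
    (Z : Set (ℕ × ℕ)) (V0 : Finset (Fin n)) (k m : ℕ) (q0 : Fin n) (qu : ℕ → Fin n) : Prop where
  index : IsTrussIndex G inp
  conn : G.Connected
  two_le : 2 ≤ n
  word : 10 * ((n + 3) * (n + 3)) ≤ W
  zone : Zone inp Z V0 k (2 * m)
  q0_mem : q0 ∈ Q
  sub : ∀ q ∈ Q, q ∈ V0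
  query : ∀ i < Q.card, inp .query i 0 = qu i ∧ qu i ∈ Q
  query_surj : ∀ q ∈ Q, ∃ i < Q.card, qu i = q
  query_zero : inp .query 0 0 = q0
  numQuery : inp .numQuery 0 0 = Q.card
  level_eq : k = maxTrussness G Q
  two_le_level : 2 ≤ k
  core_adj : ∀ v w, (core G Q q0).Adj v w ↔ v ∈ V0 ∧ w ∈ nb n inp k v
  sum_deg : ∑ v ∈ V0, (nb n inp k v).card = 2 * m
  card_le : V0.card ≤ 2 * m
  one_le : 1 ≤ m
  mem_V0 : ∀ v, v ∈ V0 ↔ (level G k).Reachable q0 v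
  card_edges : {x : Fin n × Fin n | (core G Q q0).Adj x.1 x.2 ∧ x.1 < x.2}.ncard = m

variable (S : Setting G Q inp W Z V0 k m q0 qu)

include S

theorem Setting.word' : n * n + 4 * n + 20 ≤ W := by
  have := S.word
  nlinarith

theorem Setting.card_query : Q.card ≤ 2 * m := (Finset.card_le_card S.sub).trans S.card_le

theorem Setting.card_query_le : Q.card ≤ n := by
  simpa using Finset.card_le_univ Q

theorem Setting.sum_vertexCost : ∑ v ∈ V0, vertexCost inp k v ≤ 280 * m := by
  have h : ∑ v ∈ V0, vertexCost inp k v = 80 * ∑ v ∈ V0, (nb n inp k v).card + V0.card * 60 := by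
    simp [vertexCost, Finset.sum_add_distrib, Finset.mul_sum]
  have := S.sum_deg
  have := S.card_le
  omega

omit S

/-- Count the query vertices that carry the current stamp. -/
def checkBody : Com :=
  block [.input 17 .query (.reg 21) (.lit 0), .load 17 6 (.reg 17),
    .ite (.reg 17) (.reg 7) .skip (.assign 22 (.add (.reg 22) (.lit 1)))]

/-- Register 22 counts the query vertices that have been reached. -/
def check : Com := .seq (.assign 22 (.lit 0)) (forUp 21 5 checkBody)

include S in
-- Stamps never exceed the current one, so a failing comparison with it already means equality, that
-- is, a vertex reached by this search.
theorem check_spec {st : ℕ} {D : Fin n → ℕ} {L : List (Fin n)} {s : State}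
    (h5 : s.reg 5 = Q.card) (h7 : s.reg 7 = st) (hst : st ≤ W)
    (hq : Queued V0 st D L (s.reg 9) s.mem) :
    WP inp W Z check s (100 * m) fun s' => s'.reg 22 ≤ Q.card ∧
      (s'.reg 22 = Q.card ↔ ∀ q ∈ Q, q ∈ L) := by
  have hW := S.word'
  have hQ := S.card_query
  have hQn := S.card_query_le
  have hm := S.one_le
  refine WP.seq' (N1 := 2) (N2 := ∑ j ∈ Finset.range Q.card, (22 + 8) + 6)
    (R := fun s1 => s1 = s.setReg 22 0) (WP.straight ?_ (by simp)) ?_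
    (by simp only [Finset.sum_const, Finset.card_range, smul_eq_mul]; omega)
  · simp
  rintro s0 hs0 rfl
  have h5' : (s.setReg 22 0).reg 5 = Q.card := by simpa using h5
  refine (WP.counting (Z := Z) (fun j s1 => s1.reg 22 ≤ j ∧ (s1.reg 22 = j ↔ ∀ i < j, qu i ∈ L))
    (fun _ => 22) (by decide) rfl rfl h5' (by omega) (by omega) (by simp) ?_).mono le_rfl ?_
  · intro j hj s1 hs1 h21 h
    obtain ⟨hqu, hquQ⟩ := S.query j hj
    have e7 : s1.reg 7 = st := (hs1.1 7 rfl).trans (by simpa using h7)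
    have e6 : s1.mem 6 = s.mem 6 := hs1.2 6 rfl
    have hV := S.sub _ hquQ
    have hle := hq.stamp_le _ hV
    have hiff := hq.stamp _ hV
    rw [← e6] at hle hiff
    have z6 := S.zone.vtx 6 (by omega) _ hV
    have hlt := (qu j).2
    refine WP.code (by simp [checkBody]) fun R hR => ?_
    simp only [checkBody, block, vc, Expr.val, Expr.Fits, State.reg_setReg, State.mem_setReg,
      h21, hqu, e7, Nat.reduceEqDiff, if_true, if_false, z6, true_and]
    obtain ⟨h1, h2⟩ := h
    and_intros <;> try omega
    · intro hlt
      refine hR _ ⟨?_, ?_⟩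
      · simp; omega
      · simp only [State.reg_setReg, Nat.reduceEqDiff, if_false]
        refine ⟨fun h => by omega, fun h => ?_⟩
        have := hiff.2 (h j (by omega))
        omega
    · intro hge
      have hin : qu j ∈ L := hiff.1 (by omega)
      and_intros <;> try omega
      refine hR _ ⟨?_, ?_⟩
      · simp; omega
      · simp only [State.reg_setReg, Nat.reduceEqDiff, if_true, if_false, Nat.add_right_cancel_iff,
          h2]
        refine ⟨fun h i hi => ?_, fun h i hi => h i (by omega)⟩
        rcases Nat.lt_succ_iff_lt_or_eq.1 hi with hi | rfl
        · exact h i hi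
        · exact hin
  · rintro s2 hs2 ⟨h1, h2⟩
    refine ⟨h1, h2.trans ⟨fun h q hq => ?_, fun h i hi => h _ (S.query i hi).2⟩⟩
    obtain ⟨i, hi, rfl⟩ := S.query_surj q hq
    exact h i hi

/-- Search from the first query vertex and count the query vertices that are reached. -/
def searchQuery : Com := .seq bfs check

include S in
theorem searchQuery_spec {R : SimpleGraph (Fin n)} {l st : ℕ} {s : State} (h5 : s.reg 5 = Q.card)
    (hst : st + 2 ≤ W) (hkl : k ≤ l) (hlW : l ≤ W)
    (hr : SearchReady inp V0 R l (2 * m) st q0 s) :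
    WP inp W Z searchQuery s (420 * m) fun s' => (∃ L, Searched V0 R (st + 1) q0 L s') ∧
      s'.reg 22 ≤ Q.card ∧ (s'.reg 22 = Q.card ↔ ∀ q ∈ Q, R.Reachable q0 q) := by
  have hm := S.one_le
  have := S.sum_vertexCost
  have := S.two_le_level
  refine WP.seq' (N2 := 100 * m)
    (bfs_spec S.index S.zone S.word' hst hkl (by omega) hlW hr) ?_ (by omega)
  rintro s1 hs1 ⟨L, hL⟩
  refine (check_spec S ((hs1.1 5 rfl).trans h5) hL.stamp (by omega) hL.queued).mono le_rfl ?_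
  rintro s2 hs2 ⟨h1, h2⟩
  have e9 : s2.reg 9 = s1.reg 9 := hs2.1 9 rfl
  have e7 : s2.reg 7 = s1.reg 7 := hs2.1 7 rfl
  have em : s2.mem = s1.mem := by
    funext a
    exact hs2.2 a rfl
  refine ⟨⟨L, ?_⟩, h1, h2.trans ⟨fun h q hq => (hL.mem_iff q).1 (h q hq),
    fun h q hq => (hL.mem_iff q).2 (h q hq)⟩⟩
  exact ⟨e7.trans hL.stamp, hL.nodup, hL.mem_iff, by rw [e9, em]; exact hL.queued⟩

/-- Read the sizes and the first query vertex. -/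
def findLevelInit : Com :=
  block [.input 4 .size (.lit 0) (.lit 0), .input 5 .numQuery (.lit 0) (.lit 0),
    .input 6 .query (.lit 0) (.lit 0), .input 0 .vertexTruss (.reg 6) (.lit 0),
    .assign 0 (.add (.reg 0) (.lit 1)), .assign 23 (.reg 6)]

/-- Decrease the level until the query vertices are connected. -/
def findLevelLoop : Com :=
  .loop (.reg 22) (.reg 5) (.seq (.assign 0 (.sub (.reg 0) (.lit 1))) searchQuery)

/-- Determine the trussness level and list the vertices of the maximal connected truss. -/
def findLevel : Com := .seq findLevelInit findLevelLoop

include S in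
theorem Setting.vertexTruss : k ≤ inp .vertexTruss q0 0 ∧ inp .vertexTruss q0 0 ≤ n + 2 ∧
    q0 ∈ (level G (inp .vertexTruss q0 0)).support := by
  have hn : 2 ≤ Fintype.card (Fin n) := by simpa using S.two_le
  have hbdd : BddAbove {k | ∃ u, G.Adj q0 u ∧ k = edgeTrussness G q0 u} := by
    refine ⟨n + 2, ?_⟩
    rintro _ ⟨u, hu, rfl⟩
    simpa using edgeTrussness_le hu
  obtain ⟨w, hw⟩ := mem_support_level S.conn hn S.q0_mem
  have hmem := Nat.sSup_mem (s := {k | ∃ u, G.Adj q0 u ∧ k = edgeTrussness G q0 u})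
    ⟨_, w, hw.1, rfl⟩ hbdd
  rw [← S.index.vertexTruss q0] at hmem
  obtain ⟨u, hu, he⟩ := hmem
  refine ⟨?_, ?_, ⟨u, hu, he.le⟩⟩
  · rw [S.index.vertexTruss q0]
    refine le_trans ?_ (le_csSup hbdd ⟨w, hw.1, rfl⟩)
    exact S.level_eq ▸ hw.2
  · rw [he]
    simpa using edgeTrussness_le hu

include S in
-- The search of level `l ≥ k` stays inside `V0`, so each attempt is linear in `m`; the number of
-- attempts is at most `2ρ + 2` by `le_two_mul_arboricity`. The last search, at level `k` itself,
-- leaves the vertex set of the core in the queue.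
theorem findLevel_spec : WP inp W Z findLevel State.zero
      (1000 * ((2 * arboricity (ofGraph (core G Q q0) (core_le q0)) + 2) * m))
      fun s' => s'.reg 0 = k ∧ s'.reg 4 = n ∧ s'.reg 5 = Q.card ∧ s'.reg 6 = q0 ∧
        ∃ L st, st ≤ n + 3 ∧ Searched V0 (level G k) st q0 L s' := by
  have hW := S.word'
  have hm := S.one_le
  have hk := S.two_le_level
  have hQn := S.card_query_le
  have hlt := q0.2
  have hn : 2 ≤ Fintype.card (Fin n) := by simpa using S.two_le
  obtain ⟨hv1, hv2, hv3⟩ := S.vertexTruss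
  have hvt := le_two_mul_arboricity (Q := Q) hv3 (S.level_eq ▸ hv1)
  set ρ := arboricity (ofGraph (core G Q q0) (core_le q0))
  set vt := inp .vertexTruss q0 0
  have hQpos : 0 < Q.card := Finset.card_pos.2 ⟨q0, S.q0_mem⟩
  -- The level register starts at `vt + 1`, one too high, because the loop body decrements it before
  -- searching.
  refine WP.seq' (N1 := 30) (N2 := (vt + 1 - k) * (430 * m) + 3)
    (R := fun s1 => s1.reg 0 = vt + 1 ∧ s1.reg 4 = n ∧ s1.reg 5 = Q.card ∧ s1.reg 6 = q0 ∧
      s1.reg 23 = q0 ∧ s1.reg 7 = 0 ∧ s1.reg 22 = 0 ∧ ∀ a i, s1.mem a i = 0) ?_ ?_ ?_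
  · refine WP.code (by simp [findLevelInit]) fun R hR => ?_
    simp [findLevelInit, S.query_zero, S.numQuery, S.index.size]
    and_intros <;> try omega
    exact hR _ ⟨by simp [vt], by simp, by simp, by simp, by simp, by simp [State.zero],
      by simp [State.zero], by simp [State.zero]⟩
  · rintro s1 hs1 ⟨a0, a4, a5, a6, a23, a7, a22, am⟩
    have key := WT.while (inp := inp) (W := W) (Z := Z) (e := .reg 22) (f := .reg 5)
      (c := .seq (.assign 0 (.sub (.reg 0) (.lit 1))) searchQuery) (s := s1)
      -- Stamp and level have a constant sum, so the stamp remains at most `n + 3` during this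
      -- phase.
      (fun s2 p => k ≤ s2.reg 0 ∧ s2.reg 7 + s2.reg 0 = vt + 1 ∧ (∀ v ∈ V0, s2.mem 6 v ≤ s2.reg 7) ∧
        s2.reg 22 ≤ Q.card ∧ p = (s2.reg 0 - k) * (430 * m) ∧
        ((s2.reg 22 < Q.card ∧ k < s2.reg 0) ∨
          (s2.reg 22 = Q.card ∧ s2.reg 0 = k ∧ ∃ L, Searched V0 (level G k) (s2.reg 7) q0 L s2)))
      (p := (vt + 1 - k) * (430 * m)) ?_ ?_ ?_
    · refine WT.mono key fun s' T hs h => ?_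
      obtain ⟨p', ⟨h1, h2, h3, h4, -, h6⟩, h7, h8⟩ := h
      have e5 : s'.reg 5 = Q.card := (hs.1 5 rfl).trans a5
      simp only [Expr.cost] at h8
      simp only [Expr.val, e5] at h7
      obtain ⟨-, h9, L, hL⟩ := h6.resolve_left (by omega)
      exact ⟨by omega, h9, (hs.1 4 rfl).trans a4, e5, (hs.1 6 rfl).trans a6, L, _, by omega, hL⟩
    · refine ⟨by omega, by omega, by simp [am], by omega, by rw [a0], Or.inl ⟨by omega, by omega⟩⟩
    · rintro s2 p hs2 ⟨h1, h2, h3, h4, -, h6⟩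
      have e5 : s2.reg 5 = Q.card := (hs2.1 5 rfl).trans a5
      simp only [Expr.Fits]
      omega
    · rintro s2 p hs2 ⟨h1, h2, h3, h4, hp, h6⟩ hg
      have e5 : s2.reg 5 = Q.card := (hs2.1 5 rfl).trans a5
      simp only [Expr.val, e5] at hg
      have hk0 : k < s2.reg 0 := (h6.resolve_right (by omega)).2
      have e8 : ∀ i, s2.mem 8 i = 0 := fun i => by rw [hs2.2 8 rfl, am]
      have e9 : ∀ i, s2.mem 9 i = 0 := fun i => by rw [hs2.2 9 rfl, am]
      obtain ⟨l, hl⟩ : ∃ l, s2.reg 0 = l + 1 := ⟨s2.reg 0 - 1, by omega⟩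
      -- There is no edge table yet. Arrays 8 and 9 are still zero, so every edge is looked up as
      -- number `0` with status `0` and counts as present; only the level of the scan delimits the
      -- graph.
      have hready : SearchReady inp V0 (level G l) l (2 * m) (s2.reg 7) q0 (s2.setReg 0 l) := by
        refine ⟨by simp, ?_, by simp, ?_, S.sub _ S.q0_mem, ?_, ?_, by simpa using h3⟩
        · simpa using (hs2.1 4 rfl).trans a4
        · simpa using (hs2.1 23 rfl).trans a23
        · exact fun v _ w hw => (mem_nb_iff S.index (by omega)).2 hw
        · intro v _ w hw
          simp [e8, e9, (mem_nb_iff S.index (by omega)).1 hw]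
      have hbody : WP inp W Z (.seq (.assign 0 (.sub (.reg 0) (.lit 1))) searchQuery) s2
          (4 + 420 * m) fun s' => (∃ L, Searched V0 (level G l) (s2.reg 7 + 1) q0 L s') ∧
            s'.reg 22 ≤ Q.card ∧ (s'.reg 22 = Q.card ↔ ∀ q ∈ Q, (level G l).Reachable q0 q) ∧
            s'.reg 0 = l := by
        refine WP.seq' (N1 := 4) (R := fun s3 => s3 = s2.setReg 0 l) (WP.straight ?_ (by simp)) ?_
          le_rfl
        · simp [hl]
          omega
        · rintro s3 - rfl
          refine (searchQuery_spec S (by simpa using e5) (by omega) (by omega) (by omega)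
            hready).mono le_rfl ?_
          rintro s4 hs4 ⟨b1, b2, b3⟩
          exact ⟨b1, b2, b3, (hs4.1 0 rfl).trans (by simp)⟩
      refine WT.mono hbody fun s4 T hs4 h => ?_
      obtain ⟨hT, ⟨L, hL⟩, c1, c2, c3⟩ := h
      have e7 := hL.stamp
      refine ⟨_, ⟨by omega, by omega, ?_, c1, rfl, ?_⟩, ?_⟩
      · rw [e7]
        exact hL.queued.stamp_le
      · by_cases hall : ∀ q ∈ Q, (level G l).Reachable q0 q
        · right
          have hsup : q0 ∈ (level G l).support := by
            obtain ⟨w, hw⟩ := hv3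
            exact ⟨w, level_anti (by omega) hw⟩
          have hlk : l = k := by
            have := le_maxTrussness_of_reachable hsup hall
            have := S.level_eq
            omega
          refine ⟨c2.2 hall, by omega, L, ?_⟩
          rw [e7, ← hlk]
          exact hL
        · left
          have h1 : s4.reg 22 ≠ Q.card := fun h => hall (c2.1 h)
          have h2 : l ≠ k := by
            rintro rfl
            exact hall fun q hq => S.level_eq ▸ reachable_level S.conn hn S.q0_mem hq
          omega
      · rw [hp, hl, c3]
        obtain ⟨d, hd⟩ : ∃ d, l = k + d := ⟨l - k, by omega⟩
        have e1 : l + 1 - k = d + 1 := by omega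
        have e2 : l - k = d := by omega
        rw [e1, e2]
        simp only [Expr.cost]
        have : (d + 1) * (430 * m) = d * (430 * m) + 430 * m := by ring
        omega
  · have h1 : vt + 1 - k ≤ 2 * ρ + 2 := by omega
    have h2 : (vt + 1 - k) * (430 * m) ≤ (2 * ρ + 2) * (430 * m) := Nat.mul_le_mul_right _ h1
    have h3 : 1 ≤ (2 * ρ + 2) * m := Nat.mul_pos (by omega) hm
    have h4 : (2 * ρ + 2) * (430 * m) = 430 * ((2 * ρ + 2) * m) := by ring
    omega

end Level


/-! ## The edge table of the maximal connected truss -/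

section EdgeTable

open SimpleGraph

variable {n : ℕ} {G : SimpleGraph (Fin n)} {Q : Finset (Fin n)} {inp : Input} {W : ℕ}
  {Z : Set (ℕ × ℕ)} {V0 : Finset (Fin n)} {k m : ℕ} {q0 : Fin n} {qu : ℕ → Fin n}

theorem sum_range_list {α : Type*} [DecidableEq α] {L : List α} (hL : L.Nodup) (f : α → ℕ) :
    ∑ j ∈ Finset.range L.length, (if h : j < L.length then f L[j] else 0) =
      ∑ v ∈ L.toFinset, f v := by
  rw [Finset.sum_range, List.sum_toFinset _ hL, ← Fin.sum_univ_fun_getElem]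
  simp

/-- The edges in the list `E` of ordered pairs are stored in the arrays 0, 1 (ends) and
8 (numbers of the edges). -/
structure Stored (E : List (Fin n × Fin n)) (c : ℕ) (mem : ℕ → ℕ → ℕ) : Prop where
  len : c = E.length
  nodup : E.Nodup
  lt : ∀ e ∈ E, e.1 < e.2
  get : ∀ (i : ℕ) (v w : Fin n), E[i]? = some (v, w) → mem 0 i = v ∧ mem 1 i = w ∧
    mem 8 (v * n + w) = i ∧ mem 8 (w * n + v) = i

theorem Stored.append {E : List (Fin n × Fin n)} {c : ℕ} {mem mem' : ℕ → ℕ → ℕ}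
    (h : Stored E c mem) {v w : Fin n} (hvw : v < w) (hE : (v, w) ∉ E)
    (h0 : mem' 0 = Function.update (mem 0) c v) (h1 : mem' 1 = Function.update (mem 1) c w)
    (h8 : mem' 8 = Function.update (Function.update (mem 8) (v * n + w) c) (w * n + v) c) :
    Stored (E ++ [(v, w)]) (c + 1) mem' where
  len := by simp [h.len]
  nodup := List.nodup_append.2 ⟨h.nodup, by simp, fun a ha b hb e => by
    rw [List.mem_singleton] at hb
    exact hE (hb ▸ e ▸ ha)⟩
  lt := by
    intro e he
    rcases List.mem_append.1 he with he | he
    · exact h.lt e he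
    · rw [List.mem_singleton] at he
      exact he ▸ hvw
  get := by
    intro i x y hi
    rw [List.getElem?_append] at hi
    have hlen := h.len
    split_ifs at hi with hlt
    · obtain ⟨g0, g1, g2, g3⟩ := h.get i x y hi
      have hmem : (x, y) ∈ E := List.mem_of_getElem? hi
      have hxy : x < y := h.lt _ hmem
      have n1 : ¬ (x = v ∧ y = w) := fun e => hE (e.1 ▸ e.2 ▸ hmem)
      have n2 : ¬ (x = w ∧ y = v) := fun e => absurd hxy (by rw [e.1, e.2]; exact hvw.asymm)
      have m1 : ((x : ℕ) * n + y) ≠ v * n + w := fun e => n1 (pair_inj e)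
      have m2 : ((x : ℕ) * n + y) ≠ w * n + v := fun e => n2 (pair_inj e)
      have m3 : ((y : ℕ) * n + x) ≠ v * n + w := fun e => n2 (pair_inj e).symm
      have m4 : ((y : ℕ) * n + x) ≠ w * n + v := fun e => n1 (pair_inj e).symm
      rw [h0, h1, h8]
      have hic : i ≠ c := by omega
      simp [Function.update_apply, hic, m1, m2, m3, m4, g0, g1, g2, g3]
    · rw [List.getElem?_singleton] at hi
      split_ifs at hi with h0'
      have hic : i = c := by omega
      simp only [Option.some.injEq, Prod.mk.injEq] at hi
      obtain ⟨rfl, rfl⟩ := hi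
      rw [h0, h1, h8]
      simp [Function.update_apply, hic]

/-- Record the edge from register 10 to register 13 if it is ascending, and count the degree. -/
def recordEdge : Com :=
  block [.load 17 13 (.reg 10), .store 13 (.reg 10) (.add (.reg 17) (.lit 1)),
    .ite (.reg 10) (.reg 13)
      (block [.store 0 (.reg 3) (.reg 10), .store 1 (.reg 3) (.reg 13),
        .store 8 (.add (.mul (.reg 10) (.reg 4)) (.reg 13)) (.reg 3),
        .store 8 (.add (.mul (.reg 13) (.reg 4)) (.reg 10)) (.reg 3),
        .assign 3 (.add (.reg 3) (.lit 1))]) .skip]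

/-- Build the edge table from the list of vertices. -/
def edgeTable : Com := forUp 21 9 (.seq (.load 10 5 (.reg 21)) (scan recordEdge))

/-- The completed edge table. -/
structure EdgeTable (P0 : SimpleGraph (Fin n)) (V0 : Finset (Fin n)) (inp : Input) (k m : ℕ)
    (mem : ℕ → ℕ → ℕ) : Prop where
  ends : ∀ v w : Fin n, P0.Adj v w → v < w → mem 8 (v * n + w) < m ∧
    mem 0 (mem 8 (v * n + w)) = v ∧ mem 1 (mem 8 (v * n + w)) = w ∧
    mem 8 (w * n + v) = mem 8 (v * n + w)
  surj : ∀ e < m, ∃ v w : Fin n, P0.Adj v w ∧ v < w ∧ mem 0 e = v ∧ mem 1 e = w ∧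
    mem 8 (v * n + w) = e
  deg : ∀ v ∈ V0, mem 13 v = (nb n inp k v).card

variable (S : Setting G Q inp W Z V0 k m q0 qu)

include S

theorem Setting.core_mem {v w : Fin n} (h : (core G Q q0).Adj v w) : v ∈ V0 ∧ w ∈ V0 :=
  ⟨((S.core_adj v w).1 h).1, ((S.core_adj w v).1 h.symm).1⟩

theorem Setting.length_le {E : List (Fin n × Fin n)} (hE : E.Nodup)
    (h : ∀ e ∈ E, (core G Q q0).Adj e.1 e.2 ∧ e.1 < e.2) : E.length ≤ m := by
  rw [← List.toFinset_card_of_nodup hE, ← S.card_edges, ← Set.ncard_coe_finset]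
  exact Set.ncard_le_ncard (fun e he => h e (by simpa using he)) (Set.toFinite _)

/-- Scanning the listed vertices meets every edge of the core from both ends. The ascending
direction assigns the number and enters it for both ordered pairs, while each direction counts
towards a degree. Only `2m` of the potential `n²` entries of array 8 are ever used. -/
theorem edgeTable_spec {L : List (Fin n)} {st : ℕ} {s : State} (h0 : s.reg 0 = k) (h3 : s.reg 3 = 0)
    (h4 : s.reg 4 = n) (hL : Searched V0 (level G k) st q0 L s)
    (hz : ∀ v ∈ V0, s.mem 13 v = 0) :
    WP inp W Z edgeTable s (400 * m) fun s' => s'.reg 3 = m ∧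
      EdgeTable (core G Q q0) V0 inp k m s'.mem := by
  have hW := S.word'
  have hm := S.one_le
  have hk := S.two_le_level
  have hm2 := S.zone.m_le
  have hq := hL.queued
  have h9 := hq.len
  have hLV : ∀ v, v ∈ L ↔ v ∈ V0 := fun v => (hL.mem_iff v).trans (S.mem_V0 v).symm
  have hLV' : L.toFinset = V0 := by ext v; simp [hLV]
  have hlen : L.length ≤ 2 * m := by
    rw [← List.toFinset_card_of_nodup hL.nodup, hLV']
    exact S.card_le
  have hkW : k ≤ W := by
    have := S.vertexTruss
    omega
  refine (WP.counting (Z := Z) (m := L.length) (fun j s1 => ∃ E, Stored E (s1.reg 3) s1.mem ∧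
      (∀ v w, (v, w) ∈ E ↔ (core G Q q0).Adj v w ∧ v < w ∧ v ∈ L.take j) ∧
      (∀ v ∈ L.take j, s1.mem 13 v = (nb n inp k v).card) ∧
      ∀ v ∈ V0, v ∉ L.take j → s1.mem 13 v = 0)
    (fun j => if h : j < L.length then 80 * (nb n inp k L[j]).card + 32 else 0)
    (by decide) rfl rfl h9 (by omega) (by omega) ?_ ?_).mono ?_ ?_
  · refine ⟨[], ⟨by simp [h3], by simp, by simp, by simp⟩, by simp, by simp, ?_⟩
    simpa using hz
  · rintro j hj s1 hs1 h21 ⟨E, hE1, hE2, hE3, hE4⟩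
    rw [dif_pos hj]
    set v := L[j] with hv
    have hvV : v ∈ V0 := (hLV v).1 (List.getElem_mem hj)
    have hvT : v ∉ L.take j := by
      intro hmem
      obtain ⟨i, hi, he⟩ := List.mem_take_iff_getElem.1 hmem
      have := (hL.nodup.getElem_inj_iff).1 he
      omega
    have hget : s1.mem 5 j = v := by
      rw [hs1.2 5 rfl]
      exact hq.get _ _ (List.getElem?_eq_getElem hj)
    have hvlt := v.2
    refine WP.seq' (N1 := 2) (N2 := 80 * (nb n inp k v).card + 30)
      (R := fun s2 => s2 = s1.setReg 10 v) (WP.straight ?_ (by simp)) ?_ (by omega)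
    · simp [h21, hget]
      exact ⟨by omega, by omega, S.zone.idx 5 (by omega) j (by omega)⟩
    rintro s2 - rfl
    have e4 : s1.reg 4 = n := (hs1.1 4 rfl).trans h4
    refine (WP.scan (Z := Z) S.index (by omega) (K := 60) (l := k) (v := v)
      (fun X s2 => ∃ E, Stored E (s2.reg 3) s2.mem ∧
        (∀ x w, (x, w) ∈ E ↔ (core G Q q0).Adj x w ∧ x < w ∧
          (x ∈ L.take j ∨ (x = v ∧ w ∈ X))) ∧
        (∀ x ∈ L.take j, s2.mem 13 x = (nb n inp k x).card) ∧ s2.mem 13 v = X.card ∧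
        ∀ x ∈ V0, x ∉ L.take j → x ≠ v → s2.mem 13 x = 0) (by omega) hkW
      (by simpa using (hs1.1 0 rfl).trans h0) (by simp) rfl rfl rfl rfl ?_ ?_ ?_).mono le_rfl ?_
    · rintro X s2 x y hx hx' ⟨E, f1, f2, f3, f4, f5⟩
      refine ⟨E, ?_, f2, f3, f4, f5⟩
      rw [State.reg_setReg, if_neg (by omega)]
      exact f1
    · refine ⟨E, by simpa using hE1, by simpa using hE2, by simpa using hE3,
        by simpa using hE4 v hvV hvT, fun x hx hxT _ => by simpa using hE4 x hx hxT⟩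
    · rintro X w s2 hs2 hX hwX hw h13 ⟨E, f1, f2, f3, f4, f5⟩
      have hwlt := w.2
      have hp := pair_lt v w
      have hp' := pair_lt w v
      have hadj : (core G Q q0).Adj v w := (S.core_adj v w).2 ⟨hvV, hw⟩
      have hwV := (S.core_mem hadj).2
      have hwv : v ∈ nb n inp k w := ((S.core_adj w v).1 hadj.symm).2
      have g4 : s2.reg 4 = n := (hs2.1 4 rfl).trans (by simpa using e4)
      have g10 : s2.reg 10 = v := (hs2.1 10 rfl).trans (by simp)
      have hXn : X.card ≤ n := by simpa using Finset.card_le_univ X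
      have z13 := S.zone.vtx 13 (by omega) v hvV
      have z8 := S.zone.dart 8 (by omega) v hvV w hw
      have z8' := S.zone.dart 8 (by omega) w hwV v hwv
      have hvwE : (v, w) ∉ E := by
        rw [f2]
        rintro ⟨-, -, h | ⟨-, h⟩⟩
        · exact hvT h
        · exact hwX h
      have hlen3 := f1.len
      have hElen : E.length ≤ m := S.length_le f1.nodup fun e he => by
        have := (f2 e.1 e.2).1 he
        exact ⟨this.1, this.2.1⟩
      have z0 := S.zone.idx 0 (by omega) (s2.reg 3) (by omega)
      have z1 := S.zone.idx 1 (by omega) (s2.reg 3) (by omega)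
      have deg1 : ∀ x ∈ L.take j,
          Function.update (s2.mem 13) v (X.card + 1) x = (nb n inp k x).card := by
        intro x hx
        rw [Function.update_apply, if_neg, f3 x hx]
        intro e
        exact hvT (Fin.ext e ▸ hx)
      have deg2 : ∀ x ∈ V0, x ∉ L.take j → x ≠ v →
          Function.update (s2.mem 13) v (X.card + 1) x = 0 := by
        intro x hx hxT hxv
        rw [Function.update_apply, if_neg (fun e => hxv (Fin.ext e)), f5 x hx hxT hxv]
      refine WP.code (by simp [recordEdge]) fun R hR => ?_
      by_cases hlt : v < w
      · have hlt' : (v : ℕ) < w := hlt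
        simp [recordEdge, g4, g10, h13, f4, z13, z8, z8', z0, z1, hlt']
        and_intros <;> try omega
        refine hR _ ⟨E ++ [(v, w)], ?_, ?_, ?_, ?_, ?_⟩
        · simp only [State.reg_setReg, if_true, State.mem_setReg]
          refine f1.append hlt hvwE ?_ ?_ ?_
          · simp
          · simp
          · simp
        · intro x y
          rw [List.mem_append, f2, List.mem_singleton, Prod.mk.injEq]
          constructor
          · rintro (⟨a1, a2, a3⟩ | ⟨rfl, rfl⟩)
            · exact ⟨a1, a2, a3.imp_right fun h => ⟨h.1, Finset.mem_insert_of_mem h.2⟩⟩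
            · exact ⟨hadj, hlt, Or.inr ⟨rfl, Finset.mem_insert_self _ _⟩⟩
          · rintro ⟨a1, a2, a3 | ⟨rfl, a3⟩⟩
            · exact Or.inl ⟨a1, a2, Or.inl a3⟩
            · rcases Finset.mem_insert.1 a3 with rfl | a3
              · exact Or.inr ⟨rfl, rfl⟩
              · exact Or.inl ⟨a1, a2, Or.inr ⟨rfl, a3⟩⟩
        · simpa using deg1
        · simp [Finset.card_insert_of_notMem hwX]
        · simpa using deg2
      · have hlt' : ¬ (v : ℕ) < w := hlt
        simp [recordEdge, g4, g10, h13, f4, z13, z8, z8', z0, z1, hlt']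
        and_intros <;> try omega
        refine hR _ ⟨E, ?_, ?_, ?_, ?_, ?_⟩
        · refine ⟨by simpa using f1.len, f1.nodup, f1.lt, by simpa using f1.get⟩
        · intro x y
          rw [f2]
          refine and_congr_right fun a1 => and_congr_right fun a2 => or_congr_right ?_
          refine and_congr_right fun a3 => ?_
          rw [Finset.mem_insert]
          refine ⟨Or.inr, fun h => h.resolve_left ?_⟩
          rintro rfl
          exact hlt (a3 ▸ a2)
        · simpa using deg1
        · simp [Finset.card_insert_of_notMem hwX]
        · simpa using deg2
    · rintro s3 hs3 ⟨E, f1, f2, f3, f4, f5⟩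
      have htake : ∀ x, x ∈ L.take (j + 1) ↔ x ∈ L.take j ∨ x = v := by
        intro x
        rw [← List.take_concat_get' L j hj, List.mem_append, List.mem_singleton]
      refine ⟨E, by simpa using f1, fun x w => ?_, fun x hx => ?_, fun x hx hxT => ?_⟩
      · rw [f2, htake]
        refine and_congr_right fun a1 => and_congr_right fun a2 => or_congr_right ?_
        exact ⟨fun h => h.1, fun h => ⟨h, ((S.core_adj v w).1 (h ▸ a1)).2⟩⟩
      · rcases (htake x).1 hx with hx | rfl
        · simpa using f3 x hx
        · simpa using f4
      · rw [htake] at hxT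
        push Not at hxT
        simpa using f5 x hx hxT.1 hxT.2
  · have h1 := sum_range_list hL.nodup fun v => 80 * (nb n inp k v).card + 40
    rw [hLV'] at h1
    have h2 : ∑ v ∈ V0, (80 * (nb n inp k v).card + 40) =
        80 * ∑ v ∈ V0, (nb n inp k v).card + V0.card * 40 := by
      simp [Finset.sum_add_distrib, Finset.mul_sum]
    have h3 : ∑ j ∈ Finset.range L.length,
        ((if h : j < L.length then 80 * (nb n inp k L[j]).card + 32 else 0) + 8) =
        ∑ j ∈ Finset.range L.length,
          (if h : j < L.length then 80 * (nb n inp k L[j]).card + 40 else 0) := by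
      refine Finset.sum_congr rfl fun j hj => ?_
      rw [dif_pos (Finset.mem_range.1 hj), dif_pos (Finset.mem_range.1 hj)]
    have := S.sum_deg
    have := S.card_le
    omega
  · rintro s' hs' ⟨E, f1, f2, f3, -⟩
    rw [List.take_length] at f3
    have f2' : ∀ v w, (v, w) ∈ E ↔ (core G Q q0).Adj v w ∧ v < w := by
      intro v w
      rw [f2, List.take_length]
      exact ⟨fun h => ⟨h.1, h.2.1⟩, fun h => ⟨h.1, h.2, (hLV v).2 (S.core_mem h.1).1⟩⟩
    have hEm : E.length = m := by
      rw [← List.toFinset_card_of_nodup f1.nodup, ← S.card_edges, ← Set.ncard_coe_finset]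
      congr 1
      ext ⟨v, w⟩
      simp [f2']
    refine ⟨f1.len.trans hEm, ?_, ?_, fun v hv => f3 v ((hLV v).2 hv)⟩
    · intro v w hadj hlt
      obtain ⟨i, hi, he⟩ := List.mem_iff_getElem.1 ((f2' v w).2 ⟨hadj, hlt⟩)
      obtain ⟨g0, g1, g2, g3⟩ := f1.get i v w (by rw [List.getElem?_eq_getElem hi, he])
      rw [g2, g3]
      exact ⟨hEm ▸ hi, g0, g1, rfl⟩
    · intro e he
      have hi : e < E.length := by omega
      obtain ⟨g0, g1, g2, g3⟩ := f1.get e E[e].1 E[e].2 (List.getElem?_eq_getElem hi)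
      have := (f2' E[e].1 E[e].2).1 (List.getElem_mem hi)
      exact ⟨_, _, this.1, this.2, g0, g1, g2⟩

end EdgeTable


/-! ## Numbered edges and triangles -/

section Numbering

open SimpleGraph

variable {n : ℕ} {P0 : SimpleGraph (Fin n)} {m : ℕ}

/-- The numbers `0, …, m - 1` of the edges of `P0`. -/
structure Numbering (P0 : SimpleGraph (Fin n)) (m : ℕ) where
  id : Fin n → Fin n → ℕ
  lo : ℕ → Fin n
  hi : ℕ → Fin n
  comm : ∀ v w, id v w = id w v
  id_lt : ∀ v w, P0.Adj v w → id v w < m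
  adj : ∀ e < m, P0.Adj (lo e) (hi e)
  lo_lt : ∀ e < m, lo e < hi e
  id_ends : ∀ e < m, id (lo e) (hi e) = e
  ends : ∀ v w, P0.Adj v w → v < w → lo (id v w) = v ∧ hi (id v w) = w

variable (N : Numbering P0 m)

/-- The edges whose numbers satisfy `p`. -/
def Numbering.graph (p : ℕ → Prop) : SimpleGraph (Fin n) where
  Adj v w := P0.Adj v w ∧ p (N.id v w)
  symm := ⟨fun v w h => ⟨h.1.symm, N.comm v w ▸ h.2⟩⟩
  loopless := ⟨fun _ h => h.1.ne rfl⟩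

/-- `a`, `b` are the ends of `e`. -/
def Numbering.Ends (e : ℕ) (a b : Fin n) : Prop :=
  (a = N.lo e ∧ b = N.hi e) ∨ (a = N.hi e ∧ b = N.lo e)

variable {N}

theorem Numbering.graph_le (p : ℕ → Prop) : N.graph p ≤ P0 := fun _ _ h => h.1

theorem Numbering.graph_mono {p p' : ℕ → Prop} (h : ∀ e < m, p e → p' e) :
    N.graph p ≤ N.graph p' := fun v w h' => ⟨h'.1, h _ (N.id_lt v w h'.1) h'.2⟩

theorem Numbering.graph_congr {p p' : ℕ → Prop} (h : ∀ e < m, p e ↔ p' e) :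
    N.graph p = N.graph p' :=
  le_antisymm (N.graph_mono fun e he => (h e he).1) (N.graph_mono fun e he => (h e he).2)

theorem Numbering.ends_id {v w : Fin n} (h : P0.Adj v w) : N.Ends (N.id v w) v w := by
  rcases lt_or_gt_of_ne h.ne with hlt | hlt
  · obtain ⟨h1, h2⟩ := N.ends v w h hlt
    exact Or.inl ⟨h1.symm, h2.symm⟩
  · obtain ⟨h1, h2⟩ := N.ends w v h.symm hlt
    rw [N.comm]
    exact Or.inr ⟨h2.symm, h1.symm⟩

theorem Numbering.Ends.symm {e : ℕ} {a b : Fin n} (h : N.Ends e a b) : N.Ends e b a := by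
  rcases h with ⟨h1, h2⟩ | ⟨h1, h2⟩
  · exact Or.inr ⟨h2, h1⟩
  · exact Or.inl ⟨h2, h1⟩

theorem Numbering.Ends.adj {e : ℕ} {a b : Fin n} (h : N.Ends e a b) (he : e < m) :
    P0.Adj a b := by
  rcases h with ⟨rfl, rfl⟩ | ⟨rfl, rfl⟩
  · exact N.adj e he
  · exact (N.adj e he).symm

theorem Numbering.Ends.id {e : ℕ} {a b : Fin n} (h : N.Ends e a b) (he : e < m) :
    N.id a b = e := by
  rcases h with ⟨rfl, rfl⟩ | ⟨rfl, rfl⟩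
  · exact N.id_ends e he
  · rw [N.comm]
    exact N.id_ends e he

theorem Numbering.Ends.unique {e : ℕ} {a b x y : Fin n} (h : N.Ends e a b) (h' : N.Ends e x y) :
    (x = a ∧ y = b) ∨ (x = b ∧ y = a) := by
  rcases h with ⟨rfl, rfl⟩ | ⟨rfl, rfl⟩ <;> rcases h' with ⟨rfl, rfl⟩ | ⟨rfl, rfl⟩ <;> simp

theorem Numbering.id_eq {v w x y : Fin n} (h : P0.Adj v w) (h' : P0.Adj x y) :
    N.id v w = N.id x y ↔ (v = x ∧ w = y) ∨ (v = y ∧ w = x) := by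
  constructor
  · intro he
    exact (N.ends_id h').unique (he ▸ N.ends_id h)
  · rintro (⟨rfl, rfl⟩ | ⟨rfl, rfl⟩)
    · rfl
    · exact N.comm _ _

theorem Numbering.Ends.graph_adj {p : ℕ → Prop} {e : ℕ} {a b : Fin n} (h : N.Ends e a b)
    (he : e < m) : (N.graph p).Adj a b ↔ p e := by
  refine ⟨fun h' => h.id he ▸ h'.2, fun h' => ⟨h.adj he, (h.id he).symm ▸ h'⟩⟩

variable (N) in
/-- The support of the edge number `e` among the edges whose numbers satisfy `p`. -/
noncomputable def Numbering.supp (p : ℕ → Prop) (e : ℕ) : ℕ :=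
  common (N.graph p) (N.lo e) (N.hi e)

theorem Numbering.Ends.common {p : ℕ → Prop} {e : ℕ} {a b : Fin n} (h : N.Ends e a b) :
    common (N.graph p) a b = N.supp p e := by
  rcases h with ⟨rfl, rfl⟩ | ⟨rfl, rfl⟩
  · rfl
  · exact common_comm _ _ _

open scoped Classical in
variable (N) in
/-- The common neighbours of the ends of `e` among the edges whose numbers satisfy `p`. -/
noncomputable def Numbering.tips (p : ℕ → Prop) (e : ℕ) : Finset (Fin n) :=
  Finset.univ.filter fun w => (N.graph p).Adj (N.lo e) w ∧ (N.graph p).Adj (N.hi e) w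

theorem Numbering.Ends.mem_tips {p : ℕ → Prop} {e : ℕ} {a b w : Fin n} (h : N.Ends e a b) :
    w ∈ N.tips p e ↔ (N.graph p).Adj a w ∧ (N.graph p).Adj b w := by
  rcases h with ⟨rfl, rfl⟩ | ⟨rfl, rfl⟩
  · simp [Numbering.tips]
  · simp [Numbering.tips, and_comm]

theorem Numbering.card_tips (p : ℕ → Prop) (e : ℕ) : (N.tips p e).card = N.supp p e := by
  rw [← Set.ncard_coe_finset]
  unfold Numbering.supp CTC.common
  congr 1
  ext w
  simp [Numbering.tips]

open scoped Classical in
variable (N) in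
/-- The number of triangles that consist of `e`, `f` and a vertex of `X` as the common neighbour of
the ends of `e`. -/
noncomputable def Numbering.hits (e f : ℕ) (X : Finset (Fin n)) : ℕ :=
  (X.filter fun w => f = N.id (N.lo e) w ∨ f = N.id (N.hi e) w).card

theorem Numbering.hits_mono {e f : ℕ} {X Y : Finset (Fin n)} (h : X ⊆ Y) :
    N.hits e f X ≤ N.hits e f Y := by
  classical
  exact Finset.card_le_card (Finset.filter_subset_filter _ h)

@[simp] theorem Numbering.hits_empty {e f : ℕ} : N.hits e f ∅ = 0 := by
  classical
  simp [Numbering.hits]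

open scoped Classical in
theorem Numbering.Ends.hits_insert {e f : ℕ} {a b w : Fin n} (h : N.Ends e a b)
    {X : Finset (Fin n)} (hw : w ∉ X) : N.hits e f (insert w X) =
      N.hits e f X + if f = N.id a w ∨ f = N.id b w then 1 else 0 := by
  have h1 : (f = N.id (N.lo e) w ∨ f = N.id (N.hi e) w) ↔ (f = N.id a w ∨ f = N.id b w) := by
    rcases h with ⟨rfl, rfl⟩ | ⟨rfl, rfl⟩
    · rfl
    · exact or_comm
  unfold Numbering.hits
  rw [Finset.filter_insert]
  split_ifs with h2 h3 h3
  · rw [Finset.card_insert_of_notMem fun h' => hw (Finset.mem_filter.1 h').1]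
  · exact absurd (h1.1 h2) h3
  · exact absurd (h1.2 h3) h2
  · rfl

/-- The support of `f` drops by the number of triangles through both edges. For `e = ab` and `f =
ay` the only candidate is `aby`, which exists if and only if `by` is present; edges without a common
end share no triangle. -/
theorem Numbering.supp_remove {p : ℕ → Prop} {e f : ℕ} (he : e < m) (hf : f < m) (hpe : p e)
    (hpf : p f) (hne : f ≠ e) :
    N.supp (fun g => p g ∧ g ≠ e) f + N.hits e f (N.tips p e) = N.supp p f := by
  classical
  -- All four ways for the two edges to share an end reduce to this one by swapping the names of the
  -- ends.
  have key : ∀ a b y, N.Ends e a b → N.Ends f a y →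
      N.supp (fun g => p g ∧ g ≠ e) f + N.hits e f (N.tips p e) = N.supp p f := by
    intro a b y hab hay
    have hadj := hab.adj he
    have hadj' := hay.adj hf
    have hyb : y ≠ b := by
      rintro rfl
      exact hne ((hay.id hf).symm.trans (hab.id he))
    have e1 : N.hits e f (N.tips p e) = if p (N.id b y) ∧ P0.Adj b y then 1 else 0 := by
      have h0 : ∀ w ∈ N.tips p e, (f = N.id (N.lo e) w ∨ f = N.id (N.hi e) w) ↔ w = y := by
        intro w hw
        have h1 : (f = N.id (N.lo e) w ∨ f = N.id (N.hi e) w) ↔ (f = N.id a w ∨ f = N.id b w) := by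
          rcases hab with ⟨rfl, rfl⟩ | ⟨rfl, rfl⟩
          · rfl
          · exact or_comm
        obtain ⟨hw1, hw2⟩ := hab.mem_tips.1 hw
        rw [h1, ← hay.id hf, N.id_eq hadj' hw1.1, N.id_eq hadj' hw2.1]
        constructor
        · rintro ((⟨-, h⟩ | ⟨-, h⟩) | (⟨h, -⟩ | ⟨-, h⟩))
          · exact h.symm
          · exact absurd h.symm hadj'.ne
          · exact absurd h hadj.ne
          · exact absurd h hyb
        · rintro rfl
          exact Or.inl (Or.inl ⟨rfl, rfl⟩)
      unfold Numbering.hits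
      rw [Finset.filter_congr h0, Finset.filter_eq']
      simp only [hab.mem_tips]
      have h2 : (N.graph p).Adj a y := (hay.graph_adj hf).2 hpf
      by_cases h3 : (N.graph p).Adj b y
      · rw [if_pos ⟨h2, h3⟩, if_pos ⟨h3.2, h3.1⟩]
        simp
      · rw [if_neg fun h => h3 h.2, if_neg fun h => h3 ⟨h.2, h.1⟩]
        simp
    rw [e1, ← hay.common (p := p), ← hay.common (p := fun g => p g ∧ g ≠ e)]
    -- The only common neighbour of the ends of `f` that can be lost is `b`.
    have e2 : ∀ z, z ≠ b → (((N.graph fun g => p g ∧ g ≠ e).Adj a z ∧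
        (N.graph fun g => p g ∧ g ≠ e).Adj y z) ↔ ((N.graph p).Adj a z ∧ (N.graph p).Adj y z)) := by
      intro z hz
      constructor
      · exact fun h => ⟨⟨h.1.1, h.1.2.1⟩, ⟨h.2.1, h.2.2.1⟩⟩
      · intro h
        refine ⟨⟨h.1.1, h.1.2, fun h' => ?_⟩, ⟨h.2.1, h.2.2, fun h' => ?_⟩⟩
        · rw [← hab.id he, N.id_eq h.1.1 hadj] at h'
          rcases h' with ⟨-, h'⟩ | ⟨h', -⟩
          · exact hz h'
          · exact hadj.ne h'
        · rw [← hab.id he, N.id_eq h.2.1 hadj] at h'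
          rcases h' with ⟨h', -⟩ | ⟨h', -⟩
          · exact hadj'.ne h'.symm
          · exact hyb h'
    have e3 : ¬ (N.graph fun g => p g ∧ g ≠ e).Adj a b := fun h => h.2.2 (hab.id he)
    unfold CTC.common
    have e4 : b ∉ (N.graph fun g => p g ∧ g ≠ e).neighborSet a ∩
        (N.graph fun g => p g ∧ g ≠ e).neighborSet y := fun h => e3 h.1
    split_ifs with h
    · have hby : (N.graph p).Adj y b := SimpleGraph.Adj.symm ⟨h.2, h.1⟩
      rw [← Set.ncard_insert_of_notMem e4 (Set.toFinite _)]
      congr 1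
      ext z
      rw [Set.mem_insert_iff]
      by_cases hz : z = b
      · subst hz
        exact ⟨fun _ => ⟨(hab.graph_adj he).2 hpe, hby⟩, fun _ => Or.inl rfl⟩
      · simp only [hz, false_or]
        exact e2 z hz
    · rw [add_zero]
      congr 1
      ext z
      by_cases hz : z = b
      · subst hz
        refine ⟨fun h' => absurd h' e4, fun h' => (h ?_).elim⟩
        have : (N.graph p).Adj z y := (show (N.graph p).Adj y z from h'.2).symm
        exact ⟨this.2, this.1⟩
      · exact e2 z hz
  have hE : N.Ends e (N.lo e) (N.hi e) := Or.inl ⟨rfl, rfl⟩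
  have hF : N.Ends f (N.lo f) (N.hi f) := Or.inl ⟨rfl, rfl⟩
  by_cases h1 : N.lo f = N.lo e
  · exact key _ _ _ hE (h1 ▸ hF)
  by_cases h2 : N.lo f = N.hi e
  · exact key _ _ _ hE.symm (h2 ▸ hF)
  by_cases h3 : N.hi f = N.lo e
  · exact key _ _ _ hE (h3 ▸ hF.symm)
  by_cases h4 : N.hi f = N.hi e
  · exact key _ _ _ hE.symm (h4 ▸ hF.symm)
  have e1 : N.hits e f (N.tips p e) = 0 := by
    unfold Numbering.hits
    rw [Finset.card_eq_zero, Finset.filter_eq_empty_iff]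
    intro w hw
    obtain ⟨hw1, hw2⟩ := hE.mem_tips.1 hw
    rintro (h | h)
    · rcases (h ▸ N.ends_id hw1.1 : N.Ends f _ _) with ⟨h5, -⟩ | ⟨h5, -⟩
      · exact h1 h5.symm
      · exact h3 h5.symm
    · rcases (h ▸ N.ends_id hw2.1 : N.Ends f _ _) with ⟨h5, -⟩ | ⟨h5, -⟩
      · exact h2 h5.symm
      · exact h4 h5.symm
  rw [e1, add_zero]
  unfold Numbering.supp CTC.common
  congr 1
  have e2 : ∀ x z, x ≠ N.lo e → x ≠ N.hi e →
      ((N.graph fun g => p g ∧ g ≠ e).Adj x z ↔ (N.graph p).Adj x z) := by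
    intro x z hx hx'
    refine ⟨fun h => ⟨h.1, h.2.1⟩, fun h => ⟨h.1, h.2, fun h' => ?_⟩⟩
    rcases (h' ▸ N.ends_id h.1 : N.Ends e _ _) with ⟨h5, -⟩ | ⟨h5, -⟩
    · exact hx h5
    · exact hx' h5
  ext z
  exact and_congr (e2 _ z h1 h2) (e2 _ z h3 h4)

theorem Numbering.supp_congr {p p' : ℕ → Prop} (h : ∀ e < m, p e ↔ p' e) (f : ℕ) :
    N.supp p f = N.supp p' f := by
  unfold Numbering.supp
  rw [N.graph_congr h]

theorem Numbering.sum_min_le {b : ℕ} (h : ForestCover b P0) (d : Fin n → ℕ) :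
    ∑ e ∈ Finset.range m, min (d (N.lo e)) (d (N.hi e)) ≤ b * ∑ v, d v := by
  classical
  have h1 := h.sum_min_le ((Finset.range m).image fun e => (N.lo e, N.hi e)) (fun x hx => by
    obtain ⟨e, he, rfl⟩ := Finset.mem_image.1 hx
    rw [Finset.mem_range] at he
    exact ⟨N.adj e he, N.lo_lt e he⟩) d
  rwa [Finset.sum_image] at h1
  intro e he f hf hef
  have he' : e < m := by simpa using he
  have hf' : f < m := by simpa using hf
  simp only [Prod.mk.injEq] at hef
  rw [← N.id_ends e he', hef.1, hef.2, N.id_ends f hf']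

/-- Replaces array contents by functions on vertices and edge numbers, so that statements about
triangles need not refer to memory. -/
theorem EdgeTable.exists_numbering {V0 : Finset (Fin n)} {inp : Input} {k : ℕ}
    {mem : ℕ → ℕ → ℕ} (h : EdgeTable P0 V0 inp k m mem) (v0 : Fin n) :
    ∃ N : Numbering P0 m, (∀ v w, P0.Adj v w → mem 8 (v * n + w) = N.id v w) ∧
      ∀ e < m, mem 0 e = N.lo e ∧ mem 1 e = N.hi e := by
  classical
  have hs : ∀ e, ∃ v w : Fin n, e < m → P0.Adj v w ∧ v < w ∧ mem 0 e = v ∧ mem 1 e = w ∧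
      mem 8 (v * n + w) = e := by
    intro e
    by_cases he : e < m
    · obtain ⟨v, w, h'⟩ := h.surj e he
      exact ⟨v, w, fun _ => h'⟩
    -- A default pair for numbers that belong to no edge.
    · exact ⟨v0, v0, fun he' => (he he').elim⟩
  choose lo hi hlh using hs
  have hid : ∀ v w : Fin n, P0.Adj v w →
      (if v < w then mem 8 (v * n + w) else mem 8 (w * n + v)) = mem 8 (v * n + w) ∧
      mem 8 (v * n + w) < m := by
    intro v w hvw
    rcases lt_or_gt_of_ne hvw.ne with hlt | hlt
    · rw [if_pos hlt]
      exact ⟨rfl, (h.ends v w hvw hlt).1⟩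
    · rw [if_neg hlt.asymm]
      obtain ⟨h1, -, -, h2⟩ := h.ends w v hvw.symm hlt
      exact ⟨h2.symm, h2 ▸ h1⟩
  refine ⟨⟨fun v w => if v < w then mem 8 (v * n + w) else mem 8 (w * n + v), lo, hi, ?_, ?_,
    fun e he => (hlh e he).1, fun e he => (hlh e he).2.1, ?_, ?_⟩, fun v w hvw => (hid v w hvw).1.symm,
    fun e he => ⟨(hlh e he).2.2.1, (hlh e he).2.2.2.1⟩⟩
  · intro v w
    rcases lt_trichotomy v w with hlt | rfl | hlt
    · simp [hlt, hlt.asymm]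
    · rfl
    · simp [hlt, hlt.asymm]
  · intro v w hvw
    simp only [(hid v w hvw).1]
    exact (hid v w hvw).2
  · intro e he
    simp only [(hlh e he).2.1, if_true]
    exact (hlh e he).2.2.2.2
  · intro v w hvw hlt
    simp only [hlt, if_true]
    obtain ⟨h1, h2, h3, -⟩ := h.ends v w hvw hlt
    obtain ⟨-, -, g1, g2, -⟩ := hlh _ h1
    exact ⟨Fin.ext (g1.symm.trans h2), Fin.ext (g2.symm.trans h3)⟩

end Numbering


/-! ## Enumerating the triangles of an edge -/

section Triangles

open SimpleGraph

variable {n : ℕ} {G : SimpleGraph (Fin n)} {Q : Finset (Fin n)} {inp : Input} {W : ℕ}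
  {Z : Set (ℕ × ℕ)} {V0 : Finset (Fin n)} {k m : ℕ} {q0 : Fin n} {qu : ℕ → Fin n}

/-- The registers and arrays that do not change once the edge table has been built. -/
structure Ready (Q V0 : Finset (Fin n)) (inp : Input) (k : ℕ) (q0 : Fin n)
    {P0 : SimpleGraph (Fin n)} (N : Numbering P0 m) (s : State) : Prop where
  level : s.reg 0 = k
  edges : s.reg 3 = m
  size : s.reg 4 = n
  numQuery : s.reg 5 = Q.card
  first : s.reg 6 = q0
  id : ∀ v w, P0.Adj v w → s.mem 8 (v * n + w) = N.id v w
  lo : ∀ e < m, s.mem 0 e = N.lo e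
  hi : ∀ e < m, s.mem 1 e = N.hi e
  deg : ∀ v ∈ V0, s.mem 13 v = (nb n inp k v).card

/-- The program leaves the fixed registers and arrays alone. -/
def Com.fixes (c : Com) : Bool :=
  !(c.wr 0 || c.wr 3 || c.wr 4 || c.wr 5 || c.wr 6 || c.wa 0 || c.wa 1 || c.wa 8 || c.wa 13)

theorem Ready.same {P0 : SimpleGraph (Fin n)} {N : Numbering P0 m} {s s' : State} {c : Com}
    (hR : Ready Q V0 inp k q0 N s) (hs : Same c s s') (h : c.fixes = true) :
    Ready Q V0 inp k q0 N s' := by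
  simp only [Com.fixes, Bool.not_eq_true', Bool.or_eq_false_iff] at h
  obtain ⟨⟨⟨⟨⟨⟨⟨⟨h0, h3⟩, h4⟩, h5⟩, h6⟩, a0⟩, a1⟩, a8⟩, a13⟩ := h
  refine ⟨?_, ?_, ?_, ?_, ?_, ?_, ?_, ?_, ?_⟩
  · exact (hs.1 0 h0).trans hR.level
  · exact (hs.1 3 h3).trans hR.edges
  · exact (hs.1 4 h4).trans hR.size
  · exact (hs.1 5 h5).trans hR.numQuery
  · exact (hs.1 6 h6).trans hR.first
  · rw [hs.2 8 a8]; exact hR.id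
  · rw [hs.2 0 a0]; exact hR.lo
  · rw [hs.2 1 a1]; exact hR.hi
  · rw [hs.2 13 a13]; exact hR.deg

theorem Ready.setReg {P0 : SimpleGraph (Fin n)} {N : Numbering P0 m} {s : State}
    (hR : Ready Q V0 inp k q0 N s) {x y : ℕ} (hx : 7 ≤ x) :
    Ready Q V0 inp k q0 N (s.setReg x y) := by
  obtain ⟨h0, h3, h4, h5, h6, a8, a0, a1, a13⟩ := hR
  constructor
  · rwa [State.reg_setReg, if_neg (by omega)]
  · rwa [State.reg_setReg, if_neg (by omega)]
  · rwa [State.reg_setReg, if_neg (by omega)]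
  · rwa [State.reg_setReg, if_neg (by omega)]
  · rwa [State.reg_setReg, if_neg (by omega)]
  · exact a8
  · exact a0
  · exact a1
  · exact a13

/-- Run `c` if the vertex in register 13 completes a present triangle; registers 19 and 20 hold the
numbers of the two other edges. -/
def triBody (c : Com) : Com :=
  block [.input 17 .edgeTruss (.reg 16) (.reg 13),
    .ite (.reg 17) (.reg 0) .skip
      (block [.load 19 8 (.add (.mul (.reg 10) (.reg 4)) (.reg 13)), .load 17 9 (.reg 19),
        .load 20 8 (.add (.mul (.reg 16) (.reg 4)) (.reg 13)), .load 18 9 (.reg 20),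
        .ite (.reg 17) (.lit 2) (.ite (.reg 18) (.lit 2) c .skip) .skip])]

/-- Put the end of smaller degree of the edge in register 15 into register 10, the other end into
register 16. -/
def triInit : Com :=
  block [.load 10 0 (.reg 15), .load 16 1 (.reg 15), .load 17 13 (.reg 10), .load 18 13 (.reg 16),
    .ite (.reg 18) (.reg 17)
      (block [.assign 17 (.reg 10), .assign 10 (.reg 16), .assign 16 (.reg 17)]) .skip]

/-- Run `c` for all present triangles that contain the edge in register 15. -/
def tri (c : Com) : Com := .seq triInit (scan (triBody c))

variable (inp k) in
/-- The smaller degree of the ends of an edge, plus one. -/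
def weight {P0 : SimpleGraph (Fin n)} (N : Numbering P0 m) (e : ℕ) : ℕ :=
  min (nb n inp k (N.lo e)).card (nb n inp k (N.hi e)).card + 1

variable (S : Setting G Q inp W Z V0 k m q0 qu) {N : Numbering (core G Q q0) m}

include S

theorem triInit_spec {s : State} {e : ℕ} (he : e < m) (hR : Ready Q V0 inp k q0 N s)
    (h15 : s.reg 15 = e) :
    WP inp W Z triInit s 40 fun s' => ∃ a b, N.Ends e a b ∧
      (nb n inp k a).card = min (nb n inp k (N.lo e)).card (nb n inp k (N.hi e)).card ∧
      s'.reg 10 = a ∧ s'.reg 16 = b ∧ ∃ y z, s' = ((((s.setReg 10 a).setReg 16 b).setReg 17 y).setReg 18 z) := by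
  have hW := S.word'
  have hm2 := S.zone.m_le
  have hadj := N.adj e he
  obtain ⟨hV1, hV2⟩ := S.core_mem hadj
  have d1 := hR.deg _ hV1
  have d2 := hR.deg _ hV2
  have l1 : (nb n inp k (N.lo e)).card ≤ n := by simpa using Finset.card_le_univ (nb n inp k (N.lo e))
  have l2 : (nb n inp k (N.hi e)).card ≤ n := by simpa using Finset.card_le_univ (nb n inp k (N.hi e))
  have z0 := S.zone.idx 0 (by omega) e (by omega)
  have z1 := S.zone.idx 1 (by omega) e (by omega)
  have z2 := S.zone.vtx 13 (by omega) _ hV1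
  have z3 := S.zone.vtx 13 (by omega) _ hV2
  have e0 := hR.lo e he
  have e1 := hR.hi e he
  have b1 := (N.lo e).2
  have b2 := (N.hi e).2
  refine WP.code (by simp [triInit]) fun R hR => ?_
  simp [triInit, h15, e0, e1, d1, d2, z0, z1, z2, z3]
  and_intros <;> try omega
  · intro hlt
    refine ⟨by omega, by omega, by omega, hR _ ⟨N.hi e, N.lo e, Or.inr ⟨rfl, rfl⟩, by omega, by simp, by simp,
      N.lo e, (nb n inp k (N.hi e)).card, ?_⟩⟩
    refine congrArg₂ State.mk (funext fun x => ?_) rfl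
    simp only [State.setReg, Function.update_apply]
    split_ifs <;> first | rfl | omega
  · intro hle
    refine hR _ ⟨N.lo e, N.hi e, Or.inl ⟨rfl, rfl⟩, by omega, by simp, by simp, _, _, rfl⟩

/-- The scan runs over all neighbours of the end `a` of smaller degree; the hash table and two
status lookups decide which of them are tips. The scan invariant is therefore stated for `X ∩ N.tips
p e`, which other neighbours leave unchanged. The program `c` may change statuses as long as `p`
keeps describing which of them are below `2`. -/
theorem tri_spec {c : Com} {s : State} {e K : ℕ} {p : ℕ → Prop} (he : e < m)
    (hR : Ready Q V0 inp k q0 N s) (h15 : s.reg 15 = e) (Inv : Finset (Fin n) → State → Prop)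
    (hc : c.fixes = true) (hc10 : c.wr 10 = false) (hc11 : c.wr 11 = false)
    (hc12 : c.wr 12 = false) (hc15 : c.wr 15 = false) (hc16 : c.wr 16 = false)
    (hp : ∀ X s1, Inv X s1 → ∀ f < m, s1.mem 9 f ≤ 2 ∧ (s1.mem 9 f < 2 ↔ p f))
    (hinv : ∀ X s1 x y, 10 ≤ x → x ≤ 20 → x ≠ 15 → Inv X s1 → Inv X (s1.setReg x y))
    (h0 : Inv ∅ s)
    (hstep : ∀ a b X w s1, N.Ends e a b → X ⊆ N.tips p e → w ∉ X → w ∈ N.tips p e →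
      Ready Q V0 inp k q0 N s1 → s1.reg 15 = e → s1.reg 19 = N.id a w → s1.reg 20 = N.id b w →
      Inv X s1 → WP inp W Z c s1 K (Inv (insert w X))) :
    WP inp W Z (tri c) s
      ((K + 80) * weight inp k N e)
      (Inv (N.tips p e)) := by
  have hW := S.word'
  obtain ⟨hk1, hk2, -⟩ := S.vertexTruss
  have hk := S.two_le_level
  have hm2 := S.zone.m_le
  refine WP.seq' (triInit_spec S he hR h15)
    (N2 := (K + 60 + 20) * min (nb n inp k (N.lo e)).card (nb n inp k (N.hi e)).card + 30) ?_ ?_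
  swap
  · rw [weight, mul_add, mul_one]
    simp only [show K + 60 + 20 = K + 80 by omega]
    omega
  rintro s1 hs1 ⟨a, b, hab, hcard, h10, h16, y, z, hs⟩
  rw [← hcard]
  have hfx := hc
  simp only [Com.fixes, Bool.not_eq_true', Bool.or_eq_false_iff] at hfx
  obtain ⟨⟨⟨⟨⟨⟨⟨⟨f0, f3⟩, f4⟩, f5⟩, f6⟩, g0⟩, g1⟩, g8⟩, g13⟩ := hfx
  have hadj := hab.adj he
  have haV := (S.core_mem hadj).1
  have hbV := (S.core_mem hadj).2
  have hR1 : Ready Q V0 inp k q0 N s1 := hR.same hs1 rfl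
  have hscanfix : (scan (triBody c)).fixes = true := by
    simp [Com.fixes, scan, triBody, Com.wr, Com.wa, f0, f3, f4, f5, f6, g0, g1, g8, g13]
  have hsub : N.tips p e ⊆ nb n inp k a := by
    intro w hw
    exact ((S.core_adj a w).1 (hab.mem_tips.1 hw).1.1).2
  have hfin : nb n inp k a ∩ N.tips p e = N.tips p e := Finset.inter_eq_right.2 hsub
  refine (WP.scan (Z := Z) S.index (by omega) (K := K + 60) (l := k) (v := a)
    (fun X s2 => Inv (X ∩ N.tips p e) s2) (by omega) (by omega) hR1.level h10
    (by simp [triBody, Com.wr, f0]) (by simp [triBody, Com.wr, hc10])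
    (by simp [triBody, Com.wr, hc11]) (by simp [triBody, Com.wr, hc12]) ?_ ?_ ?_).mono le_rfl ?_
  · intro X s2 x y' hx hx' h
    exact hinv _ _ _ _ (by omega) (by omega) (by omega) h
  · rw [Finset.empty_inter, hs]
    exact hinv _ _ _ _ (by omega) (by omega) (by omega) <| hinv _ _ _ _ (by omega) (by omega) (by omega) <|
      hinv _ _ _ _ (by omega) (by omega) (by omega) <| hinv _ _ _ _ (by omega) (by omega) (by omega) h0
  · intro X w s2 hs2 hX hwX hw h13 hI
    have hR2 := hR1.same hs2 hscanfix
    have e10 : s2.reg 10 = a :=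
      (hs2.1 10 (by simp [scan, triBody, Com.wr, hc10])).trans h10
    have e16 : s2.reg 16 = b :=
      (hs2.1 16 (by simp [scan, triBody, Com.wr, hc16])).trans h16
    have e15 : s2.reg 15 = e :=
      (hs2.1 15 (by simp [scan, triBody, Com.wr, hc15])).trans ((hs1.1 15 rfl).trans h15)
    have haw : (core G Q q0).Adj a w := (S.core_adj a w).2 ⟨haV, hw⟩
    have hp1 := pair_lt a w
    have hp2 := pair_lt b w
    have hwlt := w.2
    have halt := a.2
    have hblt := b.2
    have hτ := edgeTruss_le S.index b w
    have z8 := S.zone.dart 8 (by omega) a haV w hw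
    have i8 := hR2.id a w haw
    have hl1 := N.id_lt a w haw
    have z9 := S.zone.idx 9 (by omega) (N.id a w) (by omega)
    obtain ⟨st1, st2⟩ := hp _ _ hI _ hl1
    have e4 := hR2.size
    have e0 := hR2.level
    refine WP.comp (N1 := 3) (N2 := K + 55) (WP.straight ?_ (by simp)) (by omega)
    simp only [vc, Expr.Fits, Expr.val, e16, h13]
    refine ⟨by omega, by omega, by omega, ?_⟩
    refine WP.comp (N1 := K + 50) (N2 := 1) ?_ (by omega)
    suffices hmain : WP inp W Z (.ite (.reg 17) (.reg 0) .skip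
      (block [.load 19 8 (.add (.mul (.reg 10) (.reg 4)) (.reg 13)), .load 17 9 (.reg 19),
        .load 20 8 (.add (.mul (.reg 16) (.reg 4)) (.reg 13)), .load 18 9 (.reg 20),
        .ite (.reg 17) (.lit 2) (.ite (.reg 18) (.lit 2) c .skip) .skip]))
        (s2.setReg 17 (inp .edgeTruss b w)) (K + 50) (fun s' => Inv (insert w X ∩ N.tips p e) s') from
      hmain.mono le_rfl fun s' _ h => WP.done h le_rfl
    have hskip : w ∉ N.tips p e → insert w X ∩ N.tips p e = X ∩ N.tips p e := fun h =>
      Finset.insert_inter_of_notMem h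
    refine WP.branch (M := K + 47) ?_ ?_ (fun hlt => ?_) (fun hge => ?_) (by simp; omega)
    · simp; omega
    · simp [e0]; omega
    · simp [e0] at hlt
      refine WP.done ?_ (by omega)
      rw [hskip]
      · exact hinv _ _ _ _ (by omega) (by omega) (by omega) hI
      · intro h
        have := ((S.core_adj b w).1 (hab.mem_tips.1 h).2.1).2
        rw [mem_nb] at this
        omega
    simp [e0] at hge
    have hwb : w ∈ nb n inp k b := by simpa using hge
    have hbw : (core G Q q0).Adj b w := (S.core_adj b w).2 ⟨hbV, hwb⟩
    have z8' := S.zone.dart 8 (by omega) b hbV w hwb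
    have i8' := hR2.id b w hbw
    have hl2 := N.id_lt b w hbw
    have z9' := S.zone.idx 9 (by omega) (N.id b w) (by omega)
    obtain ⟨st3, st4⟩ := hp _ _ hI _ hl2
    have hwT : w ∈ N.tips p e ↔ s2.mem 9 (N.id a w) < 2 ∧ s2.mem 9 (N.id b w) < 2 := by
      rw [hab.mem_tips, st2, st4]
      exact ⟨fun h => ⟨h.1.2, h.2.2⟩, fun h => ⟨⟨haw, h.1⟩, ⟨hbw, h.2⟩⟩⟩
    set s3 := ((((s2.setReg 17 (inp .edgeTruss b w)).setReg 19 (N.id a w)).setReg 17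
      (s2.mem 9 (N.id a w))).setReg 20 (N.id b w)).setReg 18 (s2.mem 9 (N.id b w)) with hs3
    have hI3 : Inv (X ∩ N.tips p e) s3 := by
      refine hinv _ _ _ _ (by omega) (by omega) (by omega) <| hinv _ _ _ _ (by omega) (by omega) (by omega) <|
        hinv _ _ _ _ (by omega) (by omega) (by omega) <|
        hinv _ _ _ _ (by omega) (by omega) (by omega) <| hinv _ _ _ _ (by omega) (by omega) (by omega) hI
    suffices hlast : WP inp W Z (.ite (.reg 17) (.lit 2) (.ite (.reg 18) (.lit 2) c .skip) .skip) s3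
        (K + 10) (fun s' => Inv (insert w X ∩ N.tips p e) s') by
      refine WP.comp (N1 := 6) (N2 := K + 41) (WP.straight ?_ (by simp)) (by omega)
      simp [e10, e4, h13, i8]
      refine ⟨by omega, by omega, z8, ?_⟩
      refine WP.comp (N1 := 2) (N2 := K + 39) (WP.straight ?_ (by simp)) (by omega)
      simp [e10, e4, h13, i8]
      refine ⟨by omega, by omega, z9, ?_⟩
      refine WP.comp (N1 := 6) (N2 := K + 33) (WP.straight ?_ (by simp)) (by omega)
      simp [e16, e4, h13, i8']
      refine ⟨by omega, by omega, z8', ?_⟩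
      refine WP.comp (N1 := 2) (N2 := K + 31) (WP.straight ?_ (by simp)) (by omega)
      simp [e16, e4, h13, i8']
      refine ⟨by omega, by omega, z9', ?_⟩
      refine WP.comp (N1 := K + 10) (N2 := 1) ?_ (by omega)
      exact hlast.mono le_rfl fun s' _ h => WP.done h le_rfl
    refine WP.branch (M := K + 7) ?_ ?_ (fun hlt => ?_) (fun hge => ?_) (by simp only [Expr.cost]; omega)
    · simp [hs3]; omega
    · simp; omega
    · refine WP.branch (M := K + 3) ?_ ?_ (fun hlt' => ?_) (fun hge => ?_) (by simp only [Expr.cost]; omega)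
      · simp [hs3]; omega
      · simp; omega
      · simp [hs3] at hlt hlt'
        have hwT' := hwT.2 ⟨by omega, by omega⟩
        rw [Finset.insert_inter_of_mem hwT']
        refine (hstep a b _ w s3 hab Finset.inter_subset_right
          (fun h => hwX (Finset.mem_inter.1 h).1) hwT' ?_ (by simp [hs3, e15]) (by simp [hs3])
          (by simp [hs3]) hI3).mono (by omega) fun _ _ h => h
        exact ((((hR2.setReg (by omega)).setReg (by omega)).setReg (by omega)).setReg
          (by omega)).setReg (by omega)
      · simp [hs3] at hge
        refine WP.done ?_ (by omega)
        rw [hskip]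
        · exact hI3
        · intro h
          have := (hwT.1 h).2
          omega
    · simp [hs3] at hge
      refine WP.done ?_ (by omega)
      rw [hskip]
      · exact hI3
      · intro h
        have := (hwT.1 h).1
        omega
  · intro s' _ h
    rw [hfin] at h
    exact h

/-- The smaller degrees sum to at most `ρ` times the degree sum `2m`, and each edge adds one. -/
theorem sum_weight_le :
    ∑ e ∈ Finset.range m, weight inp k N e ≤
      (2 * arboricity (ofGraph (core G Q q0) (core_le q0)) + 1) * m := by
  classical
  have h1 := forestCover_arboricity (ofGraph (core G Q q0) (core_le q0))
  rw [ofGraph_spanningCoe] at h1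
  have h2 := N.sum_min_le h1 fun v => if v ∈ V0 then (nb n inp k v).card else 0
  rw [Finset.sum_ite_mem, Finset.univ_inter, S.sum_deg] at h2
  have h3 : ∀ e ∈ Finset.range m, weight inp k N e =
      min (if N.lo e ∈ V0 then (nb n inp k (N.lo e)).card else 0)
        (if N.hi e ∈ V0 then (nb n inp k (N.hi e)).card else 0) + 1 := by
    intro e he
    obtain ⟨a, b⟩ := S.core_mem (N.adj e (Finset.mem_range.1 he))
    rw [if_pos a, if_pos b, weight]
  rw [Finset.sum_congr rfl h3, Finset.sum_add_distrib]
  simp only [Finset.sum_const, Finset.card_range, smul_eq_mul, mul_one]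
  calc _ ≤ arboricity (ofGraph (core G Q q0) (core_le q0)) * (2 * m) + m := Nat.add_le_add_right h2 m
    _ = _ := by ring

omit S

/-- Count a triangle of the edge in register 15. -/
def incSup : Com := block [.load 17 10 (.reg 15), .store 10 (.reg 15) (.add (.reg 17) (.lit 1))]

/-- Compute the supports of all edges. -/
def initSup : Com := forUp 21 3 (.seq (.assign 15 (.reg 21)) (tri incSup))

include S

theorem supp_le {p : ℕ → Prop} {e : ℕ} : N.supp p e ≤ n := by
  rw [← N.card_tips]
  simpa using Finset.card_le_univ (N.tips p e)

theorem initSup_spec {s : State} (hR : Ready Q V0 inp k q0 N s) (h9 : ∀ e < m, s.mem 9 e = 0)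
    (h10 : ∀ e < m, s.mem 10 e = 0) :
    WP inp W Z initSup s
      (110 * ((2 * arboricity (ofGraph (core G Q q0) (core_le q0)) + 1) * m) + 6) fun s' =>
      ∀ e < m, s'.mem 10 e = N.supp (fun _ => True) e := by
  have hW := S.word'
  have hm2 := S.zone.m_le
  refine (WP.counting (Z := Z) (m := m) (fun j s1 =>
      (∀ e < j, s1.mem 10 e = N.supp (fun _ => True) e) ∧ ∀ e < m, j ≤ e → s1.mem 10 e = 0)
    (fun j => 90 * weight inp k N j + 2) (by decide) rfl rfl hR.edges (by omega) (by omega)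
    ⟨by simp, by simpa using h10⟩ ?_).mono ?_ ?_
  · rintro j hj s1 hs1 h21 ⟨i1, i2⟩
    refine WP.seq' (N1 := 2) (R := fun s2 => s2 = s1.setReg 15 j) (WP.straight ?_ (by simp)) ?_
      (by omega : 2 + (10 + 80) * weight inp k N j ≤ _)
    · simp [h21]; omega
    rintro s2 hs2 rfl
    have hR1 : Ready Q V0 inp k q0 N (s1.setReg 15 j) := (hR.same hs1 rfl).setReg (by omega)
    have e9 : ∀ e < m, s1.mem 9 e = 0 := by rw [hs1.2 9 rfl]; exact h9
    have z10 := S.zone.idx 10 (by omega) j (by omega)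
    refine (tri_spec S (p := fun _ => True) hj hR1 (by simp) (fun X s3 => (∀ e < m, s3.mem 9 e = 0) ∧
      (∀ e < j, s3.mem 10 e = N.supp (fun _ => True) e) ∧ s3.mem 10 j = X.card ∧
      ∀ e < m, j < e → s3.mem 10 e = 0) rfl rfl rfl rfl rfl rfl ?_ ?_ ?_ ?_).mono le_rfl ?_
    · rintro X s3 ⟨a1, -⟩ f hf
      simp [a1 f hf]
    · intro X s3 x y _ _ _ h
      exact h
    · exact ⟨e9, i1, by simpa using i2 j hj le_rfl, fun e he hje => i2 e he hje.le⟩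
    · rintro a b X w s3 hab hX hwX hw hR3 h15 - - ⟨a1, a2, a3, a4⟩
      have hXn : X.card ≤ n := by simpa using Finset.card_le_univ X
      refine WP.code (by simp [incSup]) fun R hR => ?_
      simp [incSup, h15, a3, z10]
      and_intros <;> try omega
      refine hR _ ⟨by simpa using a1, ?_, ?_, ?_⟩
      · intro e he
        simp [Function.update_apply, he.ne, a2 e he]
      · simp [Finset.card_insert_of_notMem hwX]
      · intro e he hje
        simp [Function.update_apply, hje.ne', a4 e he hje]
    · rintro s3 - ⟨a1, a2, a3, a4⟩
      refine ⟨fun e he => ?_, fun e he hje => ?_⟩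
      · rcases Nat.lt_succ_iff_lt_or_eq.1 he with he | rfl
        · simpa using a2 e he
        · simpa [N.card_tips] using a3
      · simpa using a4 e he hje
  · have h1 := sum_weight_le S (N := N)
    have h2 : ∑ j ∈ Finset.range m, (90 * weight inp k N j + 2 + 8) ≤
        ∑ j ∈ Finset.range m, 110 * weight inp k N j := by
      refine Finset.sum_le_sum fun j _ => ?_
      have : 1 ≤ weight inp k N j := Nat.le_add_left _ _
      omega
    rw [← Finset.mul_sum] at h2
    omega
  · rintro s' - ⟨i1, -⟩
    exact i1

end Triangles


/-! ## Peeling off edges of small support -/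

section Peel

open SimpleGraph

variable {n : ℕ} {G : SimpleGraph (Fin n)} {Q : Finset (Fin n)} {inp : Input} {W : ℕ}
  {Z : Set (ℕ × ℕ)} {V0 : Finset (Fin n)} {k m : ℕ} {q0 : Fin n} {qu : ℕ → Fin n}
  {P0 H : SimpleGraph (Fin n)}

/-- The edges in the list `L` are on the stack; they and those that satisfy `x` have status 1. -/
structure Stacked (m : ℕ) (L : List ℕ) (x : ℕ → Prop) (d : ℕ) (mem : ℕ → ℕ → ℕ) : Prop where
  len : d = L.length
  get : ∀ i f, L[i]? = some f → mem 11 i = f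
  nodup : L.Nodup
  lt : ∀ f ∈ L, f < m
  stat_le : ∀ f < m, mem 9 f ≤ 2
  stat : ∀ f < m, mem 9 f = 1 ↔ f ∈ L ∨ x f
  disj : ∀ f ∈ L, ¬ x f

theorem length_le_of_lt {L : List ℕ} (h : L.Nodup) (hL : ∀ f ∈ L, f < m) : L.length ≤ m := by
  rw [← List.toFinset_card_of_nodup h]
  simpa using Finset.card_le_card (s := L.toFinset) (t := Finset.range m) fun f hf => by
    simpa using hL f (by simpa using hf)

theorem Stacked.push {L : List ℕ} {x : ℕ → Prop} {d f : ℕ} {mem mem' : ℕ → ℕ → ℕ}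
    (h : Stacked m L x d mem) (hf : f < m) (h0 : mem 9 f = 0)
    (hx : ¬ x f)
    (h9 : mem' 9 = Function.update (mem 9) f 1) (h11 : mem' 11 = Function.update (mem 11) d f) :
    Stacked m (L ++ [f]) x (d + 1) mem' where
  len := by simp [h.len]
  get := by
    intro i g hi
    rw [h11, Function.update_apply]
    rw [List.getElem?_append] at hi
    have := h.len
    split_ifs at hi with hlt
    · rw [if_neg (by omega)]
      exact h.get i g hi
    · rw [List.getElem?_singleton] at hi
      split_ifs at hi with h0'
      simp only [Option.some.injEq] at hi
      rw [if_pos (by omega), hi]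
  nodup := List.nodup_append.2 ⟨h.nodup, by simp, fun a ha b hb e => by
    rw [List.mem_singleton] at hb
    subst hb
    have := (h.stat _ hf).2 (Or.inl (e ▸ ha))
    omega⟩
  lt := by
    intro g hg
    rcases List.mem_append.1 hg with hg | hg
    · exact h.lt g hg
    · rw [List.mem_singleton] at hg
      omega
  stat_le := by
    intro g hg
    rw [h9, Function.update_apply]
    split_ifs
    · omega
    · exact h.stat_le g hg
  stat := by
    intro g hg
    rw [h9, Function.update_apply, List.mem_append, List.mem_singleton]
    split_ifs with hgf
    · simp [hgf]
    · rw [h.stat g hg]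
      simp [hgf]
  disj := by
    intro g hg
    rcases List.mem_append.1 hg with hg | hg
    · exact h.disj g hg
    · rw [List.mem_singleton] at hg
      exact hg ▸ hx

/-- The `k`-trusses in `H` survive. -/
def Keeps (N : Numbering P0 m) (k : ℕ) (H : SimpleGraph (Fin n)) (mem : ℕ → ℕ → ℕ) : Prop :=
  ∀ K ≤ H, (∀ x y, K.Adj x y → k ≤ common K x y + 2) →
    ∀ x y, K.Adj x y → P0.Adj x y ∧ mem 9 (N.id x y) = 0

/-- The invariant while the triangles of `e` are being removed; `c f` triangles have been
discounted from the support of `f`. -/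
structure Peeling (N : Numbering P0 m) (k : ℕ) (H : SimpleGraph (Fin n)) (p : ℕ → Prop) (e : ℕ)
    (c : ℕ → ℕ) (L : List ℕ) (d : ℕ) (mem : ℕ → ℕ → ℕ) : Prop where
  stacked : Stacked m L (· = e) d mem
  present : ∀ f < m, mem 9 f < 2 ↔ p f
  supp : ∀ f < m, p f → f ≠ e → mem 10 f + c f = N.supp p f
  low : ∀ f < m, mem 9 f = 0 → k ≤ mem 10 f + 2
  keep : Keeps N k H mem
  del : ∀ f < m, mem 9 f = 0 → H.Adj (N.lo f) (N.hi f)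

/-- The invariant between the removals of two edges. -/
structure Peeled (N : Numbering P0 m) (k : ℕ) (H : SimpleGraph (Fin n)) (L : List ℕ) (d : ℕ)
    (mem : ℕ → ℕ → ℕ) : Prop where
  stacked : Stacked m L (fun _ => False) d mem
  supp : ∀ f < m, mem 9 f < 2 → mem 10 f = N.supp (fun g => mem 9 g < 2) f
  low : ∀ f < m, mem 9 f = 0 → k ≤ mem 10 f + 2
  keep : Keeps N k H mem
  del : ∀ f < m, mem 9 f = 0 → H.Adj (N.lo f) (N.hi f)

/-- Put the edge in register `x` on the stack. -/
def push (x : ℕ) : Com :=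
  block [.store 9 (.reg x) (.lit 1), .store 11 (.reg 28) (.reg x), .assign 28 (.add (.reg 28) (.lit 1))]

/-- Discount a triangle of the edge in register `x`. -/
def dec (x : ℕ) : Com :=
  block [.load 17 10 (.reg x), .assign 17 (.sub (.reg 17) (.lit 1)), .store 10 (.reg x) (.reg 17),
    .ite (.add (.reg 17) (.lit 2)) (.reg 0)
      (block [.load 18 9 (.reg x), .ite (.reg 18) (.lit 1) (push x) .skip]) .skip]

/-- Remove the edges on the stack. -/
def cascade : Com :=
  .loop (.lit 0) (.reg 28) (block [.assign 28 (.sub (.reg 28) (.lit 1)), .load 15 11 (.reg 28),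
    tri (.seq (dec 19) (dec 20)), .store 9 (.reg 15) (.lit 2)])

variable (S : Setting G Q inp W Z V0 k m q0 qu) {N : Numbering (core G Q q0) m}

include S

theorem Setting.level_le : k ≤ n + 2 := by
  obtain ⟨h1, h2, -⟩ := S.vertexTruss
  omega

/-- At most `N.hits e f (N.tips p e)` triangles are discounted, so the counter of `f` never falls
below its support without `e`. Once it drops under `k - 2`, no `k`-truss without `e` can contain
`f`, and stacking `f` is safe. Stacked edges still count as present, so every triangle is discounted
exactly once, when the first of its edges is removed. -/
theorem dec_spec {x f e : ℕ} {s : State} {p : ℕ → Prop} {c : ℕ → ℕ} {L : List ℕ} (hx : 19 ≤ x)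
    (hx' : x ≤ 20) (hR : Ready Q V0 inp k q0 N s) (hxf : s.reg x = f) (hf : f < m) (he : e < m)
    (hpe : p e) (hpf : p f) (hne : f ≠ e) (hc : c f + 1 ≤ N.hits e f (N.tips p e))
    (h : Peeling N k H p e c L (s.reg 28) s.mem) :
    WP inp W Z (dec x) s 50 fun s' => ∃ L',
      Peeling N k H p e (Function.update c f (c f + 1)) L' (s'.reg 28) s'.mem := by
  have hW := S.word'
  have hm2 := S.zone.m_le
  have hk := S.level_le
  have z9 := S.zone.idx 9 (by omega) f (by omega)
  have z10 := S.zone.idx 10 (by omega) f (by omega)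
  have hs1 := h.supp f hf hpf hne
  have hs2 := N.supp_remove he hf hpe hpf hne
  have hs3 : N.supp p f ≤ n := supp_le S
  have hst := h.stacked.stat_le f hf
  have e0 := hR.level
  have hlen := h.stacked.len
  have x17 : x ≠ 17 := by omega
  have x18 : x ≠ 18 := by omega
  have x28 : x ≠ 28 := by omega
  have hpre : ∀ g, s.mem 9 g < 1 → s.mem 9 g = 0 := fun g hg => by omega
  have hsupp : ∀ g < m, p g → g ≠ e → Function.update (s.mem 10) f (s.mem 10 f - 1) g +
      Function.update c f (c f + 1) g = N.supp p g := by
    intro g hg hpg hge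
    simp only [Function.update_apply]
    split_ifs with hgf
    · subst hgf
      omega
    · exact h.supp g hg hpg hge
  refine WP.code (by simp [dec, push]) fun R hR => ?_
  by_cases hlow : s.mem 10 f - 1 + 2 < k
  · by_cases h0 : s.mem 9 f = 0
    · have hfL : f ∉ L := fun hfL => by
        have := (h.stacked.stat f hf).2 (Or.inl hfL)
        omega
      have hL : L.length + 1 ≤ m := by
        have := length_le_of_lt (m := m) (L := f :: L) (List.nodup_cons.2 ⟨hfL, h.stacked.nodup⟩)
          fun g hg => by
            rcases List.mem_cons.1 hg with rfl | hg
            · exact hf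
            · exact h.stacked.lt g hg
        simpa using this
      have z11 := S.zone.idx 11 (by omega) (s.reg 28) (by omega)
      simp [dec, push, hxf, z9, z10, z11, x17, x18, x28, e0, hlow, h0]
      and_intros <;> try omega
      refine hR _ ⟨L ++ [f], ?_, ?_, ?_, ?_, ?_, ?_⟩
      · simp only [State.reg_setReg, if_true, State.mem_setReg]
        exact h.stacked.push hf h0 hne (by simp) (by simp)
      · intro g hg
        simp only [State.mem_setMem, State.mem_setReg, Nat.reduceEqDiff, if_true, if_false,
          Function.update_apply]
        split_ifs with hgf
        · subst hgf
          simp [hpf]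
        · exact h.present g hg
      · simpa using hsupp
      · intro g hg hg0
        simp only [State.mem_setMem, State.mem_setReg, Nat.reduceEqDiff, if_true, if_false,
          Function.update_apply] at hg0 ⊢
        split_ifs at hg0 ⊢ with hgf
        exact h.low g hg hg0
      · intro K hK hKt x y hxy
        obtain ⟨a1, a2⟩ := h.keep K hK hKt x y hxy
        refine ⟨a1, ?_⟩
        simp only [State.mem_setMem, State.mem_setReg, Nat.reduceEqDiff, if_true, if_false,
          Function.update_apply]
        split_ifs with hgf
        · exfalso
          have b1 := hKt x y hxy
          -- The edges of `K` have status `0` whereas `e` has status `1`; so supports in `K` are at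
          -- most those without `e`.
          have b2 : K ≤ N.graph fun g => p g ∧ g ≠ e := by
            intro x' y' hxy'
            obtain ⟨c1, c2⟩ := h.keep K hK hKt x' y' hxy'
            refine ⟨c1, (h.present _ (N.id_lt _ _ c1)).1 (by omega), fun c3 => ?_⟩
            have := (h.stacked.stat e he).2 (Or.inr rfl)
            rw [c3] at c2
            omega
          have b3 := common_mono b2 x y
          rw [(N.ends_id a1).common, hgf] at b3
          omega
        · exact a2
      · intro g hg hg0
        simp only [State.mem_setMem, State.mem_setReg, Nat.reduceEqDiff, if_true, if_false,
          Function.update_apply] at hg0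
        split_ifs at hg0 with hgf
        exact h.del g hg hg0
    · have h1 : ¬ s.mem 9 f < 1 := by omega
      simp [dec, push, hxf, z9, z10, x17, x18, x28, e0, hlow, h0]
      and_intros <;> try omega
      refine hR _ ⟨L, ?_, ?_, ?_, ?_, ?_, ?_⟩
      · obtain ⟨b1, b2, b3, b4, b5, b6, b7⟩ := h.stacked
        exact ⟨by simpa using b1, by simpa using b2, b3, b4, by simpa using b5, by simpa using b6, b7⟩
      · simpa using h.present
      · simpa using hsupp
      · intro g hg hg0
        simp at hg0
        have hgf : g ≠ f := by rintro rfl; exact h0 hg0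
        simpa [hgf] using h.low g hg hg0
      · exact fun K hK hKt x y hxy => by simpa using h.keep K hK hKt x y hxy
      · simpa using h.del
  · simp [dec, push, hxf, z9, z10, x17, x18, x28, e0, hlow]
    and_intros <;> try omega
    refine hR _ ⟨L, ?_, ?_, ?_, ?_, ?_, ?_⟩
    · obtain ⟨b1, b2, b3, b4, b5, b6, b7⟩ := h.stacked
      exact ⟨by simpa using b1, by simpa using b2, b3, b4, by simpa using b5, by simpa using b6, b7⟩
    · simpa using h.present
    · simpa using hsupp
    · intro g hg hg0
      simp [Function.update_apply] at hg0 ⊢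
      split_ifs with hgf
      · omega
      · exact h.low g hg hg0
    · exact fun K hK hKt x y hxy => by simpa using h.keep K hK hKt x y hxy
    · simpa using h.del

omit S

variable (inp k) in
/-- The potential: the weights of the present edges. -/
def potential (N : Numbering P0 m) (c : ℕ) (mem : ℕ → ℕ → ℕ) : ℕ :=
  ∑ f ∈ Finset.range m, if mem 9 f < 2 then c * weight inp k N f else 0

theorem potential_mono {N : Numbering P0 m} {c : ℕ} {mem mem' : ℕ → ℕ → ℕ}
    (h : ∀ f < m, mem' 9 f < 2 → mem 9 f < 2) :
    potential inp k N c mem' ≤ potential inp k N c mem := by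
  refine Finset.sum_le_sum fun f hf => ?_
  have := h f (Finset.mem_range.1 hf)
  split_ifs <;> simp_all

theorem potential_drop {N : Numbering P0 m} {c e : ℕ} {mem mem' : ℕ → ℕ → ℕ}
    (h : ∀ f < m, mem' 9 f < 2 → mem 9 f < 2) (he : e < m) (h1 : mem 9 e < 2)
    (h2 : ¬ mem' 9 e < 2) :
    potential inp k N c mem' + c * weight inp k N e ≤ potential inp k N c mem := by
  unfold potential
  rw [← Finset.add_sum_erase _ _ (Finset.mem_range.2 he),
    ← Finset.add_sum_erase (f := fun f => if mem 9 f < 2 then c * weight inp k N f else 0) _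
      (Finset.mem_range.2 he), if_neg h2, if_pos h1]
  have : ∑ f ∈ (Finset.range m).erase e, (if mem' 9 f < 2 then c * weight inp k N f else 0) ≤
      ∑ f ∈ (Finset.range m).erase e, (if mem 9 f < 2 then c * weight inp k N f else 0) := by
    refine Finset.sum_le_sum fun f hf => ?_
    have := h f (Finset.mem_range.1 (Finset.mem_of_mem_erase hf))
    split_ifs <;> simp_all
  omega

include S

/-- Removing `e` releases `300` times its weight, enough for the `180` times its weight spent on its
triangles and for the overhead, since weights are at least one. Potential is never restored, so all
cascades of an execution together are paid by its initial value. -/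
theorem cascade_spec {s : State} {L : List ℕ} (hR : Ready Q V0 inp k q0 N s)
    (h : Peeled N k H L (s.reg 28) s.mem) :
    WT inp W Z cascade s fun s' T => Peeled N k H [] (s'.reg 28) s'.mem ∧
      (∀ f < m, s'.mem 9 f < 2 → s.mem 9 f < 2) ∧
      T + potential inp k N 300 s'.mem ≤ potential inp k N 300 s.mem + 3 := by
  have hW := S.word'
  have hm2 := S.zone.m_le
  have key := WT.while (inp := inp) (W := W) (Z := Z) (e := .lit 0) (f := .reg 28)
    (c := block [.assign 28 (.sub (.reg 28) (.lit 1)), .load 15 11 (.reg 28),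
      tri (.seq (dec 19) (dec 20)), .store 9 (.reg 15) (.lit 2)]) (s := s)
    (fun s1 p => ∃ L, Peeled N k H L (s1.reg 28) s1.mem ∧
      (∀ f < m, s1.mem 9 f < 2 → s.mem 9 f < 2) ∧ p = potential inp k N 300 s1.mem)
    (p := potential inp k N 300 s.mem) ⟨L, h, fun _ _ h => h, rfl⟩ ?_ ?_
  · refine WT.mono key fun s' T hs h => ?_
    obtain ⟨p', ⟨L, h1, h2, h3⟩, h4, h5⟩ := h
    simp only [Expr.cost] at h5
    simp only [Expr.val] at h4
    have hL : L = [] := List.length_eq_zero_iff.1 (by have := h1.stacked.len; omega)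
    subst hL
    exact ⟨h1, h2, by omega⟩
  · rintro s1 p hs ⟨L, h1, -⟩
    have := h1.stacked.len
    have := length_le_of_lt h1.stacked.nodup h1.stacked.lt
    simp only [Expr.Fits]
    omega
  · rintro s1 p1 hs ⟨L, h1, h2, rfl⟩ hg
    simp only [Expr.val] at hg
    have hR1 : Ready Q V0 inp k q0 N s1 := hR.same hs rfl
    have hlen := h1.stacked.len
    have hLm := length_le_of_lt h1.stacked.nodup h1.stacked.lt
    obtain ⟨L', e, rfl⟩ : ∃ L' e, L = L' ++ [e] := by
      rcases List.eq_nil_or_concat L with rfl | ⟨L', e, h⟩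
      · simp at hlen
        omega
      · exact ⟨L', e, by simpa using h⟩
    have hlen' : s1.reg 28 = L'.length + 1 := by simpa using hlen
    have hLm' : L'.length + 1 ≤ m := by simpa using hLm
    have he : e < m := h1.stacked.lt e (by simp)
    have hget : s1.mem 11 L'.length = e := h1.stacked.get _ _ (by simp)
    have hnd := List.nodup_append.1 h1.stacked.nodup
    have heL : e ∉ L' := fun h => hnd.2.2 e h e (by simp) rfl
    have hst1 : s1.mem 9 e = 1 := (h1.stacked.stat e he).2 (Or.inl (by simp))
    have z11 := S.zone.idx 11 (by omega) L'.length (by omega)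
    have z9 := S.zone.idx 9 (by omega) e (by omega)
    -- Presence is frozen while the triangles of `e` are enumerated: statuses only change from `0`
    -- to `1`, and `e` receives status `2` at the very end.
    set p : ℕ → Prop := fun g => s1.mem 9 g < 2 with hp
    set s2 := (s1.setReg 28 L'.length).setReg 15 e with hs2
    have hR2 : Ready Q V0 inp k q0 N s2 := (hR1.setReg (by omega)).setReg (by omega)
    have hpe : p e := by simp [hp, hst1]
    have hE : N.Ends e (N.lo e) (N.hi e) := Or.inl ⟨rfl, rfl⟩
    have htri : WP inp W Z (tri (.seq (dec 19) (dec 20))) s2 ((100 + 80) * weight inp k N e)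
        (fun s' => ∃ L, Peeling N k H p e (fun f => N.hits e f (N.tips p e)) L (s'.reg 28) s'.mem) := by
      refine tri_spec S (p := p) he hR2 (by simp [hs2]) (fun X s3 => ∃ L,
        Peeling N k H p e (fun f => N.hits e f X) L (s3.reg 28) s3.mem) rfl rfl rfl rfl rfl rfl ?_ ?_ ?_ ?_
      · rintro X s3 ⟨M, h3⟩ f hf
        exact ⟨h3.stacked.stat_le f hf, h3.present f hf⟩
      · rintro X s3 x y hx hx' _ ⟨M, h3⟩
        refine ⟨M, ?_⟩
        rw [State.reg_setReg, if_neg (by omega)]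
        exact h3
      · refine ⟨L', ⟨?_, ?_, hnd.1, ?_, h1.stacked.stat_le, ?_, ?_⟩, ?_, ?_, h1.low, h1.keep, h1.del⟩
        · simp [hs2]
        · intro i f hi
          refine h1.stacked.get i f ?_
          rw [List.getElem?_append_left (List.getElem?_eq_some_iff.1 hi).1]
          exact hi
        · exact fun f hf => h1.stacked.lt f (List.mem_append_left _ hf)
        · intro f hf
          have := h1.stacked.stat f hf
          simpa [hs2] using this
        · rintro f hf rfl
          exact heL hf
        · exact fun f hf => Iff.rfl
        · intro f hf hpf hne
          simp only [hs2, N.hits_empty, add_zero]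
          exact h1.supp f hf hpf
      · rintro a b X w s3 hab hX hwX hw hR3 h15 h19 h20 ⟨M, h3⟩
        obtain ⟨g1, g2⟩ := hab.mem_tips.1 hw
        have hadj := hab.adj he
        have l1 := N.id_lt _ _ g1.1
        have l2 := N.id_lt _ _ g2.1
        have ne1 : N.id a w ≠ e := by
          rw [← hab.id he, Ne, N.id_eq g1.1 hadj]
          rintro (⟨-, h⟩ | ⟨h, -⟩)
          · exact g2.1.ne h.symm
          · exact hadj.ne h
        have ne2 : N.id b w ≠ e := by
          rw [← hab.id he, Ne, N.id_eq g2.1 hadj]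
          rintro (⟨h, -⟩ | ⟨-, h⟩)
          · exact hadj.ne h.symm
          · exact g1.1.ne h.symm
        have ne3 : N.id a w ≠ N.id b w := by
          rw [Ne, N.id_eq g1.1 g2.1]
          rintro (⟨h, -⟩ | ⟨h, -⟩)
          · exact hadj.ne h
          · exact g1.1.ne h
        have hle : ∀ f, N.hits e f (insert w X) ≤ N.hits e f (N.tips p e) := fun f =>
          N.hits_mono (Finset.insert_subset hw hX)
        have hins := fun f => hab.hits_insert (f := f) hwX
        refine WP.seq' (dec_spec S (by omega) (by omega) hR3 h19 l1 he hpe g1.2 ne1 ?_ h3) ?_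
          (by omega : 50 + 50 ≤ _)
        · have := hle (N.id a w)
          rw [hins, if_pos (Or.inl rfl)] at this
          exact this
        rintro s4 hs4 ⟨M', h4⟩
        refine (dec_spec S (x := 20) (by omega) (by omega) (hR3.same hs4 rfl)
          ((hs4.1 20 rfl).trans h20) l2 he hpe g2.2 ne2 ?_ h4).mono le_rfl ?_
        · rw [Function.update_of_ne ne3.symm]
          have := hle (N.id b w)
          rw [hins, if_pos (Or.inr rfl)] at this
          exact this
        · rintro s5 - ⟨M'', h5⟩
          refine ⟨M'', ?_⟩
          -- Adding the tip `w` raises the number of hits by one exactly for the two other edges of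
          -- the triangle, which are distinct; these are the two updates just made.
          convert h5 using 1
          funext f
          rw [hins]
          simp only [Function.update_apply]
          by_cases f1 : f = N.id a w
          · subst f1
            simp [ne3]
          · by_cases f2 : f = N.id b w
            · subst f2
              simp [ne3.symm]
            · simp [f1, f2]
    have hbody : WP inp W Z (block [.assign 28 (.sub (.reg 28) (.lit 1)), .load 15 11 (.reg 28),
      tri (.seq (dec 19) (dec 20)), .store 9 (.reg 15) (.lit 2)]) s1
        (180 * weight inp k N e + 10) fun s5 => ∃ (M : List ℕ) (s4 : State),
          Peeling N k H p e (fun f => N.hits e f (N.tips p e)) M (s4.reg 28) s4.mem ∧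
          s5 = s4.setMem 9 e 2 := by
      refine WP.comp (N1 := 4) (N2 := 180 * weight inp k N e + 6) (WP.straight ?_ (by simp)) (by omega)
      simp [hlen']
      refine ⟨by omega, ?_⟩
      refine WP.comp (N1 := 2) (N2 := 180 * weight inp k N e + 4) (WP.straight ?_ (by simp)) (by omega)
      simp [hget]
      refine ⟨by omega, by omega, z11, ?_⟩
      refine WP.seq' (N2 := 4) htri ?_ (by omega)
      rintro s4 hs4 ⟨M, h4⟩
      refine WP.code (by simp) fun R hR => ?_
      have e15 : s4.reg 15 = e := (hs4.1 15 rfl).trans (by simp [hs2])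
      simp [e15, z9]
      and_intros <;> try omega
      exact hR _ ⟨M, s4, h4, rfl⟩
    refine WT.mono hbody fun s5 T _ h5 => ?_
    obtain ⟨hT, M, s4, h4, rfl⟩ := h5
    have hst4 : s4.mem 9 e = 1 := (h4.stacked.stat e he).2 (Or.inr rfl)
    have hsub : ∀ f < m, (s4.setMem 9 e 2).mem 9 f < 2 ↔ p f ∧ f ≠ e := by
      intro f hf
      simp only [State.mem_setMem, if_true, Function.update_apply]
      split_ifs with hfe
      · simp [hfe]
      · rw [h4.present f hf]
        simp [hfe]
    have hsub0 : ∀ f, (s4.setMem 9 e 2).mem 9 f = 0 → s4.mem 9 f = 0 ∧ f ≠ e := by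
      intro f h0
      simp only [State.mem_setMem, if_true, Function.update_apply] at h0
      split_ifs at h0 with hfe
      exact ⟨h0, hfe⟩
    refine ⟨_, ⟨M, ⟨?_, ?_, ?_, ?_, ?_⟩, fun f hf hlt => h2 f hf ((hsub f hf).1 hlt).1, rfl⟩, ?_⟩
    · refine ⟨h4.stacked.len, ?_, h4.stacked.nodup, h4.stacked.lt, ?_, ?_, fun _ _ h => h⟩
      · simpa using h4.stacked.get
      · intro f hf
        simp only [State.mem_setMem, if_true, Function.update_apply]
        split_ifs
        · exact le_rfl
        · exact h4.stacked.stat_le f hf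
      · intro f hf
        simp only [State.mem_setMem, if_true, Function.update_apply]
        split_ifs with hfe
        · subst hfe
          simp only [or_false]
          refine ⟨fun h => by omega, fun h => ?_⟩
          exact (h4.stacked.disj _ h rfl).elim
        · rw [h4.stacked.stat f hf]
          simp [hfe]
    · intro f hf hlt
      obtain ⟨hpf, hfe⟩ := (hsub f hf).1 hlt
      have a1 := h4.supp f hf hpf hfe
      have a2 := N.supp_remove he hf hpe hpf hfe
      rw [N.supp_congr hsub]
      simp only [State.mem_setMem, Nat.reduceEqDiff, if_false]
      omega
    · intro f hf h0
      obtain ⟨b1, b2⟩ := hsub0 f h0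
      simpa using h4.low f hf b1
    · intro K hK hKt x y hxy
      obtain ⟨b1, b2⟩ := h4.keep K hK hKt x y hxy
      refine ⟨b1, ?_⟩
      simp only [State.mem_setMem, if_true, Function.update_apply]
      split_ifs with hfe
      · rw [hfe] at b2
        omega
      · exact b2
    · intro f hf h0
      exact h4.del f hf (hsub0 f h0).1
    · have hd := potential_drop (inp := inp) (k := k) (N := N) (c := 300) (mem := s1.mem)
        (mem' := (s4.setMem 9 e 2).mem) (fun f hf hlt => ((hsub f hf).1 hlt).1) he (by omega)
        (fun h => ((hsub e he).1 h).2 rfl)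
      have : 1 ≤ weight inp k N e := Nat.le_add_left _ _
      simp only [Expr.cost]
      omega

end Peel


/-! ## Query distances and labels -/

section Distances

open SimpleGraph

variable {n : ℕ} {G : SimpleGraph (Fin n)} {Q : Finset (Fin n)} {inp : Input} {W : ℕ}
  {Z : Set (ℕ × ℕ)} {V0 : Finset (Fin n)} {k m : ℕ} {q0 : Fin n} {qu : ℕ → Fin n}

/-- Run `c` for all vertices in the queue, held in register 10. -/
def forEach (c : Com) : Com := forUp 21 9 (.seq (.load 10 5 (.reg 21)) c)

/-- Mark the edges outside the component of the query vertices as deleted, label the others. -/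
def labelBody : Com :=
  block [.load 17 9 (.reg 21), .ite (.reg 17) (.lit 1)
    (block [.load 10 0 (.reg 21), .load 17 6 (.reg 10),
      .ite (.reg 17) (.reg 7) (.store 9 (.reg 21) (.lit 2))
        (.store 2 (.reg 21) (.add (.reg 1) (.lit 1)))]) .skip]

/-- Label the edges of the component of the query vertices. -/
def labels : Com := forUp 21 3 labelBody

/-- Take the maximum of the recorded and the current distance of the vertex in register 10. -/
def maxDist : Com :=
  block [.load 17 12 (.reg 10), .load 18 7 (.reg 10),
    .ite (.reg 17) (.reg 18) (.store 12 (.reg 10) (.reg 18)) .skip]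

/-- Compute the query distances of the vertices in the queue. -/
def queryDists : Com :=
  .seq (forEach (.store 12 (.reg 10) (.lit 0)))
    (forUp 24 5 (block [.input 23 .query (.reg 24) (.lit 0), bfs, forEach maxDist]))

/-- Compare the vertex in register 10 with the farthest vertex found so far. -/
def pickBody : Com :=
  block [.load 17 12 (.reg 10), .assign 17 (.add (.reg 17) (.lit 1)), .ite (.reg 25) (.reg 17)
    (block [.assign 25 (.reg 17), .assign 26 (.reg 10)]) .skip]

/-- Find a farthest vertex. -/
def pick : Com := .seq (.assign 25 (.lit 0)) (forEach pickBody)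

variable (S : Setting G Q inp W Z V0 k m q0 qu) {N : Numbering (core G Q q0) m}

include S

theorem Queued.length_le {st t : ℕ} {D : Fin n → ℕ} {L : List (Fin n)} {mem : ℕ → ℕ → ℕ}
    (hq : Queued V0 st D L t mem) (hL : L.Nodup) : L.length ≤ 2 * m := by
  rw [← List.toFinset_card_of_nodup hL]
  exact (Finset.card_le_card fun x hx => hq.sub x (by simpa using hx)).trans S.card_le

theorem forEach_spec {c : Com} {s : State} {K st : ℕ} {D : Fin n → ℕ} {L : List (Fin n)}
    (hq : Queued V0 st D L (s.reg 9) s.mem) (hL : L.Nodup) (Inv : Finset (Fin n) → State → Prop)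
    (h9 : c.wr 9 = false) (h21 : c.wr 21 = false) (h5 : c.wa 5 = false)
    (hinv : ∀ X s1 x y, x = 10 ∨ x = 21 → Inv X s1 → Inv X (s1.setReg x y)) (h0 : Inv ∅ s)
    (hstep : ∀ X v s1, Same (forEach c) s s1 → v ∈ L → v ∈ V0 → v ∉ X → s1.reg 10 = v →
      Inv X s1 → WP inp W Z c s1 K (Inv (insert v X))) :
    WP inp W Z (forEach c) s ((K + 10) * (2 * m) + 6) (Inv L.toFinset) := by
  have hW := S.word'
  have hm2 := S.zone.m_le
  have hlen := Queued.length_le S hq hL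
  refine (WP.counting (Z := Z) (m := L.length) (fun j s1 => Inv (L.take j).toFinset s1)
    (fun _ => K + 2) (by decide) (by simp [Com.wr, h21]) (by simp [Com.wr, h9]) hq.len
    (by omega) (by omega) ?_ ?_).mono ?_ ?_
  · simpa using hinv _ _ _ _ (Or.inr rfl) h0
  · rintro j hj s1 hs1 h21' hI
    have hvL : L[j] ∈ L := List.getElem_mem hj
    have hvV := hq.sub _ hvL
    have e5 : s1.mem 5 = s.mem 5 := hs1.2 5 (by simp [forUp, Com.wa, h5])
    have hget : s1.mem 5 j = L[j] := by
      rw [e5]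
      exact hq.get _ _ (List.getElem?_eq_getElem hj)
    have hlt := L[j].2
    have z5 := S.zone.idx 5 (by omega) j (by omega)
    have hnot : L[j] ∉ (L.take j).toFinset := by
      rw [List.mem_toFinset]
      intro hmem
      obtain ⟨i, hi, he⟩ := List.mem_take_iff_getElem.1 hmem
      have := (hL.getElem_inj_iff).1 he
      omega
    have e1 : (L.take (j + 1)).toFinset = insert L[j] (L.take j).toFinset := by
      rw [← List.take_concat_get' L j hj]
      ext x
      simp only [List.mem_toFinset, List.mem_append, List.mem_singleton, Finset.mem_insert, or_comm]
    refine WP.seq' (N1 := 2) (N2 := K) (R := fun s2 => s2 = s1.setReg 10 L[j])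
      (WP.straight ?_ (by simp)) ?_ (by omega)
    · simp [h21', hget]
      exact ⟨by omega, by omega, z5⟩
    rintro s2 hs2 rfl
    refine (hstep (L.take j).toFinset L[j] _ (hs1.trans (hs2.mono ?_ ?_)) hvL hvV hnot (by simp)
      (hinv _ _ _ _ (Or.inl rfl) hI)).mono le_rfl ?_
    · intro x hx
      simp [forEach, forUp, Com.wr] at hx ⊢
      tauto
    · intro x hx
      rfl
    · intro s3 _ h3
      rw [e1]
      exact hinv _ _ _ _ (Or.inr rfl) h3
  · simp only [Finset.sum_const, Finset.card_range, smul_eq_mul]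
    have : L.length * (K + 2 + 8) ≤ (2 * m) * (K + 10) := Nat.mul_le_mul_right _ hlen
    rw [mul_comm (K + 10)]
    omega
  · intro s' _ h
    rwa [List.take_length] at h

/-- One end suffices: a present edge lies in the component of `q0` if and only if its lower end
carries the current stamp. Surviving edges are relabelled in every iteration, so the final label
records the last graph that contains the edge. -/
theorem labels_spec {s : State} {H P : SimpleGraph (Fin n)} {st i : ℕ} {D : Fin n → ℕ} {L : List (Fin n)}
    (hR : Ready Q V0 inp k q0 N s) (hi : s.reg 1 = i) (hin : i ≤ n) (h7 : s.reg 7 = st) (hst : st ≤ W)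
    (hP : P = N.graph fun f => s.mem 9 f < 2) (hs : ∀ f < m, s.mem 9 f = 0 ∨ s.mem 9 f = 2)
    (hH : H = comp P q0) (hq : Queued V0 st D L (s.reg 9) s.mem)
    (hL : ∀ v, v ∈ L ↔ P.Reachable q0 v) :
    WP inp W Z labels s (50 * m + 6) fun s' => (∀ f < m,
      (s'.mem 9 f = 0 ∧ s'.mem 2 f = i + 1 ∧ H.Adj (N.lo f) (N.hi f)) ∨
      (s'.mem 9 f = 2 ∧ s'.mem 2 f = s.mem 2 f ∧ ¬ H.Adj (N.lo f) (N.hi f))) ∧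
      ∀ f < m, s'.mem 9 f = 0 → s.mem 9 f = 0 := by
  have hW := S.word'
  have hm2 := S.zone.m_le
  refine (WP.counting (Z := Z) (m := m) (fun j s1 => (∀ f < m, (f < j ∧
      ((s1.mem 9 f = 0 ∧ s1.mem 2 f = i + 1 ∧ H.Adj (N.lo f) (N.hi f)) ∨
      (s1.mem 9 f = 2 ∧ s1.mem 2 f = s.mem 2 f ∧ ¬ H.Adj (N.lo f) (N.hi f)))) ∨
      (j ≤ f ∧ s1.mem 9 f = s.mem 9 f ∧ s1.mem 2 f = s.mem 2 f)) ∧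
      ∀ f < m, s1.mem 9 f = 0 → s.mem 9 f = 0)
    (fun _ => 42) (by decide) rfl rfl hR.edges (by omega) (by omega) ?_ ?_).mono ?_ ?_
  · refine ⟨fun f hf => Or.inr ⟨by omega, by simp, by simp⟩, fun f _ h => by simpa using h⟩
  · rintro j hj s1 hs1 h21 ⟨i1, i2⟩
    obtain ⟨i3, i4⟩ : s1.mem 9 j = s.mem 9 j ∧ s1.mem 2 j = s.mem 2 j := by
      rcases i1 j hj with h | h
      · omega
      · exact h.2
    have hR1 := hR.same hs1 rfl
    have e1 : s1.reg 1 = i := (hs1.1 1 rfl).trans hi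
    have e7 : s1.reg 7 = st := (hs1.1 7 rfl).trans h7
    have e6 : s1.mem 6 = s.mem 6 := hs1.2 6 rfl
    have hadj := N.adj j hj
    have hlV := (S.core_mem hadj).1
    have hlo := hR1.lo j hj
    have hstle := hq.stamp_le _ hlV
    have hsti := hq.stamp _ hlV
    have hlt := (N.lo j).2
    have z9 := S.zone.idx 9 (by omega) j (by omega)
    have z0 := S.zone.idx 0 (by omega) j (by omega)
    have z2 := S.zone.idx 2 (by omega) j (by omega)
    have z6 := S.zone.vtx 6 (by omega) _ hlV
    have hE : N.Ends j (N.lo j) (N.hi j) := Or.inl ⟨rfl, rfl⟩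
    have hPadj : P.Adj (N.lo j) (N.hi j) ↔ s.mem 9 j < 2 := by
      rw [hP]
      exact hE.graph_adj hj
    have hHadj : H.Adj (N.lo j) (N.hi j) ↔ s.mem 9 j < 2 ∧ s.mem 6 (N.lo j) = st := by
      rw [hH, hsti, hL]
      exact and_congr_left' hPadj
    refine WP.code (by simp [labelBody]) fun R hR => ?_
    rcases hs j hj with h0 | h2
    · by_cases hlast : s.mem 6 (N.lo j) < st
      · have hHn : ¬ H.Adj (N.lo j) (N.hi j) := fun h => by
          have := (hHadj.1 h).2
          omega
        simp [labelBody, h21, i3, h0, hlo, e6, e7, e1, hlast, z9, z0, z2, z6]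
        and_intros <;> try omega
        refine hR _ ⟨fun f hf => ?_, fun f hf h => ?_⟩
        · simp [Function.update_apply]
          rcases eq_or_ne f j with rfl | hfj
          · left
            simp [hHn, i4]
          · simp only [hfj, not_false_eq_true, forall_const, if_false]
            rcases i1 f hf with h | h
            · exact Or.inl ⟨by omega, h.2⟩
            · exact Or.inr ⟨by omega, h.2⟩
        · simp only [State.mem_setMem, State.mem_setReg, if_true, Function.update_apply] at h
          split_ifs at h
          exact i2 f hf h
      · have hHy : H.Adj (N.lo j) (N.hi j) := hHadj.2 ⟨by omega, by omega⟩
        simp [labelBody, h21, i3, h0, hlo, e6, e7, e1, hlast, z9, z0, z2, z6]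
        and_intros <;> try omega
        refine hR _ ⟨fun f hf => ?_, fun f hf h => ?_⟩
        · simp [Function.update_apply]
          rcases eq_or_ne f j with rfl | hfj
          · left
            simp [hHy, i3, h0]
          · simp only [hfj, not_false_eq_true, forall_const, if_false]
            rcases i1 f hf with h | h
            · exact Or.inl ⟨by omega, h.2⟩
            · exact Or.inr ⟨by omega, h.2⟩
        · exact i2 f hf (by simpa using h)
    · have hHn : ¬ H.Adj (N.lo j) (N.hi j) := fun h => by
        have := (hHadj.1 h).1
        omega
      simp [labelBody, h21, i3, h2, z9]
      and_intros <;> try omega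
      refine hR _ ⟨fun f hf => ?_, fun f hf h => ?_⟩
      · simp
        rcases eq_or_ne f j with rfl | hfj
        · left
          simp [hHn, i3, i4, h2]
        · rcases i1 f hf with h | h
          · exact Or.inl ⟨by omega, h.2⟩
          · exact Or.inr ⟨by omega, h.2⟩
      · exact i2 f hf (by simpa using h)
  · simp only [Finset.sum_const, Finset.card_range, smul_eq_mul]
    omega
  · rintro s' - ⟨h1, h2⟩
    refine ⟨fun f hf => ?_, h2⟩
    rcases h1 f hf with h | h
    · exact h.2
    · omega

/-- The list of the vertices of the graph `H` in the queue. -/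
structure Listed (V0 : Finset (Fin n)) (H : SimpleGraph (Fin n)) (q0 : Fin n) (L : List (Fin n))
    (s : State) : Prop where
  nodup : L.Nodup
  mem_iff : ∀ v, v ∈ L ↔ H.Reachable q0 v
  queued : ∃ D, Queued V0 (s.reg 7) D L (s.reg 9) s.mem

/-- All query vertices lie in one component, so each search lists the same vertices, though in
another order, and the maximum over `Q` can be accumulated in array 12. These searches are the
source of the term `|Q|tm'`. -/
theorem queryDists_spec {s : State} {H : SimpleGraph (Fin n)} {st : ℕ} {L : List (Fin n)}
    (hR : Ready Q V0 inp k q0 N s) (h7 : s.reg 7 = st) (hst : st + n + 2 ≤ W)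
    (hH : H ≤ core G Q q0)
    (hs : ∀ v w, (core G Q q0).Adj v w → s.mem 9 (N.id v w) ≤ 2 ∧
      (H.Adj v w ↔ s.mem 9 (N.id v w) < 2))
    (hreach : ∀ q ∈ Q, H.Reachable q0 q) (hL : Listed V0 H q0 L s) :
    WP inp W Z queryDists s ((500 * Q.card + 100) * m) fun s' => s'.reg 7 = st + Q.card ∧
      (∃ L', Listed V0 H q0 L' s') ∧
      ∀ v, H.Reachable q0 v → s'.mem 12 v = Q.sup fun q => H.dist q v := by
  have hW := S.word'
  have hm2 := S.zone.m_le
  have hm := S.one_le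
  have hk := S.level_le
  have hk2 := S.two_le_level
  have hQn := S.card_query_le
  have hQm := S.card_query
  have hsum := S.sum_vertexCost
  have hQpos : 0 < Q.card := Finset.card_pos.2 ⟨q0, S.q0_mem⟩
  obtain ⟨hL1, hL2, D, hL3⟩ := hL
  have hVr : ∀ v, H.Reachable q0 v → v ∈ V0 := fun v hv => hL3.sub v ((hL2 v).2 hv)
  refine WP.seq' (N1 := 13 * (2 * m) + 6) (N2 := 470 * m * Q.card + 6)
    (R := fun s1 => ∀ v ∈ L, s1.mem 12 v = 0) ?_ ?_ ?_
  · refine (forEach_spec S (K := 3) hL3 hL1 (fun X s1 => ∀ v ∈ X, s1.mem 12 v = 0) rfl rfl rfl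
      (fun X s1 x y _ h => by simpa using h) (by simp) ?_).mono le_rfl ?_
    · intro X v s1 hs1 hvL hvV hvX h10 hI
      have z12 := S.zone.vtx 12 (by omega) v hvV
      have hlt := v.2
      refine WP.code (by simp) fun R hR => ?_
      simp [h10, z12]
      and_intros <;> try omega
      refine hR _ fun x hx => ?_
      simp only [State.mem_setMem, if_true, Function.update_apply]
      split_ifs with hxv
      · rfl
      · rcases Finset.mem_insert.1 hx with rfl | hx
        · exact (hxv rfl).elim
        · exact hI x hx
    · intro s' _ h v hv
      exact h v (by simpa using hv)
  · intro s1 hs1 h0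
    have hR1 : Ready Q V0 inp k q0 N s1 := hR.same hs1 rfl
    refine (WP.counting (Z := Z) (m := Q.card) (fun j s2 => s2.reg 7 = st + j ∧
      (∃ L', Listed V0 H q0 L' s2) ∧
      ∀ v, H.Reachable q0 v → s2.mem 12 v = (Finset.range j).sup fun i => H.dist (qu i) v)
      (fun _ => 460 * m) (by decide) rfl rfl hR1.numQuery (by omega) (by omega) ?_ ?_).mono ?_ ?_
    · refine ⟨by simpa using (hs1.1 7 rfl).trans h7, ⟨L, hL1, hL2, D, ?_⟩, fun v hv => ?_⟩
      · have e7 : s1.reg 7 = s.reg 7 := hs1.1 7 rfl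
        have e9 : s1.reg 9 = s.reg 9 := hs1.1 9 rfl
        have a5 : s1.mem 5 = s.mem 5 := hs1.2 5 rfl
        have a6 : s1.mem 6 = s.mem 6 := hs1.2 6 rfl
        have a7 : s1.mem 7 = s.mem 7 := hs1.2 7 rfl
        obtain ⟨b1, b2, b3, b4, b5, b6⟩ := hL3
        constructor
        · simpa [e9] using b1
        · simpa [a5] using b2
        · simpa [a6, e7] using b3
        · simpa [a6, e7] using b4
        · simpa [a7] using b5
        · exact b6
      · simpa using h0 v ((hL2 v).2 hv)
    · rintro j hj s2 hs2 h24 ⟨i7, ⟨L2, j1, j2, D2, j3⟩, imx⟩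
      obtain ⟨hqu, hquQ⟩ := S.query j hj
      have hR2 : Ready Q V0 inp k q0 N s2 := hR1.same hs2 rfl
      have hqlt := (qu j).2
      have a9 : s2.mem 9 = s.mem 9 := (hs2.2 9 rfl).trans (hs1.2 9 rfl)
      refine WP.comp (N1 := 3) (N2 := 457 * m) (WP.straight ?_ (by simp)) (by omega)
      simp [h24, hqu]
      refine ⟨by omega, by omega, ?_⟩
      set s3 := s2.setReg 23 (qu j) with hs3
      have hR3 : Ready Q V0 inp k q0 N s3 := hR2.setReg (by omega)
      have hready : SearchReady inp V0 H k (2 * m) (st + j) (qu j) s3 := by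
        refine ⟨hR3.level, hR3.size, by simpa [hs3] using i7, by simp [hs3], S.sub _ hquQ, ?_, ?_, ?_⟩
        · exact fun v _ w hw => ((S.core_adj v w).1 (hH hw)).2
        · intro v hv w hw
          have hadj := (S.core_adj v w).2 ⟨hv, hw⟩
          obtain ⟨b1, b2⟩ := hs v w hadj
          have := N.id_lt v w hadj
          rw [hR3.id v w hadj, show s3.mem 9 = s.mem 9 from a9]
          exact ⟨by omega, b1, b2⟩
        · intro v hv
          rw [← i7]
          exact j3.stamp_le v hv
      have hbfs := bfs_spec S.index S.zone hW (by omega) le_rfl (by omega) (by omega) hready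
      refine WP.seq' (N2 := 137 * m) hbfs ?_ (by omega)
      rintro s4 hs4 ⟨L4, hL4⟩
      have hq4 := hL4.queued
      have hlist : ∀ v, v ∈ L4 ↔ H.Reachable q0 v := fun v =>
        (hL4.mem_iff v).trans ⟨(hreach _ hquQ).trans, (hreach _ hquQ).symm.trans⟩
      refine WP.comp (N1 := (20 + 10) * (2 * m) + 6) (N2 := 1) ?_ (by omega)
      have a12 : s4.mem 12 = s2.mem 12 := (hs4.2 12 rfl).trans (by simp [hs3])
      refine (forEach_spec S (K := 20) hq4 hL4.nodup (fun X s5 => ∀ v, H.Reachable q0 v →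
        s5.mem 12 v = if v ∈ X then (Finset.range (j + 1)).sup fun i => H.dist (qu i) v
          else (Finset.range j).sup fun i => H.dist (qu i) v) rfl rfl rfl
        (fun X s1 x y _ h => by simpa using h) ?_ ?_).mono le_rfl ?_
      · intro v hv
        rw [a12]
        simpa using imx v hv
      · intro X v s5 hs5 hvL hvV hvX h10 hI
        have hv := (hlist v).1 hvL
        have h12 := hI v hv
        rw [if_neg hvX] at h12
        have h7' : s5.mem 7 v = H.dist (qu j) v := by
          rw [hs5.2 7 rfl]
          exact hq4.dist v hvL
        have hd1 : H.dist (qu j) v < n := dist_lt ((hL4.mem_iff v).1 hvL)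
        have hd2 : ((Finset.range j).sup fun i => H.dist (qu i) v) ≤ n := by
          refine Finset.sup_le fun i hi => ?_
          have hi' := Finset.mem_range.1 hi
          exact (dist_lt ((hreach _ (S.query i (by omega)).2).symm.trans hv)).le
        have z12 := S.zone.vtx 12 (by omega) v hvV
        have z7 := S.zone.vtx 7 (by omega) v hvV
        have hlt := v.2
        rw [Finset.range_add_one] at *
        generalize hA : ((Finset.range j).sup fun i => H.dist (qu i) v) = A at h12 hd2
        refine WP.code (by simp [maxDist]) fun R hR => ?_
        simp [maxDist, h10, z12, z7, h7', h12]
        and_intros <;> try omega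
        · intro hlt
          refine ⟨by omega, by omega, hR _ fun x hx => ?_⟩
          have := hI x hx
          simp only [State.mem_setMem, State.mem_setReg, if_true, Function.update_apply,
            Finset.mem_insert, Finset.sup_insert] at this ⊢
          rcases eq_or_ne x v with rfl | hxv
          · simp only [true_or, if_true]
            rw [hA]
            exact (max_eq_left hlt.le).symm
          · have : (x : ℕ) ≠ v := fun h => hxv (Fin.ext h)
            simp_all
        · intro hle
          refine hR _ fun x hx => ?_
          have := hI x hx
          simp only [State.mem_setReg, Finset.mem_insert, Finset.sup_insert] at this ⊢
          rcases eq_or_ne x v with rfl | hxv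
          · simp only [true_or, if_true]
            rw [h12, hA]
            exact (max_eq_right hle).symm
          · simp_all
      · intro s6 hs6 h6
        have e7 : s6.reg 7 = s4.reg 7 := hs6.1 7 rfl
        have e9 : s6.reg 9 = s4.reg 9 := hs6.1 9 rfl
        have a5 : s6.mem 5 = s4.mem 5 := hs6.2 5 rfl
        have a6 : s6.mem 6 = s4.mem 6 := hs6.2 6 rfl
        have a7 : s6.mem 7 = s4.mem 7 := hs6.2 7 rfl
        have hst4 := hL4.stamp
        refine WP.done ⟨?_, ⟨L4, hL4.nodup, hlist, H.dist (qu j), ?_⟩, fun v hv => ?_⟩ le_rfl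
        · exact (by simpa using (show s6.reg 7 = st + (j + 1) by omega))
        · obtain ⟨b1, b2, b3, b4, b5, b6⟩ := hq4
          constructor
          · simpa [e9] using b1
          · simpa [a5] using b2
          · simpa [a6, e7, hst4] using b3
          · simpa [a6, e7, hst4] using b4
          · simpa [a7] using b5
          · exact b6
        · have := h6 v hv
          rw [if_pos (by simpa using (hlist v).2 hv)] at this
          simpa using this
    · simp only [Finset.sum_const, Finset.card_range, smul_eq_mul]
      have : Q.card * (460 * m + 8) ≤ Q.card * (470 * m) := Nat.mul_le_mul_left _ (by omega)
      rw [mul_comm (470 * m)]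
      omega
    · rintro s' - ⟨h1, h2, h3⟩
      refine ⟨h1, h2, fun v hv => (h3 v hv).trans ?_⟩
      refine le_antisymm (Finset.sup_le fun i hi => ?_) (Finset.sup_le fun q hq => ?_)
      · exact Finset.le_sup (f := fun q => H.dist q v) (S.query i (Finset.mem_range.1 hi)).2
      · obtain ⟨i, hi, rfl⟩ := S.query_surj q hq
        exact Finset.le_sup (f := fun i => H.dist (qu i) v) (Finset.mem_range.2 hi)
  · have : 1 ≤ m * Q.card := Nat.mul_pos hm hQpos
    have e1 : (500 * Q.card + 100) * m = 500 * (m * Q.card) + 100 * m := by ring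
    have e2 : 470 * m * Q.card = 470 * (m * Q.card) := by ring
    omega

/-- Register 25 holds the best distance plus one; the value `0` means that no vertex has been seen,
so a vertex at distance `0` can still be chosen. -/
theorem pick_spec {s : State} {H : SimpleGraph (Fin n)} {L : List (Fin n)} {M : Fin n → ℕ}
    (hL : Listed V0 H q0 L s) (hM : ∀ v, H.Reachable q0 v → s.mem 12 v = M v ∧ M v ≤ n) :
    WP inp W Z pick s (80 * m) fun s' => ∃ u, H.Reachable q0 u ∧ s'.reg 26 = u ∧
      s'.reg 25 = M u + 1 ∧ ∀ v, H.Reachable q0 v → M v ≤ M u := by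
  have hW := S.word'
  have hm := S.one_le
  obtain ⟨hL1, hL2, D, hL3⟩ := hL
  refine WP.seq' (N1 := 2) (N2 := 70 * m + 6) (R := fun s1 => s1 = s.setReg 25 0)
    (WP.straight (by simp) (by simp)) ?_ (by omega)
  rintro s1 - rfl
  have hq : Queued V0 (s.reg 7) D L ((s.setReg 25 0).reg 9) (s.setReg 25 0).mem := by simpa using hL3
  refine (forEach_spec S (K := 25) hq hL1 (fun X s2 =>
    (X = ∅ ∧ s2.reg 25 = 0) ∨ ∃ u ∈ X, H.Reachable q0 u ∧ s2.reg 26 = u ∧ s2.reg 25 = M u + 1 ∧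
      ∀ v ∈ X, M v ≤ M u) rfl rfl rfl ?_ ?_ ?_).mono (by omega) ?_
  · rintro X s2 x y hx h
    have h1 : (s2.setReg x y).reg 25 = s2.reg 25 := by rw [State.reg_setReg, if_neg (by omega)]
    have h2 : (s2.setReg x y).reg 26 = s2.reg 26 := by rw [State.reg_setReg, if_neg (by omega)]
    rw [h1, h2]
    exact h
  · simp
  · intro X v s2 hs2 hvL hvV hvX h10 hI
    have hv := (hL2 v).1 hvL
    obtain ⟨h12, hMn⟩ := hM v hv
    have h12' : s2.mem 12 v = M v := by
      rw [hs2.2 12 rfl]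
      exact h12
    have z12 := S.zone.vtx 12 (by omega) v hvV
    have hlt := v.2
    have h25 : s2.reg 25 ≤ n + 1 := by
      rcases hI with ⟨-, h⟩ | ⟨u, -, hu, -, h, -⟩
      · omega
      · have := (hM u hu).2
        omega
    refine WP.code (by simp [pickBody]) fun R hR => ?_
    simp [pickBody, h10, z12, h12']
    and_intros <;> try omega
    · intro hlt
      refine ⟨by omega, by omega, hR _ (Or.inr ⟨v, by simp, hv, by simp, by simp, fun x hx => ?_⟩)⟩
      rcases Finset.mem_insert.1 hx with rfl | hx
      · exact le_rfl
      · rcases hI with ⟨rfl, -⟩ | ⟨u, -, -, -, h, h'⟩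
        · simp at hx
        · have := h' x hx
          omega
    · intro hle
      refine hR _ (Or.inr ?_)
      rcases hI with ⟨-, h⟩ | ⟨u, hu, hu', h26, h, h'⟩
      · omega
      · refine ⟨u, Finset.mem_insert_of_mem hu, hu', by simpa using h26, by simpa using h, fun x hx => ?_⟩
        rcases Finset.mem_insert.1 hx with rfl | hx
        · omega
        · exact h' x hx
  · rintro s' - (⟨h, -⟩ | ⟨u, -, hu, h26, h25, h⟩)
    · have : q0 ∈ L.toFinset := by simpa using (hL2 q0).2 (Reachable.refl q0)
      rw [h] at this
      simp at this
    · exact ⟨u, hu, h26, h25, fun v hv => h v (by simpa using (hL2 v).2 hv)⟩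

end Distances


/-! ## The record of an execution -/

section History

open SimpleGraph

variable {n : ℕ} {G : SimpleGraph (Fin n)} {Q : Finset (Fin n)} {inp : Input} {W : ℕ}
  {Z : Set (ℕ × ℕ)} {V0 : Finset (Fin n)} {k m : ℕ} {q0 : Fin n} {qu : ℕ → Fin n}

variable (G Q q0) in
/-- The graphs of the execution that deletes the vertices `far 0`, `far 1`, … -/
noncomputable def graphSeq (far : ℕ → Fin n) : ℕ → G.Subgraph
  | 0 => ofGraph (core G Q q0) (core_le q0)
  | i + 1 => deleteStep (maxTrussness G Q) Q (graphSeq far i) (far i)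

/-- The graph number `i` depends on earlier choices only, so the next choice can be written into
`far` without disturbing the past. -/
theorem graphSeq_congr {far far' : ℕ → Fin n} {i : ℕ} (h : ∀ j < i, far j = far' j) :
    graphSeq G Q q0 far i = graphSeq G Q q0 far' i := by
  induction i with
  | zero => rfl
  | succ i ih => rw [graphSeq, graphSeq, ih fun j hj => h j (by omega), h i (by omega)]

theorem graphSeq_anti {far : ℕ → Fin n} {i j : ℕ} (h : i ≤ j) :
    graphSeq G Q q0 far j ≤ graphSeq G Q q0 far i := by
  induction j, h using Nat.le_induction with
  | base => exact le_rfl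
  | succ j _ ih => exact ((deleteStep_le _ _).trans Subgraph.deleteVerts_le).trans ih

/-- The memory describes the first `i` iterations of the execution that deletes the vertices
`far 0`, `far 1`, … -/
structure History (Q : Finset (Fin n)) (q0 : Fin n) (N : Numbering (core G Q q0) m)
    (far : ℕ → Fin n) (i : ℕ) (s : State) : Prop where
  connects : ∀ j < i, Connects (graphSeq G Q q0 far j) Q
  far_mem : ∀ j < i, far j ∈ (graphSeq G Q q0 far j).verts
  far_max : ∀ j < i, ∀ v ∈ (graphSeq G Q q0 far j).verts,
    queryDist (graphSeq G Q q0 far j) Q v ≤ queryDist (graphSeq G Q q0 far j) Q (far j)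
  label : ∀ j < i, ∀ f < m, j < s.mem 2 f ↔ (graphSeq G Q q0 far j).Adj (N.lo f) (N.hi f)
  label_le : ∀ f < m, s.mem 2 f ≤ i
  far_eq : ∀ j < i, s.mem 3 j = far j
  dist : ∀ j < i, (s.mem 4 j : ℕ∞) = graphQueryDist (graphSeq G Q q0 far j) Q
  best : (i = 0 ∧ s.reg 27 = n + 1) ∨ (s.reg 2 < i ∧ s.mem 4 (s.reg 2) + 1 = s.reg 27)
  best_le : ∀ j < i, s.reg 27 ≤ s.mem 4 j + 1
  bound : s.reg 27 ≤ n + 1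

theorem History.congr {N : Numbering (core G Q q0) m} {far : ℕ → Fin n} {i : ℕ} {s s' : State}
    (h : History Q q0 N far i s) (h2 : s'.reg 2 = s.reg 2) (h27 : s'.reg 27 = s.reg 27)
    (a2 : s'.mem 2 = s.mem 2) (a3 : s'.mem 3 = s.mem 3) (a4 : s'.mem 4 = s.mem 4) :
    History Q q0 N far i s' := by
  obtain ⟨c1, c2, c3, c4, c5, c6, c7, c8, c9, c10⟩ := h
  exact ⟨c1, c2, c3, by rwa [a2], by rwa [a2], by rwa [a3], by rwa [a4], by rwa [h2, h27, a4],
    by rwa [h27, a4], by rwa [h27]⟩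

/-- The graphs decrease, so an edge of the current graph belongs to all earlier ones and the new
label `i + 1` is right for every `j ≤ i`; an edge outside keeps a label of at most `i`. The best
distance is stored plus one, with `n + 1` as the initial value, which any distance below `n` beats.
-/
theorem History.step {N : Numbering (core G Q q0) m} {far : ℕ → Fin n} {i d : ℕ} {u : Fin n}
    {s s' : State} (h : History Q q0 N far i s) (hc : Connects (graphSeq G Q q0 far i) Q)
    (hu : u ∈ (graphSeq G Q q0 far i).verts)
    (hmax : ∀ v ∈ (graphSeq G Q q0 far i).verts,
      queryDist (graphSeq G Q q0 far i) Q v ≤ queryDist (graphSeq G Q q0 far i) Q u)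
    (hlab : ∀ f < m, (s'.mem 2 f = i + 1 ∧ (graphSeq G Q q0 far i).Adj (N.lo f) (N.hi f)) ∨
      (s'.mem 2 f = s.mem 2 f ∧ ¬ (graphSeq G Q q0 far i).Adj (N.lo f) (N.hi f)))
    (a3 : s'.mem 3 = Function.update (s.mem 3) i u)
    (a4 : s'.mem 4 = Function.update (s.mem 4) i d)
    (hd : (d : ℕ∞) = graphQueryDist (graphSeq G Q q0 far i) Q) (hdn : d < n)
    (hb : (d + 1 < s.reg 27 ∧ s'.reg 27 = d + 1 ∧ s'.reg 2 = i) ∨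
      (¬ d + 1 < s.reg 27 ∧ s'.reg 27 = s.reg 27 ∧ s'.reg 2 = s.reg 2)) :
    History Q q0 N (Function.update far i u) (i + 1) s' := by
  have hg : ∀ j < i + 1, graphSeq G Q q0 (Function.update far i u) j = graphSeq G Q q0 far j :=
    fun j hj => graphSeq_congr fun l hl => Function.update_of_ne (by omega) _ _
  have hsplit : ∀ j < i + 1, j < i ∨ j = i := fun j hj => by omega
  constructor
  · intro j hj
    rw [hg j hj]
    rcases hsplit j hj with h' | rfl
    · exact h.connects j h'
    · exact hc
  · intro j hj
    rw [hg j hj]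
    rcases hsplit j hj with h' | rfl
    · rw [Function.update_of_ne h'.ne]
      exact h.far_mem j h'
    · rwa [Function.update_self]
  · intro j hj
    rw [hg j hj]
    rcases hsplit j hj with h' | rfl
    · rw [Function.update_of_ne h'.ne]
      exact h.far_max j h'
    · rwa [Function.update_self]
  · intro j hj f hf
    rw [hg j hj]
    rcases hlab f hf with ⟨b1, b2⟩ | ⟨b1, b2⟩
    · rw [b1]
      exact ⟨fun _ => (graphSeq_anti (by omega)).2 b2, fun _ => hj⟩
    · rw [b1]
      rcases hsplit j hj with h' | rfl
      · exact h.label j h' f hf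
      · have := h.label_le f hf
        exact ⟨fun h' => by omega, fun h' => (b2 h').elim⟩
  · intro f hf
    have := h.label_le f hf
    rcases hlab f hf with ⟨b1, -⟩ | ⟨b1, -⟩ <;> omega
  · intro j hj
    rw [a3]
    rcases hsplit j hj with h' | rfl
    · rw [Function.update_of_ne h'.ne, Function.update_of_ne h'.ne]
      exact h.far_eq j h'
    · rw [Function.update_self, Function.update_self]
  · intro j hj
    rw [a4, hg j hj]
    rcases hsplit j hj with h' | rfl
    · rw [Function.update_of_ne h'.ne]
      exact h.dist j h'
    · rwa [Function.update_self]
  · right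
    rw [a4]
    rcases hb with ⟨b1, b2, b3⟩ | ⟨b1, b2, b3⟩
    · rw [b2, b3, Function.update_self]
      omega
    · rcases h.best with ⟨rfl, b4⟩ | ⟨b4, b5⟩
      · omega
      · rw [b2, b3, Function.update_of_ne b4.ne]
        omega
  · intro j hj
    rw [a4]
    rcases hsplit j hj with h' | rfl
    · rw [Function.update_of_ne h'.ne]
      have := h.best_le j h'
      omega
    · rw [Function.update_self]
      omega
  · have := h.bound
    omega

theorem History.records {N : Numbering (core G Q q0) m} {far : ℕ → Fin n} {t : ℕ} {s : State}
    (h : History Q q0 N far t s) (hG : G.Connected) (hn : 2 ≤ n) (hq : q0 ∈ Q)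
    (hhalted : ¬ Connects (graphSeq G Q q0 far t) Q) (h0 : s.reg 0 = maxTrussness G Q)
    (h1 : s.reg 1 = t) (h3 : s.reg 3 = m)
    (hm : numEdges (ofGraph (core G Q q0) (core_le q0)) = m)
    (hlo : ∀ f < m, s.mem 0 f = N.lo f) (hhi : ∀ f < m, s.mem 1 f = N.hi f) :
    ∃ r : BasicRun G Q, Records r s ∧ r.t = t ∧
      r.graph 0 = ofGraph (core G Q q0) (core_le q0) := by
  have hn' : 2 ≤ Fintype.card (Fin n) := by simpa using hn
  have hmax := isMaxConnectedTruss_core (Q := Q) hG hn' hq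
  -- The first graph connects `Q`, so at least one iteration was made and the register for the best
  -- index is meaningful.
  have ht : t ≠ 0 := by
    rintro rfl
    refine hhalted ⟨hmax.1.2, fun p hp p' hp' => ?_⟩
    exact reachable_spanningCoe_of_connected hmax.1.1.1 (hmax.1.2 hp) (hmax.1.2 hp')
  obtain ⟨hb1, hb2⟩ := h.best.resolve_left fun h' => ht h'.1
  refine ⟨⟨maxTrussness G Q, t, graphSeq G Q q0 far, far, s.reg 2, rfl, hmax, h.connects,
    h.far_mem, h.far_max, fun i _ => rfl, hhalted, hb1, fun i hi => ?_⟩, ⟨h0, h1, rfl, ?_, ?_, h.far_eq,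
    h.dist⟩, rfl, rfl⟩
  · rw [← h.dist i hi, ← h.dist _ hb1]
    have := h.best_le i hi
    exact_mod_cast (by omega : s.mem 4 (s.reg 2) ≤ s.mem 4 i)
  · rw [h3]
    exact hm.symm
  · intro i hi u v
    rw [h3]
    constructor
    · intro huv
      have hcore : (core G Q q0).Adj u v := (graphSeq_anti (Nat.zero_le i)).2 huv
      refine ⟨N.id u v, N.id_lt u v hcore, ?_, ?_⟩
      · rw [h.label i hi _ (N.id_lt u v hcore)]
        rcases N.ends_id hcore with ⟨e1, e2⟩ | ⟨e1, e2⟩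
        · rw [← e1, ← e2]
          exact huv
        · rw [← e1, ← e2]
          exact huv.symm
      · rw [hlo _ (N.id_lt u v hcore), hhi _ (N.id_lt u v hcore)]
        rcases N.ends_id hcore with ⟨e1, e2⟩ | ⟨e1, e2⟩
        · rw [← e1, ← e2]
          simp
        · rw [← e1, ← e2]
          simp
    · rintro ⟨f, hf, hlt, hf'⟩
      have hadj := (h.label i hi f hf).1 hlt
      rw [hlo f hf, hhi f hf] at hf'
      rcases hf' with ⟨e1, e2⟩ | ⟨e1, e2⟩
      · rw [← Fin.ext e1, ← Fin.ext e2]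
        exact hadj
      · rw [← Fin.ext e1, ← Fin.ext e2]
        exact hadj.symm

/-- Put the edge from register 10 to register 13 on the stack if it is present. -/
def markBody : Com :=
  block [.load 19 8 (.add (.mul (.reg 10) (.reg 4)) (.reg 13)), .load 17 9 (.reg 19),
    .ite (.reg 17) (.lit 1) (push 19) .skip]

variable (S : Setting G Q inp W Z V0 k m q0 qu) {N : Numbering (core G Q q0) m}

include S

/-- The deletion of `u` is delegated to the cascade: the edges at `u` are stacked whatever their
supports. They belong to no subgraph of `H'`, so `Keeps` holds, and the counters need no change
because stacked edges still count as present. -/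
theorem mark_spec {s : State} {H H' : SimpleGraph (Fin n)} {u : Fin n}
    (hR : Ready Q V0 inp k q0 N s) (h10 : s.reg 10 = u) (h28 : s.reg 28 = 0) (hu : u ∈ V0)
    (hH : H ≤ core G Q q0)
    (hs : ∀ f < m, (s.mem 9 f = 0 ∧ H.Adj (N.lo f) (N.hi f)) ∨
      (s.mem 9 f = 2 ∧ ¬ H.Adj (N.lo f) (N.hi f)))
    (hsupp : ∀ f < m, s.mem 9 f < 2 → s.mem 10 f = N.supp (fun g => s.mem 9 g < 2) f ∧
      k ≤ s.mem 10 f + 2)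
    (hH' : ∀ v w, H'.Adj v w ↔ H.Adj v w ∧ v ≠ u ∧ w ≠ u) :
    WP inp W Z (scan markBody) s (140 * m) fun s' =>
      (∃ L, Peeled N k H' L (s'.reg 28) s'.mem) ∧ ∀ f < m, s'.mem 9 f < 2 → s.mem 9 f < 2 := by
  have hW := S.word'
  have hm2 := S.zone.m_le
  have hm := S.one_le
  have hk := S.level_le
  have hk2 := S.two_le_level
  have hdeg : (nb n inp k u).card ≤ 2 * m := by
    rw [← S.sum_deg]
    exact Finset.single_le_sum (f := fun v => (nb n inp k v).card) (fun _ _ => Nat.zero_le _) hu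
  have hadjH : ∀ v w, (core G Q q0).Adj v w → (H.Adj v w ↔ s.mem 9 (N.id v w) = 0) := by
    intro v w hvw
    have h1 : H.Adj v w ↔ H.Adj (N.lo (N.id v w)) (N.hi (N.id v w)) := by
      rcases N.ends_id hvw with ⟨e1, e2⟩ | ⟨e1, e2⟩
      · rw [← e1, ← e2]
      · rw [← e1, ← e2, H.adj_comm]
    rw [h1]
    rcases hs _ (N.id_lt v w hvw) with ⟨b1, b2⟩ | ⟨b1, b2⟩
    · simp [b1, b2]
    · simp [b1, b2]
  refine (WP.scan (Z := Z) S.index (by omega) (K := 34) (l := k) (v := u) (fun X s1 => ∃ L,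
    Stacked m L (fun _ => False) (s1.reg 28) s1.mem ∧
    (∀ f, f ∈ L ↔ ∃ w ∈ X, H.Adj u w ∧ f = N.id u w) ∧
    ∀ f < m, s1.mem 9 f = 2 ↔ s.mem 9 f = 2) (by omega) (by omega) hR.level h10 rfl rfl rfl rfl
    ?_ ?_ ?_).mono (by omega) ?_
  · rintro X s1 x y hx hx' ⟨L, h⟩
    refine ⟨L, ?_⟩
    rw [State.reg_setReg, if_neg (by omega)]
    exact h
  · refine ⟨[], ⟨by simpa using h28, by simp, by simp, by simp, fun f hf => ?_, fun f hf => ?_, by simp⟩,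
      by simp, fun _ _ => Iff.rfl⟩
    · rcases hs f hf with h | h <;> omega
    · rcases hs f hf with h | h
      · simp [h.1]
      · simp [h.1]
  · rintro X w s1 hs1 hX hwX hw h13 ⟨L, i1, i2, i3⟩
    have hR1 : Ready Q V0 inp k q0 N s1 := hR.same hs1 rfl
    have e10 : s1.reg 10 = u := (hs1.1 10 rfl).trans h10
    have e4 := hR1.size
    have hcore := (S.core_adj u w).2 ⟨hu, hw⟩
    have hlt := N.id_lt u w hcore
    have hid := hR1.id u w hcore
    have hp := pair_lt u w
    have hult := u.2
    have hwlt := w.2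
    have z8 := S.zone.dart 8 (by omega) u hu w hw
    have z9 := S.zone.idx 9 (by omega) (N.id u w) (by omega)
    have hst := i1.stat_le _ hlt
    have hst1 := i1.stat _ hlt
    have hst2 := i3 _ hlt
    have hnew : N.id u w ∉ L := by
      rw [i2]
      rintro ⟨w', hw', hadj', he⟩
      rcases (N.id_eq hcore (hH hadj')).1 he with ⟨-, h⟩ | ⟨-, h⟩
      · exact hwX (h ▸ hw')
      · exact hcore.ne h.symm
    have hlen := i1.len
    have hlenm := length_le_of_lt i1.nodup i1.lt
    have z11 := S.zone.idx 11 (by omega) (s1.reg 28) (by omega)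
    refine WP.code (by simp [markBody, push]) fun R hR => ?_
    have hiff := hadjH u w hcore
    have h01 := hs _ hlt
    by_cases h0 : s1.mem 9 (N.id u w) = 0
    · simp [markBody, push, e10, e4, h13, hid, h0, z8, z9, z11]
      and_intros <;> try omega
      have hadj : H.Adj u w := by
        rw [hiff]
        omega
      refine hR _ ⟨L ++ [N.id u w], ?_, ?_, ?_⟩
      · simp only [State.reg_setReg, if_true, State.mem_setReg]
        exact i1.push hlt h0 (fun h => h) (by simp) (by simp)
      · intro f
        rw [List.mem_append, List.mem_singleton, i2]
        constructor
        · rintro (⟨w', h1, h2⟩ | rfl)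
          · exact ⟨w', Finset.mem_insert_of_mem h1, h2⟩
          · exact ⟨w, Finset.mem_insert_self _ _, hadj, rfl⟩
        · rintro ⟨w', h1, h2, h3⟩
          rcases Finset.mem_insert.1 h1 with rfl | h1
          · exact Or.inr h3
          · exact Or.inl ⟨w', h1, h2, h3⟩
      · intro f hf
        simp only [State.mem_setMem, State.mem_setReg, Nat.reduceEqDiff, if_true, if_false,
          Function.update_apply]
        split_ifs with hfe
        · subst hfe
          omega
        · exact i3 f hf
    · have hnadj : ¬ H.Adj u w := by
        rw [hiff]
        have : ¬ s1.mem 9 (N.id u w) = 1 := by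
          rw [hst1]
          simpa using hnew
        omega
      simp [markBody, push, e10, e4, h13, hid, h0, z8, z9, z11]
      and_intros <;> try omega
      refine hR _ ⟨L, ?_, ?_, ?_⟩
      · obtain ⟨b1, b2, b3, b4, b5, b6, b7⟩ := i1
        exact ⟨by simpa using b1, by simpa using b2, b3, b4, by simpa using b5, by simpa using b6, b7⟩
      · intro f
        rw [i2]
        constructor
        · rintro ⟨w', h1, h2⟩
          exact ⟨w', Finset.mem_insert_of_mem h1, h2⟩
        · rintro ⟨w', h1, h2, h3⟩
          rcases Finset.mem_insert.1 h1 with rfl | h1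
          · exact (hnadj h2).elim
          · exact ⟨w', h1, h2, h3⟩
      · simpa using i3
  · rintro s' hs' ⟨L, i1, i2, i3⟩
    have hlt2 : ∀ f < m, s'.mem 9 f < 2 ↔ s.mem 9 f < 2 := by
      intro f hf
      have := i3 f hf
      have := i1.stat_le f hf
      have := hs f hf
      omega
    have h0 : ∀ f < m, s'.mem 9 f = 0 → s.mem 9 f = 0 := by
      intro f hf h
      have := i3 f hf
      have := hs f hf
      omega
    have a10 : s'.mem 10 = s.mem 10 := hs'.2 10 rfl
    refine ⟨⟨L, i1, ?_, ?_, ?_, ?_⟩, fun f hf => (hlt2 f hf).1⟩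
    · intro f hf h
      rw [N.supp_congr hlt2, a10]
      exact (hsupp f hf ((hlt2 f hf).1 h)).1
    · intro f hf h
      rw [a10]
      have := h0 f hf h
      exact (hsupp f hf (by omega)).2
    · intro K hK _ x y hxy
      obtain ⟨b1, b2, b3⟩ := (hH' x y).1 (hK hxy)
      have hc := hH b1
      have hl := N.id_lt x y hc
      refine ⟨hc, ?_⟩
      have c1 := (hadjH x y hc).1 b1
      have c2 := i3 _ hl
      have c3 := i1.stat_le _ hl
      have c4 : ¬ s'.mem 9 (N.id x y) = 1 := by
        rw [i1.stat _ hl, i2]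
        rintro (⟨w, -, h1, h2⟩ | h)
        · rcases (N.id_eq hc (hH h1)).1 h2 with ⟨h, -⟩ | ⟨-, h⟩
          · exact b2 h
          · exact b3 h
        · exact h
      omega
    · intro f hf h
      have c1 := h0 f hf h
      have hadj : H.Adj (N.lo f) (N.hi f) := by
        rcases hs f hf with h' | h'
        · exact h'.2
        · omega
      have key : ∀ a b, N.Ends f a b → H.Adj a b → a ≠ u := by
        rintro a b hab hadj rfl
        have hb := ((S.core_adj a b).1 (hab.adj hf)).2
        have : f ∈ L := (i2 f).2 ⟨b, hb, hadj, (hab.id hf).symm⟩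
        have := (i1.stat f hf).2 (Or.inl this)
        omega
      exact (hH' _ _).2 ⟨hadj, key _ _ (Or.inl ⟨rfl, rfl⟩) hadj,
        key _ _ (Or.inr ⟨rfl, rfl⟩) hadj.symm⟩

end History


/-! ## The main loop -/

section Main

open SimpleGraph

variable {n : ℕ} {G : SimpleGraph (Fin n)} {Q : Finset (Fin n)} {inp : Input} {W : ℕ}
  {Z : Set (ℕ × ℕ)} {V0 : Finset (Fin n)} {k m : ℕ} {q0 : Fin n} {qu : ℕ → Fin n}

/-- Write down the farthest vertex and its distance, and update the best iteration. -/
def record : Com :=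
  block [.store 3 (.reg 1) (.reg 26), .store 4 (.reg 1) (.sub (.reg 25) (.lit 1)),
    .ite (.reg 25) (.reg 27) (block [.assign 27 (.reg 25), .assign 2 (.reg 1)]) .skip,
    .assign 28 (.lit 0), .assign 10 (.reg 26)]

/-- Label the current graph, and choose and write down a farthest vertex. -/
def choose : Com := .seq labels (.seq queryDists (.seq pick record))

/-- Delete the chosen vertex and restore the truss property. -/
def delete : Com := .seq (scan markBody) (.seq cascade (.assign 1 (.add (.reg 1) (.lit 1))))

/-- One iteration of the main loop. -/
def iteration : Com :=
  .seq (.assign 23 (.reg 6)) (.seq searchQuery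
    (.ite (.reg 9) (.lit 2) (.assign 29 (.lit 1))
      (.ite (.reg 22) (.reg 5) (.assign 29 (.lit 1)) (.seq choose delete))))

/-- The main loop. -/
def mainLoop : Com := .loop (.reg 29) (.lit 1) iteration

theorem Queued.congr {st t : ℕ} {D : Fin n → ℕ} {L : List (Fin n)} {mem mem' : ℕ → ℕ → ℕ}
    (h : Queued V0 st D L t mem) (h5 : mem' 5 = mem 5) (h6 : mem' 6 = mem 6)
    (h7 : mem' 7 = mem 7) : Queued V0 st D L t mem' := by
  obtain ⟨b1, b2, b3, b4, b5, b6⟩ := h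
  exact ⟨b1, by rwa [h5], by rwa [h6], by rwa [h6], by rwa [h7], b6⟩

/-- The graph of the present edges. -/
noncomputable def present (N : Numbering (core G Q q0) m) (mem : ℕ → ℕ → ℕ) : SimpleGraph (Fin n) :=
  N.graph fun f => mem 9 f < 2

theorem present_le_core (N : Numbering (core G Q q0) m) (mem : ℕ → ℕ → ℕ) :
    present N mem ≤ core G Q q0 := N.graph_le _

theorem present_le (N : Numbering (core G Q q0) m) (mem : ℕ → ℕ → ℕ) : present N mem ≤ G :=
  (present_le_core N mem).trans (core_le q0)

/-- The edges are present or deleted, and the supports are right and large enough. -/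
structure Clean (N : Numbering (core G Q q0) m) (k : ℕ) (s : State) : Prop where
  stat : ∀ f < m, s.mem 9 f = 0 ∨ s.mem 9 f = 2
  supp : ∀ f < m, s.mem 9 f < 2 → s.mem 10 f = N.supp (fun g => s.mem 9 g < 2) f ∧
    k ≤ s.mem 10 f + 2

/-- The invariant of the main loop. -/
structure Head (Q V0 : Finset (Fin n)) (inp : Input) (k : ℕ) (q0 : Fin n)
    (N : Numbering (core G Q q0) m) (far : ℕ → Fin n) (i : ℕ) (s : State) : Prop where
  ready : Ready Q V0 inp k q0 N s
  iter : s.reg 1 = i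
  clean : Clean N k s
  graph : graphSeq G Q q0 far i = queryPart Q (ofGraph (present N s.mem) (present_le N s.mem))
  verts : numVerts (graphSeq G Q q0 far i) + i ≤ V0.card
  stamps : ∀ v ∈ V0, s.mem 6 v ≤ s.reg 7
  stamp_le : s.reg 7 ≤ n + 3 + i * (n + 1)
  history : History Q q0 N far i s

variable (S : Setting G Q inp W Z V0 k m q0 qu) {N : Numbering (core G Q q0) m}

include S

/-- The memory still holds the whole peeled graph here; the component of the query vertices is cut
out only now, by labelling, when the search from `q0` has shown that `Q` is connected. -/
theorem choose_spec {s : State} {far : ℕ → Fin n} {i st : ℕ} {L : List (Fin n)}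
    (hR : Ready Q V0 inp k q0 N s) (hi : s.reg 1 = i) (hC : Clean N k s)
    (hg : graphSeq G Q q0 far i = queryPart Q (ofGraph (present N s.mem) (present_le N s.mem)))
    (hh : History Q q0 N far i s) (hin : i < V0.card) (hst : st + n + 2 ≤ W)
    (hL : Searched V0 (present N s.mem) st q0 L s)
    (hsup : q0 ∈ (present N s.mem).support)
    (hreach : ∀ q ∈ Q, (present N s.mem).Reachable q0 q) :
    WP inp W Z choose s ((500 * Q.card + 300) * m) fun s' => ∃ u,
      u ∈ (graphSeq G Q q0 far i).verts ∧ u ∈ V0 ∧ s'.reg 10 = u ∧ s'.reg 28 = 0 ∧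
      s'.reg 7 = st + Q.card ∧ (∀ v ∈ V0, s'.mem 6 v ≤ s'.reg 7) ∧
      (∀ f < m, (s'.mem 9 f = 0 ∧ (graphSeq G Q q0 far i).spanningCoe.Adj (N.lo f) (N.hi f)) ∨
        (s'.mem 9 f = 2 ∧ ¬ (graphSeq G Q q0 far i).spanningCoe.Adj (N.lo f) (N.hi f))) ∧
      (∀ f < m, s'.mem 9 f < 2 → s'.mem 10 f = N.supp (fun g => s'.mem 9 g < 2) f ∧
        k ≤ s'.mem 10 f + 2) ∧
      (∀ f < m, s'.mem 9 f < 2 → s.mem 9 f < 2) ∧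
      History Q q0 N (Function.update far i u) (i + 1) s' := by
  have hW := S.word'
  have hm := S.one_le
  have hm2 := S.zone.m_le
  have hV0 := S.card_le
  have hV0n : V0.card ≤ n := by simpa using Finset.card_le_univ V0
  have hqpos : 0 < n := q0.pos
  set P := present N s.mem with hP
  set H := comp P q0 with hH
  have hPcore : P ≤ core G Q q0 := present_le_core N s.mem
  have hHcore : H ≤ core G Q q0 := (comp_le P q0).trans hPcore
  have hHG : H ≤ G := hHcore.trans (core_le q0)
  have hconn : Connects (graphSeq G Q q0 far i) Q := by
    rw [hg, connects_queryPart_iff _ S.q0_mem]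
    exact ⟨hsup, hreach⟩
  rw [queryPart_ofGraph _ S.q0_mem hsup hreach] at hg
  have hHreach : ∀ v, H.Reachable q0 v ↔ P.Reachable q0 v := fun v => comp_reachable_iff
  have hVr : ∀ v, H.Reachable q0 v → v ∈ V0 := fun v hv =>
    hL.queued.sub v ((hL.mem_iff v).2 ((hHreach v).1 hv))
  have hverts : ∀ v, v ∈ (graphSeq G Q q0 far i).verts ↔ H.Reachable q0 v := by
    intro v
    rw [hg, hHreach]
    exact ⟨reachable_of_mem_support_comp, mem_support_comp hsup⟩
  have hadjG : ∀ v w, (graphSeq G Q q0 far i).Adj v w ↔ H.Adj v w := by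
    intro v w
    rw [hg]
    rfl
  let M : Fin n → ℕ := fun v => Q.sup fun q => H.dist q v
  have hqd : ∀ v, H.Reachable q0 v → queryDist (graphSeq G Q q0 far i) Q v = (M v : ℕ∞) := by
    intro v hv
    rw [hg]
    exact queryDist_ofGraph _ fun q hq => ((hHreach q).2 (hreach q hq)).symm.trans hv
  have hMn : ∀ v, H.Reachable q0 v → M v < n := fun v hv => (Finset.sup_lt_iff hqpos).2 fun q hq =>
    dist_lt (((hHreach q).2 (hreach q hq)).symm.trans hv)
  refine WP.seq' (N2 := (500 * Q.card + 240) * m)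
    (labels_spec S hR hi (by omega) hL.stamp (by omega) hP hC.stat hH hL.queued hL.mem_iff) ?_ ?_
  swap
  · rw [add_mul, add_mul]
    omega
  rintro s1 hs1 ⟨l1, l2⟩
  have hR1 : Ready Q V0 inp k q0 N s1 := hR.same hs1 rfl
  have hadjH : ∀ v w, (core G Q q0).Adj v w → s1.mem 9 (N.id v w) ≤ 2 ∧
      (H.Adj v w ↔ s1.mem 9 (N.id v w) < 2) := by
    intro v w hvw
    have h1 : H.Adj v w ↔ H.Adj (N.lo (N.id v w)) (N.hi (N.id v w)) := by
      rcases N.ends_id hvw with ⟨e1, e2⟩ | ⟨e1, e2⟩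
      · rw [← e1, ← e2]
      · rw [← e1, ← e2, H.adj_comm]
    rw [h1]
    rcases l1 _ (N.id_lt v w hvw) with ⟨b1, -, b2⟩ | ⟨b1, -, b2⟩
    · simp [b1, b2]
    · simp [b1, b2]
  have hgraph : present N s1.mem = H := by
    ext v w
    exact ⟨fun h => (hadjH v w h.1).2.2 h.2, fun h => ⟨hHcore h, (hadjH v w (hHcore h)).2.1 h⟩⟩
  have a10 : s1.mem 10 = s.mem 10 := hs1.2 10 rfl
  -- Cutting out a component changes no support of a remaining edge, so the counters stay right
  -- untouched.
  have hsupp1 : ∀ f < m, s1.mem 9 f < 2 → s1.mem 10 f = N.supp (fun g => s1.mem 9 g < 2) f ∧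
      k ≤ s1.mem 10 f + 2 := by
    intro f hf hlt
    rcases l1 f hf with ⟨b1, -, b2⟩ | ⟨b1, -⟩
    · have h0 := l2 f hf b1
      obtain ⟨c1, c2⟩ := hC.supp f hf (by omega)
      rw [a10]
      refine ⟨c1.trans ?_, c2⟩
      change common P _ _ = common (present N s1.mem) _ _
      rw [hgraph]
      exact (common_comp b2).symm
    · omega
  have hlist : Listed V0 H q0 L s1 := by
    refine ⟨hL.nodup, fun v => (hL.mem_iff v).trans (hHreach v).symm, P.dist q0, ?_⟩
    have e7 : s1.reg 7 = st := (hs1.1 7 rfl).trans hL.stamp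
    have e9 : s1.reg 9 = s.reg 9 := hs1.1 9 rfl
    rw [e7, e9]
    exact hL.queued.congr (hs1.2 5 rfl) (hs1.2 6 rfl) (hs1.2 7 rfl)
  refine WP.seq' (N2 := 140 * m)
    (queryDists_spec S hR1 ((hs1.1 7 rfl).trans hL.stamp) hst hHcore hadjH
      (fun q hq => (hHreach q).2 (hreach q hq)) hlist) ?_ ?_
  swap
  · rw [add_mul, add_mul]
    omega
  rintro s2 hs2 ⟨e7, ⟨L2, hL2⟩, e12⟩
  have hR2 : Ready Q V0 inp k q0 N s2 := hR1.same hs2 rfl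
  refine WP.seq' (N2 := 60 * m) (pick_spec S (M := M) hL2 fun v hv => ⟨e12 v hv, (hMn v hv).le⟩) ?_
    (by omega)
  rintro s3 hs3 ⟨u, hu, e26, e25, hmax⟩
  have hMu := hMn u hu
  have e1 : s3.reg 1 = i := (hs3.1 1 rfl).trans ((hs2.1 1 rfl).trans ((hs1.1 1 rfl).trans hi))
  have e2 : s3.reg 2 = s.reg 2 := (hs3.1 2 rfl).trans ((hs2.1 2 rfl).trans (hs1.1 2 rfl))
  have e27 : s3.reg 27 = s.reg 27 := (hs3.1 27 rfl).trans ((hs2.1 27 rfl).trans (hs1.1 27 rfl))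
  have b2 : s3.mem 2 = s1.mem 2 := (hs3.2 2 rfl).trans (hs2.2 2 rfl)
  have b9 : s3.mem 9 = s1.mem 9 := (hs3.2 9 rfl).trans (hs2.2 9 rfl)
  have b10 : s3.mem 10 = s1.mem 10 := (hs3.2 10 rfl).trans (hs2.2 10 rfl)
  have b3 : s3.mem 3 = s.mem 3 := (hs3.2 3 rfl).trans ((hs2.2 3 rfl).trans (hs1.2 3 rfl))
  have b4 : s3.mem 4 = s.mem 4 := (hs3.2 4 rfl).trans ((hs2.2 4 rfl).trans (hs1.2 4 rfl))
  have b6 : s3.mem 6 = s2.mem 6 := hs3.2 6 rfl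
  have e7' : s3.reg 7 = st + Q.card := (hs3.1 7 rfl).trans e7
  have z3 := S.zone.idx 3 (by omega) i (by omega)
  have z4 := S.zone.idx 4 (by omega) i (by omega)
  have hult := u.2
  have hstamps : ∀ v ∈ V0, s2.mem 6 v ≤ st + Q.card := by
    obtain ⟨D, hq⟩ := hL2.queued
    rw [← e7]
    exact hq.stamp_le
  have hbound := hh.bound
  have hmaxG : ∀ v ∈ (graphSeq G Q q0 far i).verts,
      queryDist (graphSeq G Q q0 far i) Q v ≤ queryDist (graphSeq G Q q0 far i) Q u := by
    intro v hv
    have hv' := (hverts v).1 hv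
    rw [hqd v hv', hqd u hu]
    exact_mod_cast hmax v hv'
  have hdist : (M u : ℕ∞) = graphQueryDist (graphSeq G Q q0 far i) Q := by
    rw [graphQueryDist_eq ((hverts u).2 hu) hmaxG, hqd u hu]
  have final : ∀ s4 : State, s4.mem 2 = s3.mem 2 → s4.mem 9 = s3.mem 9 → s4.mem 10 = s3.mem 10 →
      s4.mem 6 = s3.mem 6 → s4.mem 3 = Function.update (s3.mem 3) i u →
      s4.mem 4 = Function.update (s3.mem 4) i (M u) → s4.reg 7 = s3.reg 7 → s4.reg 10 = u →
      s4.reg 28 = 0 → ((M u + 1 < s3.reg 27 ∧ s4.reg 27 = M u + 1 ∧ s4.reg 2 = i) ∨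
      (¬ M u + 1 < s3.reg 27 ∧ s4.reg 27 = s3.reg 27 ∧ s4.reg 2 = s3.reg 2)) → ∃ u,
      u ∈ (graphSeq G Q q0 far i).verts ∧ u ∈ V0 ∧ s4.reg 10 = u ∧ s4.reg 28 = 0 ∧
      s4.reg 7 = st + Q.card ∧ (∀ v ∈ V0, s4.mem 6 v ≤ s4.reg 7) ∧
      (∀ f < m, (s4.mem 9 f = 0 ∧ (graphSeq G Q q0 far i).spanningCoe.Adj (N.lo f) (N.hi f)) ∨
        (s4.mem 9 f = 2 ∧ ¬ (graphSeq G Q q0 far i).spanningCoe.Adj (N.lo f) (N.hi f))) ∧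
      (∀ f < m, s4.mem 9 f < 2 → s4.mem 10 f = N.supp (fun g => s4.mem 9 g < 2) f ∧
        k ≤ s4.mem 10 f + 2) ∧
      (∀ f < m, s4.mem 9 f < 2 → s.mem 9 f < 2) ∧
      History Q q0 N (Function.update far i u) (i + 1) s4 := by
    intro s4 c2 c9 c10 c6 c3 c4 d7 d10 d28 db
    rw [c9, c10, c6, d7, b9, b10, b6, e7']
    refine ⟨u, (hverts u).2 hu, hVr u hu, d10, d28, rfl, hstamps, ?_, hsupp1, ?_, ?_⟩
    · intro f hf
      rcases l1 f hf with ⟨g1, -, g2⟩ | ⟨g1, -, g2⟩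
      · exact Or.inl ⟨g1, (hadjG _ _).2 g2⟩
      · exact Or.inr ⟨g1, fun h => g2 ((hadjG _ _).1 h)⟩
    · intro f hf hlt
      rcases l1 f hf with ⟨g1, -⟩ | ⟨g1, -⟩
      · have := l2 f hf g1
        omega
      · omega
    · refine hh.step hconn ((hverts u).2 hu) hmaxG ?_ (b3 ▸ c3) (b4 ▸ c4) hdist hMu ?_
      · intro f hf
        rw [c2, b2]
        rcases l1 f hf with ⟨-, g1, g2⟩ | ⟨-, g1, g2⟩
        · exact Or.inl ⟨g1, (hadjG _ _).2 g2⟩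
        · exact Or.inr ⟨g1, fun h => g2 ((hadjG _ _).1 h)⟩
      · rwa [e27, e2] at db
  clear_value M
  refine WP.code ?_ fun R hR => ?_
  · simp [record]
    omega
  simp [record, e1, e26, e25, z3, z4, e27]
  and_intros <;> try omega
  · intro hlt
    and_intros <;> try omega
    refine hR _ (final _ ?_ ?_ ?_ ?_ ?_ ?_ ?_ ?_ ?_ ?_) <;> simp [e27, hlt]
  · intro hle
    and_intros <;> try omega
    refine hR _ (final _ ?_ ?_ ?_ ?_ ?_ ?_ ?_ ?_ ?_ ?_) <;> simp [e27, hle]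

/-- With an empty stack every status is `0` or `2`, and the fields of `Peeled` supply the hypotheses
of `trussPart_eq`: `del` gives containment, `supp` and `low` the truss property, and `keep`
maximality. -/
theorem delete_spec {s : State} {far : ℕ → Fin n} {i : ℕ} {u : Fin n}
    (hR : Ready Q V0 inp k q0 N s) (hi : s.reg 1 = i) (hin : i < V0.card)
    (hverts : numVerts (graphSeq G Q q0 far i) + i ≤ V0.card)
    (hu : u ∈ (graphSeq G Q q0 far i).verts) (huV : u ∈ V0) (h10 : s.reg 10 = u)
    (h28 : s.reg 28 = 0) (h7 : s.reg 7 ≤ n + 3 + (i + 1) * (n + 1))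
    (hst : ∀ v ∈ V0, s.mem 6 v ≤ s.reg 7)
    (hs : ∀ f < m, (s.mem 9 f = 0 ∧
        (graphSeq G Q q0 far i).spanningCoe.Adj (N.lo f) (N.hi f)) ∨
      (s.mem 9 f = 2 ∧ ¬ (graphSeq G Q q0 far i).spanningCoe.Adj (N.lo f) (N.hi f)))
    (hsupp : ∀ f < m, s.mem 9 f < 2 → s.mem 10 f = N.supp (fun g => s.mem 9 g < 2) f ∧
      k ≤ s.mem 10 f + 2)
    (hh : History Q q0 N (Function.update far i u) (i + 1) s) :
    WT inp W Z delete s fun s' T =>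
      Head Q V0 inp k q0 N (Function.update far i u) (i + 1) s' ∧
      T + potential inp k N 300 s'.mem ≤ potential inp k N 300 s.mem + 150 * m := by
  have hW := S.word'
  have hm := S.one_le
  have hV0n : V0.card ≤ n := by simpa using Finset.card_le_univ V0
  set Hi := graphSeq G Q q0 far i with hHi
  set H' := (Hi.deleteVerts {u}).spanningCoe with hH'
  have hHcore : Hi.spanningCoe ≤ core G Q q0 := fun v w h => (graphSeq_anti (Nat.zero_le i)).2 h
  have hadj' : ∀ v w, H'.Adj v w ↔ Hi.spanningCoe.Adj v w ∧ v ≠ u ∧ w ≠ u := by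
    intro v w
    rw [hH', Subgraph.spanningCoe_adj, Subgraph.deleteVerts_adj, Subgraph.spanningCoe_adj]
    simp only [Set.mem_singleton_iff]
    exact ⟨fun h => ⟨h.2.2.2.2, h.2.1, h.2.2.2.1⟩,
      fun h => ⟨Hi.edge_vert h.1, h.2.1, Hi.edge_vert h.1.symm, h.2.2, h.1⟩⟩
  refine WT.seq (WT.mono (mark_spec S hR h10 h28 huV hHcore hs hsupp hadj') fun s1 T1 hs1 h1 => ?_)
  obtain ⟨hT1, ⟨L, hL⟩, hmono⟩ := h1
  have hR1 : Ready Q V0 inp k q0 N s1 := hR.same hs1 rfl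
  refine WT.seq (WT.mono (cascade_spec S hR1 hL) fun s2 T2 hs2 h2 => ?_)
  obtain ⟨hP, hmono2, hT2⟩ := h2
  have hR2 : Ready Q V0 inp k q0 N s2 := hR1.same hs2 rfl
  have e1 : s2.reg 1 = i := (hs2.1 1 rfl).trans ((hs1.1 1 rfl).trans hi)
  have hpot : potential inp k N 300 s1.mem ≤ potential inp k N 300 s.mem := potential_mono hmono
  have hadd : WP inp W Z (.assign 1 (.add (.reg 1) (.lit 1))) s2 4 fun s3 =>
      s3 = s2.setReg 1 (i + 1) := by
    refine WP.straight ?_ (by simp)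
    simp [e1]
    omega
  refine WT.mono hadd fun s3 T3 hs3 h3 => ?_
  obtain ⟨hT3, rfl⟩ := h3
  have hstat : ∀ f < m, s2.mem 9 f = 0 ∨ s2.mem 9 f = 2 := by
    intro f hf
    have h1 := hP.stacked.stat_le f hf
    have h2 := hP.stacked.stat f hf
    simp only [List.not_mem_nil, or_self, iff_false] at h2
    omega
  have hstep : graphSeq G Q q0 (Function.update far i u) (i + 1) =
      queryPart Q (ofGraph (present N s2.mem) (present_le N s2.mem)) := by
    rw [graphSeq, Function.update_self, graphSeq_congr (far' := far)
      fun j hj => Function.update_of_ne (by omega) _ _, deleteStep, ← hHi]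
    congr 1
    refine trussPart_eq _ ?_ ?_ ?_
    · intro v w hvw
      have hl := N.id_lt v w hvw.1
      have hd := hP.del _ hl (by
        have := hstat _ hl
        have : s2.mem 9 (N.id v w) < 2 := hvw.2
        omega)
      rcases N.ends_id hvw.1 with ⟨e1, e2⟩ | ⟨e1, e2⟩
      · rwa [← e1, ← e2] at hd
      · rw [← e1, ← e2] at hd
        exact hd.symm
    · intro v w hvw
      have hl := N.id_lt v w hvw.1
      have hlt : s2.mem 9 (N.id v w) < 2 := hvw.2
      rw [← S.level_eq, show common (present N s2.mem) v w = _ from (N.ends_id hvw.1).common,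
        ← hP.supp _ hl hlt]
      have := hstat _ hl
      exact hP.low _ hl (by omega)
    · intro K hK hKt v w hvw
      have hKle : K.spanningCoe ≤ H' := fun x y hxy => hK.2 hxy
      obtain ⟨c1, c2⟩ := hP.keep K.spanningCoe hKle (fun x y hxy => S.level_eq ▸ hKt x y hxy) v w hvw
      exact ⟨c1, by simp [c2]⟩
  refine ⟨⟨?_, by simp, ⟨hstat, ?_⟩, hstep, ?_, ?_, ?_, ?_⟩, ?_⟩
  · obtain ⟨r0, r3, r4, r5, r6, a8, a0, a1, a13⟩ := hR2
    exact ⟨by simpa using r0, by simpa using r3, by simpa using r4, by simpa using r5,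
      by simpa using r6, a8, a0, a1, a13⟩
  · intro f hf hlt
    have := hstat f hf
    have hlt' : s2.mem 9 f < 2 := hlt
    exact ⟨hP.supp f hf hlt, hP.low f hf (by omega)⟩
  · have h1 : graphSeq G Q q0 (Function.update far i u) (i + 1) =
        deleteStep (maxTrussness G Q) Q Hi u := by
      rw [graphSeq, Function.update_self, graphSeq_congr (far' := far)
        fun j hj => Function.update_of_ne (by omega) _ _]
    rw [h1]
    have := numVerts_deleteStep_lt (k := maxTrussness G Q) (Q := Q) hu
    omega
  · have a6 : s2.mem 6 = s.mem 6 := (hs2.2 6 rfl).trans (hs1.2 6 rfl)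
    have e7 : s2.reg 7 = s.reg 7 := (hs2.1 7 rfl).trans (hs1.1 7 rfl)
    simpa [a6, e7] using hst
  · have e7 : s2.reg 7 = s.reg 7 := (hs2.1 7 rfl).trans (hs1.1 7 rfl)
    simpa [e7] using h7
  · refine hh.congr ?_ ?_ ?_ ?_ ?_
    · simpa using (hs2.1 2 rfl).trans (hs1.1 2 rfl)
    · simpa using (hs2.1 27 rfl).trans (hs1.1 27 rfl)
    · exact (hs2.2 2 rfl).trans (hs1.2 2 rfl)
    · exact (hs2.2 3 rfl).trans (hs1.2 3 rfl)
    · exact (hs2.2 4 rfl).trans (hs1.2 4 rfl)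
  · simp only [State.mem_setReg]
    omega

end Main


/-! ### Iterations, the main loop and the cost of the whole program -/

section Run

open SimpleGraph

variable {n : ℕ} {G : SimpleGraph (Fin n)} {Q : Finset (Fin n)} {inp : Input} {W : ℕ}
  {Z : Set (ℕ × ℕ)} {V0 : Finset (Fin n)} {k m : ℕ} {q0 : Fin n} {qu : ℕ → Fin n}

theorem WT.branch {e f : Expr} {c d : Com} {s : State} {R : State → ℕ → Prop}
    (he : e.Fits W s.reg) (hf : f.Fits W s.reg)
    (hc : e.val s.reg < f.val s.reg → WT inp W Z c s fun s' T => R s' (e.cost + f.cost + 1 + T))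
    (hd : ¬ e.val s.reg < f.val s.reg → WT inp W Z d s fun s' T => R s' (e.cost + f.cost + 1 + T)) :
    WT inp W Z (.ite e f c d) s R := by
  by_cases hg : e.val s.reg < f.val s.reg
  · obtain ⟨s', T, S, h1, h2, h3⟩ := hc hg
    exact ⟨s', _, S, .ite_true he hf hg h1, h2, h3⟩
  · obtain ⟨s', T, S, h1, h2, h3⟩ := hd hg
    exact ⟨s', _, S, .ite_false he hf hg h1, h2, h3⟩

/-- The state after the last iteration. -/
structure Finished (Q V0 : Finset (Fin n)) (inp : Input) (k : ℕ) (q0 : Fin n)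
    (N : Numbering (core G Q q0) m) (far : ℕ → Fin n) (i : ℕ) (s : State) : Prop where
  ready : Ready Q V0 inp k q0 N s
  iter : s.reg 1 = i
  halted : ¬ Connects (graphSeq G Q q0 far i) Q
  history : History Q q0 N far i s

variable (S : Setting G Q inp W Z V0 k m q0 qu) {N : Numbering (core G Q q0) m}

include S

theorem iteration_spec {s : State} {far : ℕ → Fin n} {i : ℕ}
    (h : Head Q V0 inp k q0 N far i s) (h29 : s.reg 29 = 0) (hin : i ≤ n) :
    WT inp W Z iteration s fun s' T => T + potential inp k N 300 s'.mem ≤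
        potential inp k N 300 s.mem + (500 * Q.card + 900) * m ∧
      ((s'.reg 29 = 1 ∧ Finished Q V0 inp k q0 N far i s') ∨
        (s'.reg 29 = 0 ∧ i < n ∧ ∃ far', Head Q V0 inp k q0 N far' (i + 1) s')) := by
  have hW := S.word
  have hm := S.one_le
  have hm2 := S.zone.m_le
  have hV0n : V0.card ≤ n := by simpa using Finset.card_le_univ V0
  have hk := S.level_le
  have hQn := S.card_query_le
  have hqlt := q0.2
  have hin' : i * (n + 1) ≤ n * (n + 1) := Nat.mul_le_mul_right _ hin
  have hW' : n * n + 10 * n + 50 + i * (n + 1) ≤ W := by nlinarith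
  have h7 := h.stamp_le
  set P := present N s.mem with hP
  have hready : SearchReady inp V0 P k (2 * m) (s.reg 7) q0 (s.setReg 23 q0) := by
    refine ⟨by simpa using h.ready.level, by simpa using h.ready.size, by simp, by simp,
      S.sub _ S.q0_mem, ?_, ?_, by simpa using h.stamps⟩
    · exact fun v _ w hw => ((S.core_adj v w).1 hw.1).2
    · intro v hv w hw
      have hadj := (S.core_adj v w).2 ⟨hv, hw⟩
      have hl := N.id_lt v w hadj
      rw [State.mem_setReg, h.ready.id v w hadj]
      have := h.clean.stat _ hl
      exact ⟨by omega, by omega, fun h => h.2, fun h => ⟨hadj, h⟩⟩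
  have hassign : WP inp W Z (.assign 23 (.reg 6)) s 2 fun s1 => s1 = s.setReg 23 q0 := by
    refine WP.straight ?_ (by simp)
    simp [h.ready.first]
    omega
  refine WT.seq (WT.mono hassign fun s1 T1 _ h1 => ?_)
  obtain ⟨hT1, rfl⟩ := h1
  refine WT.seq (WT.mono (searchQuery_spec S (by simpa using h.ready.numQuery)
    (by omega) le_rfl (by omega) hready) fun s2 T2 hs2 h2 => ?_)
  obtain ⟨hT2, ⟨L, hL⟩, h22, hall⟩ := h2
  have hR2 : Ready Q V0 inp k q0 N s2 := (h.ready.setReg (by omega)).same hs2 rfl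
  have e1 : s2.reg 1 = i := (hs2.1 1 rfl).trans (by simpa using h.iter)
  have e29 : s2.reg 29 = 0 := (hs2.1 29 rfl).trans (by simpa using h29)
  have a9 : s2.mem 9 = s.mem 9 := hs2.2 9 rfl
  have a10 : s2.mem 10 = s.mem 10 := hs2.2 10 rfl
  have hh2 : History Q q0 N far i s2 := h.history.congr ((hs2.1 2 rfl).trans (by simp))
    ((hs2.1 27 rfl).trans (by simp)) (hs2.2 2 rfl) (hs2.2 3 rfl) (hs2.2 4 rfl)
  have hpres : present N s2.mem = P := by
    rw [hP, present, present, a9]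
  have hg2 : graphSeq G Q q0 far i =
      queryPart Q (ofGraph (present N s2.mem) (present_le N s2.mem)) := by
    simp only [hpres]
    exact h.graph
  have hC2 : Clean N k s2 := ⟨by rw [a9]; exact h.clean.stat, by rw [a9, a10]; exact h.clean.supp⟩
  have hpot : potential inp k N 300 s2.mem ≤ potential inp k N 300 s.mem :=
    potential_mono fun f _ hlt => by rwa [a9] at hlt
  have hlen := hL.queued.len
  have hlenm : L.length ≤ 2 * m := Queued.length_le S hL.queued hL.nodup
  have hq0L : q0 ∈ L := (hL.mem_iff q0).2 (Reachable.refl q0)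
  -- A queue of length one means that `q0` has lost all its edges and has left the graph. Counting
  -- the reached query vertices would not reveal this when `Q` is a single vertex.
  have hsupp : s2.reg 9 < 2 ↔ q0 ∉ P.support := by
    rw [hlen]
    constructor
    · rintro hlt ⟨w, hqw⟩
      have hw : P.Adj q0 w := hqw
      have hwL : w ∈ L := (hL.mem_iff w).2 hw.reachable
      have h1 : ({q0, w} : Finset (Fin n)) ⊆ L.toFinset := by
        intro x hx
        rcases Finset.mem_insert.1 hx with rfl | hx
        · simpa using hq0L
        · rw [Finset.mem_singleton.1 hx]
          simpa using hwL
      have h2 := Finset.card_le_card h1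
      rw [Finset.card_pair hw.ne, List.toFinset_card_of_nodup hL.nodup] at h2
      omega
    · intro hns
      have h1 : L.toFinset ⊆ {q0} := by
        intro x hx
        have hx' := (hL.mem_iff x).1 (by simpa using hx)
        by_contra hne
        obtain ⟨p⟩ := hx'
        cases p with
        | nil => simp at hne
        | cons hadj _ => exact hns ⟨_, hadj⟩
      have h2 := Finset.card_le_card h1
      rw [List.toFinset_card_of_nodup hL.nodup] at h2
      simp at h2
      omega
  have hconn : Connects (graphSeq G Q q0 far i) Q ↔ q0 ∈ P.support ∧ ∀ q ∈ Q, P.Reachable q0 q := by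
    rw [h.graph]
    exact connects_queryPart_iff _ S.q0_mem
  have hhalted : ¬ Connects (graphSeq G Q q0 far i) Q →
      WP inp W Z (.assign 29 (.lit 1)) s2 2 fun s3 => s3.reg 29 = 1 ∧
        Finished Q V0 inp k q0 N far i s3 ∧ s3.mem = s2.mem := by
    intro hnc
    refine WP.code (by simp) fun R hR => ?_
    simp
    refine ⟨by omega, hR _ ⟨by simp, ⟨hR2.setReg (by omega), by simpa using e1, hnc,
      hh2.congr (by simp) (by simp) rfl rfl rfl⟩, rfl⟩⟩
  have hcost : (500 * Q.card + 900) * m = (500 * Q.card + 300) * m + 600 * m := by ring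
  refine WT.branch (by simp; omega) (by simp; omega) (fun hlt => ?_) (fun hge => ?_)
  · have hnc : ¬ Connects (graphSeq G Q q0 far i) Q := fun hc => hsupp.1 hlt (hconn.1 hc).1
    refine WT.mono (hhalted hnc) fun s3 T3 _ h3 => ?_
    obtain ⟨hT3, h4, h5, h6⟩ := h3
    rw [h6]
    simp only [Expr.cost]
    exact ⟨by omega, Or.inl ⟨h4, h5⟩⟩
  have hsup : q0 ∈ P.support := by
    by_contra hns
    exact hge (hsupp.2 hns)
  have e5 := hR2.numQuery
  refine WT.branch (by simp; omega) (by simp; omega) (fun hlt => ?_) (fun hge' => ?_)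
  · have hnc : ¬ Connects (graphSeq G Q q0 far i) Q := fun hc => by
      have := hall.2 (hconn.1 hc).2
      simp only [Expr.val] at hlt
      omega
    refine WT.mono (hhalted hnc) fun s3 T3 _ h3 => ?_
    obtain ⟨hT3, h4, h5, h6⟩ := h3
    rw [h6]
    simp only [Expr.cost]
    exact ⟨by omega, Or.inl ⟨h4, h5⟩⟩
  simp only [Expr.val] at hge'
  have hreach := hall.1 (by omega)
  -- As each iteration removes a vertex and one is still left, `i < V0.card`; this bounds the number
  -- of iterations and the indices used in arrays 3 and 4.
  have hvpos : 0 < numVerts (graphSeq G Q q0 far i) := by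
    have : q0 ∈ (graphSeq G Q q0 far i).verts := (hconn.2 ⟨hsup, hreach⟩).1 S.q0_mem
    exact (Set.ncard_pos (Set.toFinite _)).2 ⟨q0, this⟩
  have hv := h.verts
  have hiV : i < V0.card := by omega
  refine WT.seq (WT.mono (choose_spec S hR2 e1 hC2 hg2 hh2 hiV (st := s.reg 7 + 1) (by omega)
    (by rw [hpres]; exact hL) (by rw [hpres]; exact hsup) (by rw [hpres]; exact hreach))
    fun s3 T3 hs3 h3 => ?_)
  obtain ⟨hT3, u, u1, u2, u3, u4, u5, u6, u7, u8, u9, u10⟩ := h3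
  have hR3 : Ready Q V0 inp k q0 N s3 := hR2.same hs3 rfl
  refine WT.mono (delete_spec S hR3 ((hs3.1 1 rfl).trans e1) hiV h.verts u1 u2 u3 u4 ?_ u6 u7 u8 u10)
    fun s4 T4 hs4 h4 => ?_
  · have : (i + 1) * (n + 1) = i * (n + 1) + (n + 1) := by ring
    omega
  · obtain ⟨h5, h6⟩ := h4
    have hpot3 : potential inp k N 300 s3.mem ≤ potential inp k N 300 s2.mem := potential_mono u9
    have e29' : s4.reg 29 = 0 := (hs4.1 29 rfl).trans ((hs3.1 29 rfl).trans e29)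
    simp only [Expr.cost]
    exact ⟨by omega, Or.inr ⟨e29', by omega, _, h5⟩⟩

/-- The number `t` is not known in advance. Credit for `n + 1` rounds is granted, and what remains
at the end is subtracted, which leaves `t` iterations and the round in which the connectivity test
fails. -/
theorem mainLoop_spec {s : State} {far : ℕ → Fin n} (h : Head Q V0 inp k q0 N far 0 s)
    (h29 : s.reg 29 = 0) :
    WT inp W Z mainLoop s fun s' T => ∃ far t, Finished Q V0 inp k q0 N far t s' ∧
      T ≤ potential inp k N 300 s.mem + (t + 1) * (1500 * (Q.card * m)) + 3 := by
  have hW := S.word'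
  have hm := S.one_le
  have hQpos : 0 < Q.card := Finset.card_pos.2 ⟨q0, S.q0_mem⟩
  have hQm : m ≤ Q.card * m := Nat.le_mul_of_pos_left m hQpos
  have hcost : (500 * Q.card + 900) * m = 500 * (Q.card * m) + 900 * m := by ring
  generalize hB : 1500 * (Q.card * m) = B
  have key := WT.while (inp := inp) (W := W) (Z := Z) (e := .reg 29) (f := .lit 1) (c := iteration)
    (s := s) (fun s1 p => ∃ far i, i ≤ n ∧
      ((s1.reg 29 = 0 ∧ Head Q V0 inp k q0 N far i s1 ∧
        p = potential inp k N 300 s1.mem + (n + 1 - i) * B) ∨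
      (s1.reg 29 = 1 ∧ Finished Q V0 inp k q0 N far i s1 ∧
        p = potential inp k N 300 s1.mem + (n - i) * B)))
    (p := potential inp k N 300 s.mem + (n + 1) * B)
    ⟨far, 0, by omega, Or.inl ⟨h29, h, rfl⟩⟩ ?_ ?_
  · refine WT.mono key fun s' T _ h => ?_
    obtain ⟨p', ⟨far', t, ht, h1⟩, h2, h3⟩ := h
    simp only [Expr.val] at h2
    simp only [Expr.cost] at h3
    rcases h1 with ⟨h4, -⟩ | ⟨-, h4, h5⟩
    · omega
    · refine ⟨far', t, h4, ?_⟩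
      obtain ⟨d, rfl⟩ : ∃ d, n = t + d := ⟨n - t, by omega⟩
      have e1 : t + d - t = d := by omega
      rw [e1] at h5
      have e2 : (t + d + 1) * B = (t + 1) * B + d * B := by ring
      omega
  · rintro s1 p - ⟨far', i, -, h1⟩
    simp only [Expr.Fits]
    omega
  · rintro s1 p - ⟨far', i, hin, h1⟩ hg
    simp only [Expr.val] at hg
    obtain ⟨h29', hhead, hp⟩ := h1.resolve_right (by omega)
    refine WT.mono (iteration_spec S hhead h29' hin) fun s2 T _ h2 => ?_
    obtain ⟨hT, h3⟩ := h2
    simp only [Expr.cost]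
    have e1 : (n + 1 - i) * B = (n - i) * B + B := by
      have : n + 1 - i = n - i + 1 := by omega
      rw [this]
      ring
    rcases h3 with ⟨h4, h5⟩ | ⟨h4, h5, far'', h6⟩
    · exact ⟨_, ⟨far', i, hin, Or.inr ⟨h4, h5, rfl⟩⟩, by omega⟩
    · refine ⟨_, ⟨far'', i + 1, h5, Or.inl ⟨h4, h6, rfl⟩⟩, ?_⟩
      have e2 : n + 1 - (i + 1) = n - i := by omega
      rw [e2]
      omega

omit S

/-- The whole program. -/
def program : Com :=
  .seq findLevel (.seq edgeTable (.seq initSup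
    (.seq (.assign 27 (.add (.reg 4) (.lit 1))) mainLoop)))

theorem comp_core : comp (core G Q q0) q0 = core G Q q0 :=
  le_antisymm (comp_le _ _) fun _ _ h => ⟨h, comp_reachable_iff.2 h.2⟩

include S

/-- Level search, initial supports and the cascades contribute `O((ρ + 1)m)`, the edge table `O(m)`,
and the other work of the main loop `O((t + 1)|Q|m)`. -/
theorem program_spec (hm : numEdges (ofGraph (core G Q q0) (core_le q0)) = m) :
    WT inp W Z program State.zero fun s T => ∃ r : BasicRun G Q, Records r s ∧
      r.graph 0 = ofGraph (core G Q q0) (core_le q0) ∧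
      T ≤ 10000 * ((Q.card * r.t + arboricity (ofGraph (core G Q q0) (core_le q0))) * m) := by
  have hW := S.word'
  have hm1 := S.one_le
  have hn' : 2 ≤ Fintype.card (Fin n) := by simpa using S.two_le
  have hsuppq : q0 ∈ (core G Q q0).support := subset_support_core S.conn hn' S.q0_mem S.q0_mem
  have hreach : ∀ q ∈ Q, (core G Q q0).Reachable q0 q := fun q hq =>
    comp_reachable_iff.2 (reachable_level S.conn hn' S.q0_mem hq)
  set ρ := arboricity (ofGraph (core G Q q0) (core_le q0)) with hρ
  refine WT.seq (WT.mono (findLevel_spec S) fun s1 T1 hs1 h1 => ?_)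
  obtain ⟨hT1, r0, r4, r5, r6, L, st, hst, hL⟩ := h1
  refine WT.seq (WT.mono (edgeTable_spec S r0 (hs1.1 3 rfl) r4 hL
    fun v _ => by rw [hs1.2 13 rfl]; rfl) fun s2 T2 hs2 h2 => ?_)
  obtain ⟨hT2, r3, hE⟩ := h2
  obtain ⟨N, N1, N2⟩ := hE.exists_numbering q0
  have hR2 : Ready Q V0 inp k q0 N s2 := ⟨(hs2.1 0 rfl).trans r0, r3, (hs2.1 4 rfl).trans r4,
    (hs2.1 5 rfl).trans r5, (hs2.1 6 rfl).trans r6, N1, fun e he => (N2 e he).1,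
    fun e he => (N2 e he).2, hE.deg⟩
  have a9 : ∀ e, s2.mem 9 e = 0 := fun e => by rw [hs2.2 9 rfl, hs1.2 9 rfl]; rfl
  have a10 : ∀ e, s2.mem 10 e = 0 := fun e => by rw [hs2.2 10 rfl, hs1.2 10 rfl]; rfl
  refine WT.seq (WT.mono (initSup_spec S hR2 (fun e _ => a9 e) fun e _ => a10 e)
    fun s3 T3 hs3 h3 => ?_)
  obtain ⟨hT3, hsup⟩ := h3
  have hR3 : Ready Q V0 inp k q0 N s3 := hR2.same hs3 rfl
  have b9 : ∀ e, s3.mem 9 e = 0 := fun e => by rw [hs3.2 9 rfl, a9]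
  have hassign : WP inp W Z (.assign 27 (.add (.reg 4) (.lit 1))) s3 4 fun s4 =>
      s4 = s3.setReg 27 (n + 1) := by
    refine WP.straight ?_ (by simp)
    simp [hR3.size]
    omega
  refine WT.seq (WT.mono hassign fun s4 T4 _ h4 => ?_)
  obtain ⟨hT4, rfl⟩ := h4
  set s4 := s3.setReg 27 (n + 1) with hs4
  have hpres : present N s4.mem = core G Q q0 := by
    refine le_antisymm (present_le_core N _) fun v w h => ⟨h, ?_⟩
    simp [hs4, b9]
  have hsupp : ∀ f < m, s4.mem 10 f = N.supp (fun g => s4.mem 9 g < 2) f := by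
    intro f hf
    refine (hsup f hf).trans (N.supp_congr (fun g _ => ?_) f)
    simp [hs4, b9]
  have hhead : Head Q V0 inp k q0 N (fun _ => q0) 0 s4 := by
    refine ⟨hR3.setReg (by omega), ?_, ⟨fun f _ => Or.inl (b9 f), fun f hf _ => ⟨hsupp f hf, ?_⟩⟩,
      ?_, ?_, ?_, ?_, ?_⟩
    · simp only [hs4, State.reg_setReg, Nat.reduceEqDiff, if_false]
      rw [hs3.1 1 rfl, hs2.1 1 rfl, hs1.1 1 rfl]
      rfl
    · rw [hsupp f hf]
      change k ≤ common (present N s4.mem) _ _ + 2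
      rw [hpres, S.level_eq]
      exact isTruss_core (Q := Q) q0 _ _ (N.adj f hf)
    · simp only [hpres]
      rw [queryPart_ofGraph _ S.q0_mem hsuppq hreach]
      simp only [comp_core]
      rfl
    · refine (Nat.add_zero _).le.trans ?_
      rw [← Set.ncard_coe_finset]
      refine Set.ncard_le_ncard (fun v hv => ?_) (Set.toFinite _)
      obtain ⟨w, hw⟩ := hv
      exact (S.core_mem hw).1
    · have e6 : s4.mem 6 = s1.mem 6 := (hs3.2 6 rfl).trans (hs2.2 6 rfl)
      have e7 : s4.reg 7 = s1.reg 7 := by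
        simp only [hs4, State.reg_setReg, Nat.reduceEqDiff, if_false]
        exact (hs3.1 7 rfl).trans (hs2.1 7 rfl)
      rw [e6, e7, hL.stamp]
      exact hL.queued.stamp_le
    · have e7 : s4.reg 7 = s1.reg 7 := by
        simp only [hs4, State.reg_setReg, Nat.reduceEqDiff, if_false]
        exact (hs3.1 7 rfl).trans (hs2.1 7 rfl)
      have := hL.stamp
      omega
    · refine ⟨by simp, by simp, by simp, by simp, fun f _ => ?_, by simp, by simp,
        Or.inl ⟨rfl, by simp [hs4]⟩, by simp, by simp [hs4]⟩
      change s3.mem 2 f ≤ 0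
      rw [hs3.2 2 rfl, hs2.2 2 rfl, hs1.2 2 rfl]
      exact le_rfl
  have h29 : s4.reg 29 = 0 := by
    simp only [hs4, State.reg_setReg, Nat.reduceEqDiff, if_false]
    rw [hs3.1 29 rfl, hs2.1 29 rfl, hs1.1 29 rfl]
    rfl
  refine WT.mono (mainLoop_spec S hhead h29) fun s5 T5 hs5 h5 => ?_
  obtain ⟨far, t, ⟨hR5, e1, hhalted, hh⟩, hT5⟩ := h5
  obtain ⟨r, hr1, hr2, hr3⟩ := hh.records S.conn S.two_le S.q0_mem hhalted
    (hR5.level.trans S.level_eq) e1 hR5.edges hm hR5.lo hR5.hi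
  refine ⟨r, hr1, hr3, ?_⟩
  -- Together with `|Q| ≥ 1` this absorbs all terms `m` and `|Q|m` into `|Q|tm`.
  have ht : 1 ≤ r.t := by
    have := r.best_lt
    omega
  rw [hr2] at ht ⊢
  have hQpos : 0 < Q.card := Finset.card_pos.2 ⟨q0, S.q0_mem⟩
  have hpot : potential inp k N 300 s4.mem ≤ 300 * ((2 * ρ + 1) * m) := by
    refine le_trans ?_ (Nat.mul_le_mul_left 300 (sum_weight_le S (N := N)))
    rw [Finset.mul_sum]
    refine Finset.sum_le_sum fun f _ => ?_
    split_ifs <;> omega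
  have c1 : 1 * m ≤ Q.card * t * m := Nat.mul_le_mul_right m (Nat.mul_pos hQpos ht)
  have c2 : Q.card * m * 1 ≤ Q.card * m * t := Nat.mul_le_mul_left _ ht
  have c3 : (Q.card * t + ρ) * m = Q.card * t * m + ρ * m := by ring
  have c4 : (2 * ρ + 2) * m = 2 * (ρ * m) + 2 * m := by ring
  have c5 : (2 * ρ + 1) * m = 2 * (ρ * m) + m := by ring
  have c6 : (t + 1) * (1500 * (Q.card * m)) = 1500 * (Q.card * m * t) + 1500 * (Q.card * m) := by
    ring
  have c7 : Q.card * m * t = Q.card * t * m := by ring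
  rw [← hρ] at hT1 hT3
  omega

end Run


/-! ### Degree sum of the core, touched cells and word size -/

section Assembly

open SimpleGraph

variable {n : ℕ} {G : SimpleGraph (Fin n)} {Q : Finset (Fin n)} {inp : Input}

theorem numEdges_ofGraph {P : SimpleGraph (Fin n)} (hP : P ≤ G) :
    numEdges (ofGraph P hP) = {x : Fin n × Fin n | P.Adj x.1 x.2 ∧ x.1 < x.2}.ncard := by
  have h : (ofGraph P hP).edgeSet =
      (fun x : Fin n × Fin n => s(x.1, x.2)) '' {x | P.Adj x.1 x.2 ∧ x.1 < x.2} := by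
    ext e
    induction e using Sym2.ind with
    | _ u v =>
      constructor
      · intro h
        have h' : P.Adj u v := h
        rcases lt_or_gt_of_ne h'.ne with hlt | hlt
        · exact ⟨(u, v), ⟨h', hlt⟩, rfl⟩
        · exact ⟨(v, u), ⟨h'.symm, hlt⟩, Sym2.eq_swap⟩
      · rintro ⟨x, ⟨h1, -⟩, hx⟩
        rw [← hx]
        exact h1
  rw [numEdges, h, Set.InjOn.ncard_image]
  rintro ⟨a, b⟩ ⟨-, h1⟩ ⟨c, d⟩ ⟨-, h2⟩ h
  simp only [Sym2.eq_iff] at h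
  simp only at h1 h2
  rcases h with ⟨rfl, rfl⟩ | ⟨rfl, rfl⟩
  · rfl
  · exact absurd h1 h2.asymm

theorem numEdges_ofGraph_eq_edgeFinset {P : SimpleGraph (Fin n)} (hP : P ≤ G) [Fintype P.edgeSet] :
    numEdges (ofGraph P hP) = P.edgeFinset.card := by
  have h : (ofGraph P hP).edgeSet = P.edgeSet := by
    ext e
    induction e using Sym2.ind with
    | _ u v => exact Iff.rfl
  rw [numEdges, h, ← Set.ncard_coe_finset, coe_edgeFinset]

/-- The cells that the program may touch. -/
def cells (inp : Input) (V0 : Finset (Fin n)) (k m : ℕ) : Finset (ℕ × ℕ) :=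
  Finset.range 14 ×ˢ (Finset.range (2 * m + 1) ∪ V0.image (fun v : Fin n => (v : ℕ)) ∪
    V0.biUnion fun v : Fin n => (nb n inp k v).image fun w : Fin n => (v : ℕ) * n + w)

/-- Each of the `14` arrays is used at `2m + 1` small indices, at most `2m` vertices and at most
`2m` ordered pairs, and `14(6m + 1) ≤ 98m`. -/
theorem card_cells_le {V0 : Finset (Fin n)} {k m : ℕ} (hm : 1 ≤ m) (hV : V0.card ≤ 2 * m)
    (hd : ∑ v ∈ V0, (nb n inp k v).card = 2 * m) : (cells inp V0 k m).card ≤ 98 * m := by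
  have h1 : (V0.biUnion fun v : Fin n => (nb n inp k v).image fun w : Fin n => (v : ℕ) * n + w).card ≤ 2 * m :=
    (Finset.card_biUnion_le.trans (Finset.sum_le_sum fun v _ => Finset.card_image_le)).trans hd.le
  have h2 : (V0.image fun v : Fin n => (v : ℕ)).card ≤ 2 * m := Finset.card_image_le.trans hV
  have h3 := Finset.card_union_le (Finset.range (2 * m + 1) ∪ V0.image (fun v : Fin n => (v : ℕ)))
    (V0.biUnion fun v : Fin n => (nb n inp k v).image fun w : Fin n => (v : ℕ) * n + w)
  have h4 := Finset.card_union_le (Finset.range (2 * m + 1)) (V0.image fun v : Fin n => (v : ℕ))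
  rw [Finset.card_range] at h4
  rw [cells, Finset.card_product, Finset.card_range]
  omega

theorem exists_setting (hI : IsTrussIndex G inp) (hL : IsQueryList Q inp) (hG : G.Connected)
    (hn : 2 ≤ n) (hQ : Q.Nonempty) {W : ℕ} (hW : 10 * ((n + 3) * (n + 3)) ≤ W) :
    ∃ (V0 : Finset (Fin n)) (q0 : Fin n) (qu : ℕ → Fin n),
      Setting G Q inp W (cells inp V0 (maxTrussness G Q)
        (numEdges (ofGraph (core G Q q0) (core_le q0)))) V0 (maxTrussness G Q)
        (numEdges (ofGraph (core G Q q0) (core_le q0))) q0 qu := by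
  classical
  have hn' : 2 ≤ Fintype.card (Fin n) := by simpa using hn
  have hk : 2 ≤ maxTrussness G Q := two_le_maxTrussness hG hn'
  have hqu : ∀ i, ∃ q : Fin n, i < Q.card → inp .query i 0 = q ∧ q ∈ Q := by
    intro i
    by_cases hi : i < Q.card
    · obtain ⟨q, hq, he⟩ := hL.query.mapsTo hi
      exact ⟨q, fun _ => ⟨he.symm, hq⟩⟩
    -- A default vertex for positions beyond the end of the query list.
    · exact ⟨⟨0, by omega⟩, fun h => absurd h hi⟩
  choose qu hqu using hqu
  have hpos : 0 < Q.card := hQ.card_pos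
  obtain ⟨q0, hq0⟩ : ∃ q0, q0 = qu 0 := ⟨_, rfl⟩
  have hq0Q : q0 ∈ Q := hq0 ▸ (hqu 0 hpos).2
  obtain ⟨k, hkk⟩ : ∃ k, k = maxTrussness G Q := ⟨_, rfl⟩
  obtain ⟨V0, hV0⟩ : ∃ V0 : Finset (Fin n), ∀ v, v ∈ V0 ↔ (level G k).Reachable q0 v :=
    ⟨Finset.univ.filter fun v => (level G k).Reachable q0 v, fun v => by simp⟩
  rw [← hkk] at hk
  obtain ⟨m, hm⟩ : ∃ m, m = numEdges (ofGraph (core G Q q0) (core_le q0)) := ⟨_, rfl⟩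
  have hcore : ∀ v w, (core G Q q0).Adj v w ↔ v ∈ V0 ∧ w ∈ nb n inp k v := by
    intro v w
    rw [hV0, mem_nb_iff hI (by omega : 1 ≤ k), hkk]
    exact and_comm
  have hsupp : ∀ v ∈ V0, v ∈ (core G Q q0).support := fun v hv =>
    mem_support_comp (mem_support_level hG hn' hq0Q) (hkk ▸ (hV0 v).1 hv)
  have hsub : ∀ q ∈ Q, q ∈ V0 := fun q hq => (hV0 q).2 (hkk ▸ reachable_level hG hn' hq0Q hq)
  have hsum : ∑ v ∈ V0, (nb n inp k v).card = 2 * m := by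
    rw [hm, numEdges_ofGraph_eq_edgeFinset, ← sum_degrees_eq_twice_card_edges]
    rw [← Finset.sum_subset (Finset.subset_univ V0)]
    · refine Finset.sum_congr rfl fun v hv => ?_
      rw [← card_neighborFinset_eq_degree]
      congr 1
      ext w
      rw [mem_neighborFinset, hcore]
      exact ⟨fun h => ⟨hv, h⟩, fun h => h.2⟩
    · intro v _ hv
      rw [← card_neighborFinset_eq_degree, Finset.card_eq_zero, Finset.eq_empty_iff_forall_notMem]
      intro w hw
      rw [mem_neighborFinset, hcore] at hw
      exact hv hw.1
  have hnbpos : ∀ v ∈ V0, 1 ≤ (nb n inp k v).card := fun v hv => by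
    obtain ⟨w, hw⟩ := hsupp v hv
    exact Finset.card_pos.2 ⟨w, ((hcore v w).1 hw).2⟩
  have hcard : V0.card ≤ 2 * m := by
    rw [← hsum, Finset.card_eq_sum_ones]
    exact Finset.sum_le_sum hnbpos
  have hone : 1 ≤ m := by
    have := Finset.card_pos.2 ⟨q0, hsub q0 hq0Q⟩
    omega
  have hle : 2 * m ≤ n * n := by
    rw [← hsum]
    calc _ ≤ ∑ v ∈ V0, n := Finset.sum_le_sum fun v _ => by
            simpa using Finset.card_le_univ (nb n inp k v)
      _ = V0.card * n := by simp
      _ ≤ n * n := Nat.mul_le_mul_right _ (by simpa using Finset.card_le_univ V0)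
  refine ⟨V0, q0, qu, ?_⟩
  rw [← hm, ← hkk]
  refine ⟨hI, hG, hn, hW, ⟨fun v hv w hw => ?_, by omega, hle, fun a ha v hv => ?_,
    fun a ha i hi => ?_, fun a ha v hv w hw => ?_⟩, hq0Q, hsub, fun i => hqu i, fun q hq => ?_,
    hq0 ▸ (hqu 0 hpos).1, hL.numQuery, hkk, hk, hcore, hsum, hcard, hone, hV0, ?_⟩
  · rw [hV0] at hv ⊢
    exact hv.trans ((mem_nb_iff hI (by omega : 1 ≤ k)).1 hw).reachable
  · refine Finset.mem_coe.2 (Finset.mem_product.2 ⟨Finset.mem_range.2 ha, ?_⟩)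
    exact Finset.mem_union_left _ (Finset.mem_union_right _ (Finset.mem_image_of_mem _ hv))
  · refine Finset.mem_coe.2 (Finset.mem_product.2 ⟨Finset.mem_range.2 ha, ?_⟩)
    refine Finset.mem_union_left _ (Finset.mem_union_left _ (Finset.mem_range.2 ?_))
    simp only
    omega
  · refine Finset.mem_coe.2 (Finset.mem_product.2 ⟨Finset.mem_range.2 ha, ?_⟩)
    exact Finset.mem_union_right _ (Finset.mem_biUnion.2 ⟨v, hv, Finset.mem_image_of_mem _ hw⟩)
  · obtain ⟨i, hi, he⟩ := hL.query.surjOn ⟨q, hq, rfl⟩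
    refine ⟨i, hi, Fin.ext ?_⟩
    rw [← (hqu i hi).1]
    exact he
  · rw [hm, numEdges_ofGraph]

/-- Words must hold pair indices up to `n²` and about `(n + 1)²` stamps. As `n ≥ 2`, the factor `n ^
8 ≥ 256` absorbs the constants, and a fixed exponent means `O(log n)` bits. -/
theorem word_bound {n C : ℕ} (hn : 2 ≤ n) (hC : 10 ≤ C) : 10 * ((n + 3) * (n + 3)) ≤ n ^ C := by
  have h1 : n ^ 10 ≤ n ^ C := Nat.pow_le_pow_right (by omega) hC
  have h2 : 2 ^ 8 ≤ n ^ 8 := Nat.pow_le_pow_left hn 8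
  have h3 : n ^ 10 = n ^ 8 * (n * n) := by ring
  nlinarith

end Assembly

end CTC

open CTC in
theorem theorem4 :
    ∃ (P : Com) (C : ℕ),
      ∀ (n : ℕ) (G : SimpleGraph (Fin n)) (Q : Finset (Fin n)),
        2 ≤ n → G.Connected → Q.Nonempty →
        -- the program `P` carries out the algorithm, within the claimed time and space
        (∀ inp : Input, IsTrussIndex G inp → IsQueryList Q inp →
          ∃ (r : BasicRun G Q) (s : State) (T : ℕ) (S : Finset (ℕ × ℕ)),
            Exec inp (n ^ C) P State.zero s T S ∧
            Records r s ∧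
            T ≤ C * ((Q.card * r.t + arboricity (r.graph 0)) * numEdges (r.graph 0)) ∧
            S.card ≤ C * numEdges (r.graph 0)) ∧
        -- bounds on the number of iterations and on the arboricity, in every execution
        (∀ r : BasicRun G Q,
          (r.t : ℝ) ≤ C * min (numVerts (r.graph 0) : ℝ) (numEdges (r.graph 0) / r.k) ∧
          arboricity (r.graph 0) ≤ maxDeg (r.graph 0) ∧
          (¬ (numVerts (r.graph 0) = 3 ∧ numEdges (r.graph 0) = 3) →
            (arboricity (r.graph 0) : ℝ) ≤ √(numEdges (r.graph 0) : ℝ))) := by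
  -- One constant serves as time factor, space factor, exponent of the word bound and factor in the
  -- bound on `t`; only the time bound comes near it.
  refine ⟨program, 10000, fun n G Q hn hG hQ => ⟨fun inp hI hL => ?_, fun r =>
    r.bounds hG (by simpa using hn) hQ (by norm_num)⟩⟩
  obtain ⟨V0, q0, qu, S⟩ := exists_setting hI hL hG hn hQ (word_bound hn (C := 10000) (by norm_num))
  obtain ⟨s, T, Y, hexec, hY, r, hr, h0, hT⟩ := program_spec S rfl
  refine ⟨r, s, T, Y, hexec, hr, ?_, ?_⟩
  · rw [h0]
    exact hT
  · rw [h0]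
    have h1 := Finset.card_le_card (Finset.coe_subset.1 hY)
    have h2 := card_cells_le S.one_le S.card_le S.sum_deg
    omega
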